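/- **Setting.** Let $f:(\mathbb R^2,0)\to(\mathbb R,0)$ be a real analytic germ, mini-regular in $x$: the order of $f(x,0)$ at $x=0$ is finite and equals the multiplicity $m(f)$ of $f$ at $0$. An *arc* at $0$ in $\mathbb R^2$ (or $\mathbb C^2$) is the image germ of a real analytic map germ $[0,\varepsilon)\to\mathbb R^2$ (or $\mathbb C^2$), $0\mapsto 0$, not identically $0$. The contact order $\mathcal O(\lambda,\mu)$ of two arcs is the order of $\mathrm{dist}(P,\mu)$, $P\in\lambda$, with respect to $|OP|$ (it is $\infty$ if $\lambda=\mu$). The $f$-height $h_f(\lambda)$ of a real arc $\lambda$ is the supremum of $\mathcal O(\lambda,\zeta)$ over the arcs $\zeta$ in $\mathbb C^2$ on which the complexification of $f$ vanishes. Write $\lambda\sim_f\mu$ if $\lambda=\mu$ or $h_f(\lambda)=h_f(\mu)<\mathcal O(\lambda,\mu)$; the classes $\lambda_f$ are called $f$-arcs. Let $\mathbb R^+_{*/f}$ (resp. $\mathbb R^-_{*/f}$) be the set of $f$-arcs of arcs in $y>0$ (resp. $y<0$) not tangent to the $x$-axis. Two $f$-arcs $\lambda_f,\mu_f$, both in $\mathbb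 R^+_{*/f}$ or both in $\mathbb R^-_{*/f}$, are bar equivalent if $\lambda_f=\mu_f$ or $h_f(\lambda)=h_f(\mu)=\mathcal O(\lambda,\mu)$; the classes $B$ are called bars, and $h(B):=h_f(\lambda)$ for $\lambda_f\in B$. An arc in $\pm y>0$ not tangent to the $x$-axis has an equation $x=\lambda(|y|)$, with $\lambda$ a convergent real fractional power series. If $h(B)<\infty$ then, for $\lambda_f\in B$, the part $\lambda_B$ of $\lambda$ made of the terms of exponent $<h(B)$ depends only on $B$; the coefficient $u$ of $|y|^{h(B)}$ in $\lambda$ is the *canonical coordinate* of $\lambda_f$, which is identified with $u$. One writes $f(\lambda(|y|),y)=I^B_f(u)\,|y|^{e}+\cdots$ with $I^B_f(u)\neq0$. For $g=f$ or $g=f_x$, a number $z\in\mathbb C$ is a *$B$-root* of $g$ if $g$ has a Newton–Puiseux root $x=\lambda_B(|y|)+z|y|^{h(B)}+\cdots$ (on the side $\pm y>0$ of $B$); the number of such roots, counted with multiplicities, is the multiplicity of $z$. The *critical points* of $f_*$ are the following $f$-arcs $\gamma_f$ in $\mathbb R^\pm_{*/f}$, with $B$ the bar of $\gamma_f$. (1)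 $h(B)<\infty$ and the canonical coordinate $c$ of $\gamma_f$ is a $B$-root of $f_x$; the multiplicity of the critical point is that of the $B$-root. (2) $h(B)=\infty$ (so $B=\{\gamma_f\}$) and $\gamma$ is a root of $f$ of multiplicity $m(B)\ge2$; its multiplicity as a critical point is $m(B)-1$. (3) $h(B)<\infty$, $f_x$ has $B$-roots but no real ones, and $\gamma_f$ is the $f$-arc in $B$ whose canonical coordinate is a real number $r(B)$, chosen (generically) once for each such $B$; its multiplicity is $1$. **Lemma.** (i) Let $B$ be a bar with $h(B)<\infty$. The exponent $e$ depends only on $B$, and there is a unique polynomial over $\mathbb R$, again denoted $I^B_f$, whose value at the canonical coordinate $u$ of each $f$-arc in $B$ is $I^B_f(u)$. The set $\{z_1,\dots,z_q\}\subset\mathbb C$ of $B$-roots of $f$ is finite, their multiplicities $m_i$ are finite, and $$I^B_f(x)=a\prod_{i=1}^q(x-z_i)^{m_i},\qquad 0\ne a\in\mathbb R .$$ Moreover, every $c\in\mathbb R$ with $I^B_f(c)\neq 0$ is the canonical coordinate of some $f$-arc in $B$. (ii) Let $h(B)<\infty$ and let $c=\gamma_f\in B$. Then $\gamma_f$ is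 a critical point of type (1) if and only if $\frac{d}{dx}I^B_f(c)=0\ne I^B_f(c)$, and its multiplicity then equals the multiplicity of $c$ as a root of $\frac{d}{dx}I^B_f$. (iii) For every choice of the numbers $r(B)$ in (3), the number of critical points of $f_*$ of types (1)–(3) in $\mathbb R^+_{*/f}$ is at most $m(f)-1$, and likewise in $\mathbb R^-_{*/f}$. -/

import Mathlib

open Filter Topology Asymptotics Polynomial
open scoped ENNReal NNReal

noncomputable section

/-! ### Arcs and contact order -/

/-- A parametrized arc at `0` in `𝕜²` (`𝕜 = ℝ` or `ℂ`): a germ at `0` of a real analytic map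
`[0, ε) → 𝕜²`, vanishing at `0` and not identically zero. Only the germ on `[0, ε)` is ever used. -/
structure Arc (𝕜 : Type) [RCLike 𝕜] where
  toFun : ℝ → EuclideanSpace 𝕜 (Fin 2)
  analytic : AnalyticAt ℝ toFun 0
  map_zero : toFun 0 = 0
  ne_zero : ¬ ∀ᶠ s in 𝓝[≥] (0 : ℝ), toFun s = 0

/-- The contact order of the loci of two arcs: the order of `dist(P, q)`, `P` on `p`, with respect
to `|OP|`, i.e. the largest `h` with `dist(P, q) = O(|OP| ^ h)`. It is `h` if
`dist(P, q) = a |OP| ^ h + ⋯` with `a > 0`, and `∞` if the two loci coincide. -/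
def contactOrder {𝕜 : Type} [RCLike 𝕜] (p q : ℝ → EuclideanSpace 𝕜 (Fin 2)) : ℝ≥0∞ :=
  ⨆ (h : ℝ≥0) (_ : ∀ᶠ ε in 𝓝[>] (0 : ℝ),
    (fun s => Metric.infDist (p s) (q '' Set.Ico 0 ε)) =O[𝓝[>] (0 : ℝ)]
      fun s => ‖p s‖ ^ (h : ℝ)), (h : ℝ≥0∞)

/-- Two parametrized arcs have the same geometric arc, as a germ of sets at `0`. -/
def SameLocus (l m : Arc ℝ) : Prop :=
  ∀ ε > 0, ∃ δ > 0, l.toFun '' Set.Ico 0 δ ⊆ m.toFun '' Set.Ico 0 ε ∧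
    m.toFun '' Set.Ico 0 δ ⊆ l.toFun '' Set.Ico 0 ε

/-! ### The function germ -/

/-- `F` is a complexification of (the germ at `0` of) the real analytic function `f`. -/
def IsComplexification (f : ℝ × ℝ → ℝ) (F : ℂ × ℂ → ℂ) : Prop :=
  AnalyticAt ℂ F 0 ∧ ∀ᶠ p in 𝓝 (0 : ℝ × ℝ), F ((p.1 : ℂ), (p.2 : ℂ)) = (f p : ℂ)

/-- The multiplicity `m(f)` of `f` at `0`: the order of the first nonzero Taylor term. -/
def mult (f : ℝ × ℝ → ℝ) : ℕ := sInf {k | iteratedFDeriv ℝ k f 0 ≠ 0}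

/-- `f` is mini-regular in `x`: regular in `x` of order `m(f)`. -/
def IsMiniRegular (f : ℝ × ℝ → ℝ) : Prop :=
  analyticOrderAt (fun x : ℝ => f (x, 0)) 0 = (mult f : ℕ∞)

/-- The partial derivative `f_x`. -/
def partialX (f : ℝ × ℝ → ℝ) : ℝ × ℝ → ℝ := fun p => deriv (fun x => f (x, p.2)) p.1

/-! ### `f`-arcs -/

/-- The set of arcs in `ℂ²` on which the complexification of `f` vanishes. -/
def complexZeroArcs (f : ℝ × ℝ → ℝ) : Set (Arc ℂ) :=
  {ζ | ∃ F, IsComplexification f F ∧ ∀ᶠ s in 𝓝[≥] (0 : ℝ), F (ζ.toFun s 0, ζ.toFun s 1) = 0}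

/-- A real arc regarded as an arc in `ℂ²`. -/
def complexPath (l : Arc ℝ) : ℝ → EuclideanSpace ℂ (Fin 2) :=
  fun s => !₂[(l.toFun s 0 : ℂ), (l.toFun s 1 : ℂ)]

/-- The `f`-height of a real arc. -/
def fHeight (f : ℝ × ℝ → ℝ) (l : Arc ℝ) : ℝ≥0∞ :=
  ⨆ ζ ∈ complexZeroArcs f, contactOrder (complexPath l) ζ.toFun

/-- The relation `∼_f`. (The first alternative only matters for arcs of infinite height.) -/
def ArcEquiv (f : ℝ × ℝ → ℝ) (l m : Arc ℝ) : Prop :=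
  SameLocus l m ∨ (fHeight f l = fHeight f m ∧ fHeight f l < contactOrder l.toFun m.toFun)

/-- The `f`-arc of `l`, as the set of all parametrizations of all arcs equivalent to `l`. -/
def fArc (f : ℝ × ℝ → ℝ) (l : Arc ℝ) : Set (Arc ℝ) := {m | ArcEquiv f l m}

/-- The arcs in `y > 0` (for `σ = 1`), resp. `y < 0` (for `σ = -1`), not tangent to the
`x`-axis. -/
def halfArcs (σ : ℤˣ) : Set (Arc ℝ) :=
  {l | (∀ᶠ s in 𝓝[>] (0 : ℝ), 0 < ((σ : ℤ) : ℝ) * l.toFun s 1) ∧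
    (fun s => l.toFun s 0) =O[𝓝[>] (0 : ℝ)] fun s => l.toFun s 1}

/-! ### Bars -/

/-- Bar equivalence of the `f`-arcs of `l` and `m`. -/
def BarEquiv (f : ℝ × ℝ → ℝ) (l m : Arc ℝ) : Prop :=
  fArc f l = fArc f m ∨
    (fHeight f l = fHeight f m ∧ fHeight f m = contactOrder l.toFun m.toFun)

/-- The `f`-bar containing the `f`-arc of `l`, as a set of `f`-arcs. Its height is
`fHeight f l`. -/
def bar (f : ℝ × ℝ → ℝ) (σ : ℤˣ) (l : Arc ℝ) : Set (Set (Arc ℝ)) :=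
  {c | ∃ m ∈ halfArcs σ, c = fArc f m ∧ BarEquiv f l m}

/-! ### Fractional power series -/

/-- A convergent fractional power series `∑ cₑ yᵉ`, with exponents `e` in `(1/d)ℕ` for some
`d ≥ 1`. -/
@[ext]
structure FracSeries (𝕜 : Type) [RCLike 𝕜] where
  coeff : ℝ → 𝕜
  convergent : ∃ d : ℕ, 0 < d ∧ (∀ e, coeff e ≠ 0 → ∃ n : ℕ, e = (n : ℝ) / d) ∧
    ∃ r : ℝ, 0 < r ∧ Summable fun n : ℕ => ‖coeff ((n : ℝ) / d)‖ * r ^ n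

/-- The sum of a fractional power series at a (small) `y > 0`. -/
def FracSeries.eval {𝕜 : Type} [RCLike 𝕜] (α : FracSeries 𝕜) (y : ℝ) : 𝕜 :=
  ∑' e : ℝ, (y ^ e) • α.coeff e

instance (𝕜 : Type) [RCLike 𝕜] : Nonempty (FracSeries 𝕜) :=
  ⟨⟨fun _ => 0, 1, one_pos, fun _ h => absurd rfl h, 1, one_pos, by simp [summable_zero]⟩⟩

/-- `x = α(|y|)` is the equation of the arc `l` (where `|y| = σ y` for `l` in `halfArcs σ`). -/
def IsArcSeries (σ : ℤˣ) (l : Arc ℝ) (α : FracSeries ℝ) : Prop :=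
  ∀ᶠ s in 𝓝[>] (0 : ℝ), l.toFun s 0 = α.eval (((σ : ℤ) : ℝ) * l.toFun s 1)

/-- The (unique) real fractional power series representing `l ∈ halfArcs σ`. -/
def arcSeries (σ : ℤˣ) (l : Arc ℝ) : FracSeries ℝ := Classical.epsilon (IsArcSeries σ l)

/-- The canonical coordinate of the `f`-arc of `l` in its bar, when the height `h` is finite:
the coefficient of `|y| ^ h` in the series of `l`. -/
def canonCoord (f : ℝ × ℝ → ℝ) (σ : ℤˣ) (l : Arc ℝ) : ℝ :=
  (arcSeries σ l).coeff (fHeight f l).toReal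

/-- `φ(y) = c yᵉ + ⋯` as `y → 0+`, with `c ≠ 0`. -/
def HasLeadingTerm (φ : ℝ → ℝ) (c e : ℝ) : Prop :=
  c ≠ 0 ∧ Tendsto (fun y => φ y / y ^ e) (𝓝[>] (0 : ℝ)) (𝓝 c)

/-- The polynomial `P` gives the function `I` on the bar `B` of `l`: for a single exponent `e`
and all `m` in `B`, with canonical coordinate `u` and series `m(y)`,
`f(m(y), y) = P(u) |y| ^ e + ⋯`, `P(u) ≠ 0`. -/
def IsInitialPoly (f : ℝ × ℝ → ℝ) (σ : ℤˣ) (l : Arc ℝ) (P : ℝ[X]) : Prop :=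
  ∃ e : ℝ, ∀ m ∈ halfArcs σ, fArc f m ∈ bar f σ l →
    HasLeadingTerm (fun y => f ((arcSeries σ m).eval y, ((σ : ℤ) : ℝ) * y))
      (P.eval (canonCoord f σ m)) e

/-! ### Newton–Puiseux roots and `B`-roots -/

/-- `x = ρ(|y|)`, `ρ(0) = 0`, is a Newton–Puiseux root of `g` (in `σ y > 0`) of multiplicity
greater than `j`. -/
def IsRootGT (g : ℝ × ℝ → ℝ) (σ : ℤˣ) (ρ : FracSeries ℂ) (j : ℕ) : Prop :=
  ρ.coeff 0 = 0 ∧ ∃ G, IsComplexification g G ∧ ∀ i ≤ j, ∀ᶠ y in 𝓝[>] (0 : ℝ),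
    iteratedDeriv i (fun x : ℂ => G (x, ((((σ : ℤ) : ℝ) * y : ℝ) : ℂ))) (ρ.eval y) = 0

/-- The Newton–Puiseux roots of `g` of the form `λ_B(y) + z y ^ h(B) + ⋯`, listed with their
multiplicities (a root `ρ` of multiplicity `k` yields the pairs `(ρ, 0), …, (ρ, k - 1)`). Here `B`
is the `f`-bar of `l`, and `λ_B` is the series of `l` without its terms of exponent `≥ h(B)`. -/
def bRoots (f g : ℝ × ℝ → ℝ) (σ : ℤˣ) (l : Arc ℝ) (z : ℂ) : Set (FracSeries ℂ × ℕ) :=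
  {p | (∀ e < (fHeight f l).toReal, p.1.coeff e = ((arcSeries σ l).coeff e : ℂ)) ∧
    p.1.coeff (fHeight f l).toReal = z ∧ IsRootGT g σ p.1 p.2}

/-- `z` is a `B`-root of `g`, where `B` is the `f`-bar of `l`. -/
def IsBRoot (f g : ℝ × ℝ → ℝ) (σ : ℤˣ) (l : Arc ℝ) (z : ℂ) : Prop :=
  (bRoots f g σ l z).Nonempty

/-- The multiplicity of the real arc `l` as a Newton–Puiseux root of `f`; this is `m(B)` when
`B` is the singleton bar of an arc of infinite height. -/
def rootMult (f : ℝ × ℝ → ℝ) (σ : ℤˣ) (l : Arc ℝ) : ℕ∞ :=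
  {p : FracSeries ℂ × ℕ | (∀ e, p.1.coeff e = ((arcSeries σ l).coeff e : ℂ)) ∧
    IsRootGT f σ p.1 p.2}.encard

/-! ### Critical points -/

/-- The `f`-arc of `γ`, lying in a bar `B` of finite height, is a critical point of multiplicity
`k ≥ 1` because its canonical coordinate is a `B`-root of `f_x` of multiplicity `k`. -/
def IsOrdinaryCritical (f : ℝ × ℝ → ℝ) (σ : ℤˣ) (γ : Arc ℝ) (k : ℕ) : Prop :=
  fHeight f γ ≠ ⊤ ∧ 1 ≤ k ∧ (bRoots f (partialX f) σ γ (canonCoord f σ γ : ℂ)).encard = k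

/-- The `f`-arc of `γ` is a critical point of multiplicity `k = m(B) - 1` because
it has infinite height, so that its bar `B` is a singleton, and `m(B) ≥ 2`. -/
def IsSingularCritical (f : ℝ × ℝ → ℝ) (σ : ℤˣ) (γ : Arc ℝ) (k : ℕ) : Prop :=
  fHeight f γ = ⊤ ∧ 1 ≤ k ∧ rootMult f σ γ = k + 1

/-- The `f`-arc of `γ`, lying in a bar `B` of finite height for which `f_x` has complex
`B`-roots but no real one, is the chosen critical point of `B`, the one whose canonical coordinate
is the (generic) number `r B`. -/
def IsGenericCritical (f : ℝ × ℝ → ℝ) (σ : ℤˣ) (r : Set (Set (Arc ℝ)) → ℝ) (γ : Arc ℝ) : Prop :=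
  fHeight f γ ≠ ⊤ ∧ (∃ z : ℂ, IsBRoot f (partialX f) σ γ z) ∧
    (∀ c : ℝ, ¬ IsBRoot f (partialX f) σ γ (c : ℂ)) ∧ canonCoord f σ γ = r (bar f σ γ)

/-- The critical points of `f_*` among the `f`-arcs in `σ y > 0`. -/
def criticalPoints (f : ℝ × ℝ → ℝ) (σ : ℤˣ) (r : Set (Set (Arc ℝ)) → ℝ) : Set (Set (Arc ℝ)) :=
  {c | ∃ γ ∈ halfArcs σ, c = fArc f γ ∧
    ((∃ k, IsOrdinaryCritical f σ γ k) ∨ (∃ k, IsSingularCritical f σ γ k) ∨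
      IsGenericCritical f σ r γ)}

end

/-!
The zero set of `f` is understood through the Newton–Puiseux theorem. It is proved by induction on
the order in `x`: after a translation by a root of the partial derivative the coefficient of `x`
vanishes, and then the polynomial of a side of the Newton polygon is not a power of a linear form,
so that a substitution lowers the order (`AnalyticAt.exists_newton_step`,
`AnalyticAt.exists_puiseux_root`). Dividing out one root at a time, the complexification of `f` is
a unit times `∏ᵢ (x - ρᵢ(|y|))` in each half plane (`AnalyticAt.exists_puiseuxFactors`,
`exists_puiseuxRoots`), with `m(f)` fractional power series `ρᵢ`; mini-regularity makes all of them
`O(|y|)` (`PuiseuxFactors.isBigO`). The same holds for `f_x`, with `m(f) - 1` series.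

An arc in a half plane not tangent to the `x`-axis is the graph of a real fractional power series
without terms of exponent less than `1` (`exists_isArcSeries`), and the contact order of two such
arcs is the order of the difference of their series (`contactOrder_eq_ord`). The height of an arc
is its greatest order of coincidence with one of the `ρᵢ` (`PuiseuxRoots.fHeight_eq`): a complex
zero close to a point of the arc lies on the graph of some `ρᵢ` at a complex parameter, and `ρᵢ(y)`
is a Lipschitz function of `y` for suitable branches of the `d`-th root
(`PuiseuxRoots.exists_dist_le`). Thus equality of `f`-arcs and membership in a bar become
conditions on orders of differences of fractional power series, which satisfy the ultrametric
inequality (`RootSystem.fArc_eq_iff`, `RootSystem.fArc_mem_bar_iff`).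

Let `B` be a bar of finite height `t`. Along a path `λ_B(y) + w yᵗ + o(yᵗ)` a factor `x - ρᵢ` has
the leading coefficient `w - zᵢ` if `ρᵢ` agrees with `λ_B` below `t` and has the coefficient `zᵢ`
at `t`, and a leading term independent of `w` otherwise. So the initial form of `f` along these
paths is `A ∏ (w - zᵢ)`, over the `B`-roots (`PuiseuxRoots.exists_initialForm`); its coefficients
are real, since `f` is real on real paths (`RootSystem.exists_initialPoly`). A real number `c` is
the canonical coordinate of an `f`-arc of `B` exactly if it is not a `B`-root, that is, if the
polynomial does not vanish at `c` (`RootSystem.fHeight_eq_iff`). Multiplying by the logarithmic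
derivative, whose leading term is `∑ (w - zᵢ)⁻¹`, shows that the initial form of `f_x` is the
derivative of that of `f`; it is also `A'` times the product over the `B`-roots of `f_x`, whence
the two have the same roots with the same multiplicities
(`exists_derivative_eq_C_mul_clusterPoly`).

For the bound on the number of critical points, each critical point is attached to one of the
`m(f) - 1` roots of `f_x`: a root that agrees with the arc beyond its height, or a root that leaves the
real plane at the height of the bar (`RootSystem.exists_root_of_mem_criticalPoints`). By the
ultrametric inequality a root of `f_x` is attached to at most one critical point
(`RootSystem.encard_criticalPoints_le`).
-/

/-! ### Power series in two variables -/

section TwoVariables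

variable {𝕜 : Type*} [NontriviallyNormedField 𝕜]

/-- The coefficient of `xⁱ yⁿ⁻ⁱ` in the homogeneous part of degree `n` of a power series in two
variables: the sum of the values of the `n`-linear form on all words with `i` letters `(1, 0)` and
`n - i` letters `(0, 1)`. -/
noncomputable def monomialCoeff (p : FormalMultilinearSeries 𝕜 (𝕜 × 𝕜) 𝕜) (n i : ℕ) : 𝕜 :=
  ∑ S ∈ Finset.powersetCard i (Finset.univ : Finset (Fin n)),
    p n (S.piecewise (fun _ => (1, 0)) fun _ => (0, 1))

lemma apply_eq_sum_monomialCoeff (p : FormalMultilinearSeries 𝕜 (𝕜 × 𝕜) 𝕜) (n : ℕ) (x y : 𝕜) :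
    p n (fun _ => (x, y)) =
      ∑ ij ∈ Finset.HasAntidiagonal.antidiagonal n,
        monomialCoeff p n ij.1 * x ^ ij.1 * y ^ ij.2 := by
  have h1 : (fun _ : Fin n => ((x, y) : 𝕜 × 𝕜)) =
      (fun _ => x • ((1, 0) : 𝕜 × 𝕜)) + fun _ => y • ((0, 1) : 𝕜 × 𝕜) := by
    ext i <;> simp
  have h2 (S : Finset (Fin n)) :
      p n (S.piecewise (fun _ => x • ((1, 0) : 𝕜 × 𝕜)) fun _ => y • ((0, 1) : 𝕜 × 𝕜)) =
        x ^ S.card * y ^ (n - S.card) *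
          p n (S.piecewise (fun _ => (1, 0)) fun _ => (0, 1)) := by
    have : (S.piecewise (fun _ => x • ((1, 0) : 𝕜 × 𝕜)) fun _ => y • ((0, 1) : 𝕜 × 𝕜)) =
        fun i => (S.piecewise (fun _ => x) (fun _ => y) i : 𝕜) •
          (S.piecewise (fun _ => ((1, 0) : 𝕜 × 𝕜)) (fun _ => (0, 1)) i) := by
      ext i <;> by_cases hi : i ∈ S <;> simp [hi]
    rw [this, ContinuousMultilinearMap.map_smul_univ, Finset.prod_piecewise]
    have hc : (Finset.univ \ S).card = n - S.card := by
      rw [Finset.card_sdiff_of_subset (Finset.subset_univ _), Finset.card_univ, Fintype.card_fin]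
    simp [hc]
  rw [h1, ContinuousMultilinearMap.map_add_univ, Finset.Nat.sum_antidiagonal_eq_sum_range_succ_mk,
    ← Finset.powerset_univ, Finset.sum_powerset, Finset.card_univ, Fintype.card_fin]
  refine Finset.sum_congr rfl fun i _ => ?_
  rw [monomialCoeff, Finset.sum_mul, Finset.sum_mul]
  refine Finset.sum_congr rfl fun S hS => ?_
  rw [h2, (Finset.mem_powersetCard.1 hS).2]
  ring

lemma norm_monomialCoeff_le (p : FormalMultilinearSeries 𝕜 (𝕜 × 𝕜) 𝕜) (n i : ℕ) :
    ‖monomialCoeff p n i‖ ≤ 2 ^ n * ‖p n‖ := by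
  have h1 (S : Finset (Fin n)) :
      ‖p n (S.piecewise (fun _ => (1, 0)) fun _ => (0, 1))‖ ≤ ‖p n‖ := by
    refine ((p n).le_opNorm _).trans ?_
    have : ∏ i, ‖S.piecewise (fun _ => ((1, 0) : 𝕜 × 𝕜)) (fun _ => (0, 1)) i‖ = 1 := by
      refine Finset.prod_eq_one fun i _ => ?_
      by_cases hi : i ∈ S <;> simp [hi, Prod.norm_def]
    rw [this, mul_one]
  refine (norm_sum_le _ _).trans ((Finset.sum_le_sum fun S _ => h1 S).trans ?_)
  rw [Finset.sum_const, nsmul_eq_mul]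
  gcongr
  have : (Finset.powersetCard i (Finset.univ : Finset (Fin n))).card ≤ 2 ^ n := by
    rw [Finset.card_powersetCard, Finset.card_univ, Fintype.card_fin]
    exact Nat.choose_le_two_pow n i
  exact_mod_cast this

/-- The power series in two variables with coefficients `c i j`. -/
noncomputable def twoVarSeries (c : ℕ → ℕ → 𝕜) : FormalMultilinearSeries 𝕜 (𝕜 × 𝕜) 𝕜 := fun n =>
  ∑ ij ∈ Finset.HasAntidiagonal.antidiagonal n, c ij.1 ij.2 •
    (ContinuousMultilinearMap.mkPiAlgebraFin 𝕜 n 𝕜).compContinuousLinearMap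
      fun k => if (k : ℕ) < ij.1 then ContinuousLinearMap.fst 𝕜 𝕜 𝕜
        else ContinuousLinearMap.snd 𝕜 𝕜 𝕜

lemma twoVarSeries_apply (c : ℕ → ℕ → 𝕜) (n : ℕ) (x y : 𝕜) :
    twoVarSeries c n (fun _ => (x, y)) =
      ∑ ij ∈ Finset.HasAntidiagonal.antidiagonal n, c ij.1 ij.2 * x ^ ij.1 * y ^ ij.2 := by
  rw [twoVarSeries, _root_.sum_apply]
  refine Finset.sum_congr rfl fun ij hij => ?_
  obtain ⟨i, j⟩ := ij
  obtain rfl : i + j = n := by simpa using hij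
  simp only [_root_.smul_apply,
    ContinuousMultilinearMap.compContinuousLinearMap_apply,
    ContinuousMultilinearMap.mkPiAlgebraFin_apply, smul_eq_mul, List.prod_ofFn, mul_assoc]
  congr 1
  rw [Fin.prod_univ_add]
  simp

lemma norm_twoVarSeries_le {c : ℕ → ℕ → 𝕜} {C K : ℝ}
    (hc : ∀ i j, ‖c i j‖ ≤ C * K ^ (i + j)) (n : ℕ) :
    ‖twoVarSeries c n‖ ≤ (n + 1) * (C * K ^ n) := by
  rw [twoVarSeries]
  refine (norm_sum_le_of_le (f := fun ij : ℕ × ℕ => c ij.1 ij.2 •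
    (ContinuousMultilinearMap.mkPiAlgebraFin 𝕜 n 𝕜).compContinuousLinearMap
      fun k => if (k : ℕ) < ij.1 then ContinuousLinearMap.fst 𝕜 𝕜 𝕜
        else ContinuousLinearMap.snd 𝕜 𝕜 𝕜) (n := fun _ => C * K ^ n) _ fun ij hij => ?_).trans ?_
  · have hsum : ij.1 + ij.2 = n := by simpa using hij
    rw [norm_smul]
    have h1 : ‖(ContinuousMultilinearMap.mkPiAlgebraFin 𝕜 n 𝕜).compContinuousLinearMap
        fun k => if (k : ℕ) < ij.1 then ContinuousLinearMap.fst 𝕜 𝕜 𝕜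
          else ContinuousLinearMap.snd 𝕜 𝕜 𝕜‖ ≤ 1 := by
      refine (ContinuousMultilinearMap.norm_compContinuousLinearMap_le _ _).trans ?_
      rw [ContinuousMultilinearMap.norm_mkPiAlgebraFin, one_mul]
      refine Finset.prod_le_one (fun _ _ => norm_nonneg _) fun k _ => ?_
      split_ifs
      · exact ContinuousLinearMap.norm_fst_le ..
      · exact ContinuousLinearMap.norm_snd_le ..
    calc _ ≤ ‖c ij.1 ij.2‖ * 1 := by gcongr
      _ ≤ C * K ^ n := by rw [mul_one, ← hsum]; exact hc _ _
  · simp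

/-- An analytic function of two variables is given by a double power series whose coefficients
grow at most geometrically. -/
lemma AnalyticAt.exists_twoVar_coeff {f : 𝕜 × 𝕜 → 𝕜} (hf : AnalyticAt 𝕜 f 0) :
    ∃ p : FormalMultilinearSeries 𝕜 (𝕜 × 𝕜) 𝕜, HasFPowerSeriesAt f p 0 ∧ ∃ C K : ℝ, 0 < K ∧
      ∀ i j, ‖monomialCoeff p (i + j) i‖ ≤ C * K ^ (i + j) := by
  obtain ⟨p, r, hp⟩ := hf
  refine ⟨p, ⟨r, hp⟩, ?_⟩
  obtain ⟨s, hs0, hs⟩ := ENNReal.lt_iff_exists_nnreal_btwn.1 (hp.r_pos.trans_le hp.r_le)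
  have hs0 : 0 < s := by exact_mod_cast hs0
  obtain ⟨C, hC, h⟩ := p.norm_mul_pow_le_of_lt_radius hs
  refine ⟨C, 2 / s, by positivity, fun i j => (norm_monomialCoeff_le p _ _).trans ?_⟩
  rw [div_pow, mul_div_assoc', le_div_iff₀ (by positivity)]
  calc _ = 2 ^ (i + j) * (‖p (i + j)‖ * (s : ℝ) ^ (i + j)) := by ring
    _ ≤ 2 ^ (i + j) * C := by gcongr; exact h _
    _ = _ := by ring

lemma twoVarSeries_radius_pos [CompleteSpace 𝕜] {c : ℕ → ℕ → 𝕜} {C K : ℝ}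
    (hK : 0 < K) (hc : ∀ i j, ‖c i j‖ ≤ C * K ^ (i + j)) :
    0 < (twoVarSeries c).radius := by
  have hC : 0 ≤ C := by simpa using (norm_nonneg _).trans (hc 0 0)
  have : ((Real.toNNReal (1 / (2 * K)) : ℝ≥0) : ℝ≥0∞) ≤ (twoVarSeries c).radius := by
    refine FormalMultilinearSeries.le_radius_of_bound _ C fun n => ?_
    rw [Real.coe_toNNReal _ (by positivity)]
    calc _ ≤ (n + 1) * (C * K ^ n) * (1 / (2 * K)) ^ n := by
          gcongr; exact norm_twoVarSeries_le hc n
      _ = C * ((n + 1) / 2 ^ n) := by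
          rw [div_pow, mul_pow, one_pow]; field_simp
      _ ≤ C * 1 := by
          gcongr
          rw [div_le_one (by positivity)]
          exact_mod_cast n.lt_two_pow_self
      _ = C := mul_one C
  refine lt_of_lt_of_le ?_ this
  simp [hK]

/-- The sum of a double power series whose coefficients grow at most geometrically. -/
noncomputable def twoVarSum (c : ℕ → ℕ → 𝕜) : 𝕜 × 𝕜 → 𝕜 := (twoVarSeries c).sum

lemma hasFPowerSeriesAt_twoVarSum [CompleteSpace 𝕜] {c : ℕ → ℕ → 𝕜} {C K : ℝ}
    (hK : 0 < K) (hc : ∀ i j, ‖c i j‖ ≤ C * K ^ (i + j)) :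
    HasFPowerSeriesAt (twoVarSum c) (twoVarSeries c) 0 :=
  ⟨_, (twoVarSeries c).hasFPowerSeriesOnBall (twoVarSeries_radius_pos hK hc)⟩

lemma HasFPowerSeriesAt.eventually_hasSum_diag {f : 𝕜 × 𝕜 → 𝕜}
    {p : FormalMultilinearSeries 𝕜 (𝕜 × 𝕜) 𝕜} (hp : HasFPowerSeriesAt f p 0) :
    ∀ᶠ v in 𝓝 (0 : 𝕜 × 𝕜), HasSum (fun n => ∑ ij ∈ Finset.HasAntidiagonal.antidiagonal n,
      monomialCoeff p (ij.1 + ij.2) ij.1 * v.1 ^ ij.1 * v.2 ^ ij.2) (f v) := by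
  filter_upwards [hp.eventually_hasSum] with v hv
  rw [zero_add] at hv
  refine HasSum.congr_fun hv fun n => ?_
  rw [show (fun _ : Fin n => v) = fun _ => (v.1, v.2) from rfl, apply_eq_sum_monomialCoeff]
  refine Finset.sum_congr rfl fun ij hij => ?_
  rw [Finset.HasAntidiagonal.mem_antidiagonal.1 hij]

lemma eventually_hasSum_twoVarSum [CompleteSpace 𝕜] {c : ℕ → ℕ → 𝕜} {C K : ℝ}
    (hK : 0 < K) (hc : ∀ i j, ‖c i j‖ ≤ C * K ^ (i + j)) :
    ∀ᶠ v in 𝓝 (0 : 𝕜 × 𝕜), HasSum (fun n => ∑ ij ∈ Finset.HasAntidiagonal.antidiagonal n,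
      c ij.1 ij.2 * v.1 ^ ij.1 * v.2 ^ ij.2) (twoVarSum c v) := by
  filter_upwards [(hasFPowerSeriesAt_twoVarSum hK hc).eventually_hasSum] with v hv
  rw [zero_add] at hv
  refine HasSum.congr_fun hv fun n => ?_
  rw [show (fun _ : Fin n => v) = fun _ => (v.1, v.2) from rfl, twoVarSeries_apply]

/-- Hadamard's lemma: `G(x, y) - G(0, y)` is divisible by `x` as an analytic function. -/
lemma AnalyticAt.exists_eq_add_fst_mul [CompleteSpace 𝕜] {f : 𝕜 × 𝕜 → 𝕜} (hf : AnalyticAt 𝕜 f 0) :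
    ∃ H : 𝕜 × 𝕜 → 𝕜, AnalyticAt 𝕜 H 0 ∧ ∀ᶠ v in 𝓝 (0 : 𝕜 × 𝕜), f v = f (0, v.2) + v.1 * H v := by
  obtain ⟨p, hp, C, K, hK, hc⟩ := hf.exists_twoVar_coeff
  have hc' : ∀ i j, ‖monomialCoeff p (i + 1 + j) (i + 1)‖ ≤ C * K * K ^ (i + j) := fun i j =>
    (hc (i + 1) j).trans (le_of_eq (by ring))
  refine ⟨twoVarSum fun i j => monomialCoeff p (i + 1 + j) (i + 1),
    (hasFPowerSeriesAt_twoVarSum hK hc').analyticAt, ?_⟩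
  have hlim : Tendsto (fun v : 𝕜 × 𝕜 => ((0 : 𝕜), v.2)) (𝓝 0) (𝓝 0) := by
    have : Continuous fun v : 𝕜 × 𝕜 => ((0 : 𝕜), v.2) := by fun_prop
    exact this.tendsto' 0 0 (by simp)
  filter_upwards [hp.eventually_hasSum_diag, hlim.eventually hp.eventually_hasSum_diag,
    eventually_hasSum_twoVarSum hK hc'] with v h1 h2 h3
  have h4 := h2.add ((hasSum_nat_add_iff (f := fun n => if n = 0 then 0 else
    v.1 * ∑ ij ∈ Finset.HasAntidiagonal.antidiagonal (n - 1),
      monomialCoeff p (ij.1 + 1 + ij.2) (ij.1 + 1) *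
      v.1 ^ ij.1 * v.2 ^ ij.2) 1).1 (by simpa using h3.mul_left v.1))
  refine (h1.unique (HasSum.congr_fun h4 fun n => ?_)).trans (by simp)
  rcases n with _ | n
  · simp
  · rw [Finset.Nat.antidiagonal_succ, Finset.sum_cons, Finset.sum_cons, Finset.sum_map,
      Finset.sum_map]
    have : ∑ x ∈ Finset.HasAntidiagonal.antidiagonal n,
        monomialCoeff p (x.1 + 1 + x.2) (x.1 + 1) * (0 : 𝕜) ^ (x.1 + 1) * v.2 ^ x.2 = 0 := by simp
    simp only [Function.Embedding.coe_prodMap, Function.Embedding.coeFn_mk, Prod.map_fst,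
      Prod.map_snd, Nat.succ_eq_add_one, Function.Embedding.refl_apply, this]
    simp only [pow_zero, add_zero, Nat.add_eq_zero_iff, one_ne_zero, and_false, if_false,
      Nat.add_sub_cancel, Finset.mul_sum]
    congr 1
    refine Finset.sum_congr rfl fun ij _ => ?_
    ring

end TwoVariables

/-! ### Complexification -/

/-- `G` vanishes at the origin to order at least `n`: it is bounded by `C Mⁿ` on all small balls of
radius `M`. -/
def OrderGE (n : ℕ) (G : ℂ × ℂ → ℂ) : Prop :=
  ∃ C : ℝ, ∀ᶠ M in 𝓝[>] (0 : ℝ), ∀ v, ‖v‖ ≤ M → ‖G v‖ ≤ C * M ^ n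

lemma eventually_closedBall_of_eventually {E : Type*} [SeminormedAddCommGroup E] {P : E → Prop}
    (h : ∀ᶠ v in 𝓝 (0 : E), P v) : ∀ᶠ M in 𝓝[>] (0 : ℝ), ∀ v, ‖v‖ ≤ M → P v := by
  obtain ⟨ε, hε, h⟩ := Metric.eventually_nhds_iff.1 h
  filter_upwards [Ioo_mem_nhdsGT hε] with M hM v hv
  exact h (by rw [dist_zero_right]; exact hv.trans_lt hM.2)

lemma orderGE_of_isBigO {n : ℕ} {G : ℂ × ℂ → ℂ} (h : G =O[𝓝 0] fun v => ‖v‖ ^ n) : OrderGE n G := by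
  obtain ⟨C, hC, h⟩ := h.exists_pos
  refine ⟨C, ?_⟩
  filter_upwards [eventually_closedBall_of_eventually h.bound] with M hM v hv
  refine (hM v hv).trans ?_
  rw [norm_pow, norm_norm]
  gcongr

/-- A homogeneous polynomial in two variables that vanishes identically has no nonzero
coefficient. -/
lemma monomialCoeff_eq_zero {p : FormalMultilinearSeries ℝ (ℝ × ℝ) ℝ} {n : ℕ}
    (h : ∀ v, p n (fun _ => v) = 0) {i : ℕ} (hi : i ≤ n) : monomialCoeff p n i = 0 := by
  have h1 : ∑ k ∈ Finset.range (n + 1), C (monomialCoeff p n k) * X ^ k = 0 := by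
    refine Polynomial.funext fun x => ?_
    have := h (x, 1)
    rw [apply_eq_sum_monomialCoeff, Finset.Nat.sum_antidiagonal_eq_sum_range_succ_mk] at this
    simpa [eval_finsetSum] using this
  have h2 := congrArg (fun P => P.coeff i) h1
  simpa [finsetSum_coeff, coeff_C_mul, coeff_X_pow, Nat.lt_succ_of_le hi] using h2

/-- The power series of `f`, read as a complex one, sums to a complexification; its homogeneous
parts of degree less than `mult f` vanish, which gives the order at the origin. -/
lemma exists_isComplexification {f : ℝ × ℝ → ℝ} (hf : AnalyticAt ℝ f 0) :
    ∃ F, IsComplexification f F ∧ OrderGE (mult f) F := by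
  obtain ⟨p, hp, C, K, hK, hc⟩ := hf.exists_twoVar_coeff
  set c : ℕ → ℕ → ℂ := fun i j => ((monomialCoeff p (i + j) i : ℝ) : ℂ) with hcdef
  have hc' : ∀ i j, ‖c i j‖ ≤ C * K ^ (i + j) := fun i j => by
    simpa [hcdef, Complex.norm_real] using hc i j
  refine ⟨twoVarSum c, ⟨(hasFPowerSeriesAt_twoVarSum hK hc').analyticAt, ?_⟩, ?_⟩
  · have hlim : Tendsto (fun v : ℝ × ℝ => ((v.1 : ℂ), (v.2 : ℂ))) (𝓝 0) (𝓝 0) := by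
      have : Continuous fun v : ℝ × ℝ => ((v.1 : ℂ), (v.2 : ℂ)) := by fun_prop
      exact this.tendsto' 0 0 (by simp)
    filter_upwards [hp.eventually_hasSum_diag, hlim.eventually (eventually_hasSum_twoVarSum hK hc')]
      with v h1 h2
    refine h2.unique (HasSum.congr_fun ((Complex.hasSum_ofReal (f := _)).2 h1) fun n => ?_)
    simp [hcdef]
  · have hzero : ∀ n < mult f, twoVarSeries c n = 0 := fun n hn => by
      have h0 : iteratedFDeriv ℝ n f 0 = 0 := by
        by_contra h
        exact (Nat.sInf_le (s := {k | iteratedFDeriv ℝ k f 0 ≠ 0}) h).not_gt hn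
      have h1 : ∀ v, p n (fun _ => v) = 0 := fun v => by
        obtain ⟨r, hr⟩ := hp
        have := hr.factorial_smul v n
        rw [h0] at this
        simpa [Nat.factorial_ne_zero] using this
      rw [twoVarSeries]
      refine Finset.sum_eq_zero fun ij hij => ?_
      rw [Finset.HasAntidiagonal.mem_antidiagonal] at hij
      rw [show c ij.1 ij.2 = 0 by simp [hcdef, hij, monomialCoeff_eq_zero h1 (by omega : ij.1 ≤ n)]]
      refine ContinuousMultilinearMap.ext fun v => ?_
      rw [_root_.smul_apply, zero_smul, _root_.zero_apply]
    refine orderGE_of_isBigO ?_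
    refine ((hasFPowerSeriesAt_twoVarSum hK hc').isBigO_sub_partialSum_pow (mult f)).congr
      (fun v => ?_) fun v => rfl
    rw [zero_add, FormalMultilinearSeries.partialSum,
      Finset.sum_eq_zero fun n hn => by rw [hzero n (Finset.mem_range.1 hn)]; simp, sub_zero]

lemma eventually_prodMk_zero {P : ℂ × ℂ → Prop} (h : ∀ᶠ v in 𝓝 (0 : ℂ × ℂ), P v) :
    ∃ ε > 0, ∀ x y : ℂ, ‖x‖ < ε → ‖y‖ < ε → P (x, y) := by
  obtain ⟨ε, hε, h⟩ := Metric.eventually_nhds_iff.1 h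
  exact ⟨ε, hε, fun x y hx hy => h (by simp [hx, hy])⟩

/-- A function of one complex variable that is analytic in a disc and vanishes on its real diameter
vanishes in the disc. -/
lemma eq_zero_of_eq_zero_on_real {φ : ℂ → ℂ} {ε : ℝ} (hφ : ∀ x, ‖x‖ < ε → AnalyticAt ℂ φ x)
    (h : ∀ x : ℝ, |x| < ε → φ x = 0) {x : ℂ} (hx : ‖x‖ < ε) : φ x = 0 := by
  have hε : 0 < ε := (norm_nonneg x).trans_lt hx
  have hA : AnalyticOnNhd ℂ φ (Metric.ball 0 ε) := fun z hz => hφ z (by simpa using hz)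
  have hfreq : ∃ᶠ z in 𝓝[≠] (0 : ℂ), φ z = 0 := by
    have ht : Tendsto (fun x : ℝ => (x : ℂ)) (𝓝[>] 0) (𝓝[≠] 0) := by
      refine tendsto_nhdsWithin_iff.2 ⟨?_, ?_⟩
      · exact (Complex.continuous_ofReal.tendsto' 0 0 (by simp)).mono_left nhdsWithin_le_nhds
      · filter_upwards [self_mem_nhdsWithin] with x hx
        simpa using (ne_of_gt hx)
    refine ht.frequently (Eventually.frequently ?_)
    filter_upwards [Ioo_mem_nhdsGT hε] with x hx
    exact h x (by rw [abs_of_pos hx.1]; exact hx.2)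
  have := hA.eqOn_zero_of_preconnected_of_frequently_eq_zero (convex_ball 0 ε).isPreconnected
    (by simpa using hε) hfreq
  exact this (by simpa using hx)

lemma AnalyticAt.exists_forall_norm_lt {G : ℂ × ℂ → ℂ} (hG : AnalyticAt ℂ G 0) :
    ∃ ε > 0, ∀ x y : ℂ, ‖x‖ < ε → ‖y‖ < ε → AnalyticAt ℂ G (x, y) :=
  eventually_prodMk_zero hG.eventually_analyticAt

/-- The germ of the complexification is unique: the identity theorem is applied in each variable in
turn, first on real lines. -/
lemma IsComplexification.eventually_eq {f : ℝ × ℝ → ℝ} {F G : ℂ × ℂ → ℂ}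
    (hF : IsComplexification f F) (hG : IsComplexification f G) : ∀ᶠ v in 𝓝 0, F v = G v := by
  obtain ⟨ε₁, h₁, hA⟩ := (hF.1.sub hG.1).exists_forall_norm_lt
  obtain ⟨ε₂, h₂, hE⟩ := Metric.eventually_nhds_iff.1 (hF.2.and hG.2)
  set ε := min ε₁ ε₂
  have hε : 0 < ε := lt_min h₁ h₂
  have hreal : ∀ x y : ℝ, |x| < ε → |y| < ε → (F - G) ((x : ℂ), (y : ℂ)) = 0 := fun x y hx hy => by
    obtain ⟨h3, h4⟩ := hE (y := (x, y)) (by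
      rw [dist_zero_right, Prod.norm_def, Real.norm_eq_abs, Real.norm_eq_abs]
      exact max_lt (hx.trans_le (min_le_right _ _)) (hy.trans_le (min_le_right _ _)))
    simp only at h3 h4
    simp [h3, h4]
  have hA' : ∀ x y : ℂ, ‖x‖ < ε → ‖y‖ < ε → AnalyticAt ℂ (F - G) (x, y) := fun x y hx hy =>
    hA x y (hx.trans_le (min_le_left _ _)) (hy.trans_le (min_le_left _ _))
  have h3 : ∀ (x : ℂ) (y : ℝ), ‖x‖ < ε → |y| < ε → (F - G) (x, (y : ℂ)) = 0 := fun x y hx hy =>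
    eq_zero_of_eq_zero_on_real (φ := fun x => (F - G) (x, (y : ℂ)))
      (fun x hx => (hA' x y hx (by simpa [Complex.norm_real] using hy)).comp₂ analyticAt_id
        analyticAt_const) (fun x hx => hreal x y hx hy) hx
  have h4 : ∀ x y : ℂ, ‖x‖ < ε → ‖y‖ < ε → (F - G) (x, y) = 0 := fun x y hx hy =>
    eq_zero_of_eq_zero_on_real (φ := fun y => (F - G) (x, y))
      (fun y hy => (hA' x y hx hy).comp₂ analyticAt_const analyticAt_id)
      (fun y hy => h3 x y hx hy) hy
  refine Metric.eventually_nhds_iff.2 ⟨ε, hε, fun v hv => ?_⟩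
  rw [dist_zero_right, Prod.norm_def, max_lt_iff] at hv
  exact sub_eq_zero.1 (h4 v.1 v.2 hv.1 hv.2)

/-- The partial derivative in the first variable. -/
noncomputable def complexPartialX (F : ℂ × ℂ → ℂ) : ℂ × ℂ → ℂ :=
  fun p => deriv (fun x => F (x, p.2)) p.1

lemma complexPartialX_eq_fderiv {F : ℂ × ℂ → ℂ} {p : ℂ × ℂ} (hF : DifferentiableAt ℂ F p) :
    complexPartialX F p = fderiv ℂ F p (1, 0) := by
  have h1 : HasDerivAt (fun x : ℂ => (x, p.2)) ((1 : ℂ), (0 : ℂ)) p.1 :=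
    (hasDerivAt_id p.1).prodMk (hasDerivAt_const p.1 p.2)
  exact (HasFDerivAt.comp_hasDerivAt (f := fun x : ℂ => (x, p.2)) p.1 hF.hasFDerivAt h1).deriv

lemma analyticAt_complexPartialX {F : ℂ × ℂ → ℂ} (hF : AnalyticAt ℂ F 0) :
    AnalyticAt ℂ (complexPartialX F) 0 := by
  have h1 : AnalyticAt ℂ (fun p => fderiv ℂ F p (1, 0)) 0 :=
    (ContinuousLinearMap.apply ℂ ℂ ((1 : ℂ), (0 : ℂ))).analyticAt _ |>.comp hF.fderiv
  refine h1.congr ?_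
  filter_upwards [hF.eventually_analyticAt] with p hp
  exact (complexPartialX_eq_fderiv hp.differentiableAt).symm

lemma IsComplexification.partialX {f : ℝ × ℝ → ℝ} {F : ℂ × ℂ → ℂ} (hf : AnalyticAt ℝ f 0)
    (hF : IsComplexification f F) : IsComplexification (partialX f) (complexPartialX F) := by
  refine ⟨analyticAt_complexPartialX hF.1, ?_⟩
  have hlim : Tendsto (fun v : ℝ × ℝ => ((v.1 : ℂ), (v.2 : ℂ))) (𝓝 0) (𝓝 0) := by
    have : Continuous fun v : ℝ × ℝ => ((v.1 : ℂ), (v.2 : ℂ)) := by fun_prop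
    exact this.tendsto' 0 0 (by simp)
  filter_upwards [hF.2.eventually_nhds, hf.eventually_analyticAt,
    hlim.eventually hF.1.eventually_analyticAt] with p h1 h2 h3
  have hd1 : HasDerivAt (fun x : ℂ => F (x, (p.2 : ℂ))) (complexPartialX F ((p.1 : ℂ), (p.2 : ℂ)))
      (p.1 : ℂ) :=
    ((h3.comp₂ (f := fun x => x) analyticAt_id
      analyticAt_const).differentiableAt : DifferentiableAt ℂ
        (fun x : ℂ => F (x, (p.2 : ℂ))) (p.1 : ℂ)).hasDerivAt
  have hd2 : HasDerivAt (fun x : ℝ => f (x, p.2)) (_root_.partialX f p) p.1 :=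
    ((h2.comp₂ (f := fun x => x) (g := fun _ => p.2) (x := p.1) analyticAt_id
      analyticAt_const).differentiableAt : DifferentiableAt ℝ
        (fun x : ℝ => f (x, p.2)) p.1).hasDerivAt
  have h4 : (fun x : ℝ => F ((x : ℂ), (p.2 : ℂ))) =ᶠ[𝓝 p.1] fun x => (f (x, p.2) : ℂ) :=
    (Continuous.tendsto' (by fun_prop : Continuous fun x : ℝ => (x, p.2)) p.1 p rfl).eventually h1
  exact hd1.comp_ofReal.unique (hd2.ofReal_comp.congr_of_eventuallyEq h4)

/-- Cauchy's estimate for a directional derivative. -/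
lemma OrderGE.exists_norm_fderiv_le {n : ℕ} {G : ℂ × ℂ → ℂ} (hG : AnalyticAt ℂ G 0)
    (h : OrderGE (n + 1) G) {w : ℂ × ℂ} (hw : ‖w‖ ≤ 1) :
    ∃ C : ℝ, ∀ᶠ M in 𝓝[>] (0 : ℝ), ∀ v, ‖v‖ ≤ M → ‖fderiv ℂ G v w‖ ≤ C * M ^ n := by
  obtain ⟨C, hC⟩ := h
  have hdouble : Tendsto (fun M : ℝ => 2 * M) (𝓝[>] 0) (𝓝[>] 0) := by
    refine tendsto_nhdsWithin_iff.2 ⟨?_, ?_⟩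
    · exact (Continuous.tendsto' (by fun_prop) 0 0 (by simp)).mono_left nhdsWithin_le_nhds
    · filter_upwards [self_mem_nhdsWithin] with M hM
      simpa using hM
  refine ⟨C * 2 ^ (n + 1), ?_⟩
  filter_upwards [hdouble.eventually hC, self_mem_nhdsWithin,
    hdouble.eventually (eventually_closedBall_of_eventually hG.eventually_analyticAt)]
    with M h1 (hM : 0 < M) h2 v hv
  have hnorm : ∀ z : ℂ, ‖z‖ ≤ M → ‖v + z • w‖ ≤ 2 * M := fun z hz => by
    refine (norm_add_le _ _).trans ?_
    rw [norm_smul, two_mul]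
    exact add_le_add hv ((mul_le_mul hz hw (norm_nonneg _) hM.le).trans (by simp))
  have hd : ∀ z : ℂ, ‖z‖ ≤ M →
      HasDerivAt (fun z : ℂ => G (v + z • w)) (fderiv ℂ G (v + z • w) w) z := fun z hz => by
    have h3 : HasDerivAt (fun z : ℂ => v + z • w) w z := by
      simpa using ((hasDerivAt_id z).smul_const w).const_add v
    exact HasFDerivAt.comp_hasDerivAt (f := fun z : ℂ => v + z • w) z
      (h2 _ (hnorm z hz)).differentiableAt.hasFDerivAt h3
  have h4 := Complex.norm_deriv_le_of_forall_mem_sphere_norm_le (c := 0) (R := M)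
    (C := C * (2 * M) ^ (n + 1)) (f := fun z : ℂ => G (v + z • w)) hM
    (DifferentiableOn.diffContOnCl fun z hz => by
      rw [closure_ball _ hM.ne'] at hz
      exact (hd z (by simpa using hz)).differentiableAt.differentiableWithinAt)
    (fun z hz => h1 _ (hnorm z (by simpa using (mem_sphere_zero_iff_norm.1 hz).le)))
  rw [(hd 0 (by simpa using hM.le)).deriv, zero_smul, add_zero] at h4
  refine h4.trans (le_of_eq ?_)
  field_simp
  ring

lemma OrderGE.complexPartialX {n : ℕ} {G : ℂ × ℂ → ℂ} (hG : AnalyticAt ℂ G 0)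
    (h : OrderGE (n + 1) G) : OrderGE n (complexPartialX G) := by
  obtain ⟨C, hC⟩ := h.exists_norm_fderiv_le hG (w := (1, 0)) (by simp [Prod.norm_def])
  refine ⟨C, ?_⟩
  filter_upwards [hC, eventually_closedBall_of_eventually hG.eventually_analyticAt]
    with M h1 h2 v hv
  rw [complexPartialX_eq_fderiv (h2 v hv).differentiableAt]
  exact h1 v hv

/-- `G(x, y) - G(x, 0)` is `O(|y| Mⁿ)` on the ball of radius `M` if `G` vanishes to order
`n + 1`. -/
lemma OrderGE.exists_norm_sub_le {n : ℕ} {G : ℂ × ℂ → ℂ} (hG : AnalyticAt ℂ G 0)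
    (h : OrderGE (n + 1) G) :
    ∃ C : ℝ, ∀ᶠ M in 𝓝[>] (0 : ℝ), ∀ x y : ℂ, ‖x‖ ≤ M → ‖y‖ ≤ M →
      ‖G (x, y) - G (x, 0)‖ ≤ C * M ^ n * ‖y‖ := by
  obtain ⟨C, hC⟩ := h.exists_norm_fderiv_le hG (w := (0, 1)) (by simp [Prod.norm_def])
  refine ⟨C, ?_⟩
  filter_upwards [hC, eventually_closedBall_of_eventually hG.eventually_analyticAt]
    with M h1 h2 x y hx hy
  have hd : ∀ z ∈ Metric.closedBall (0 : ℂ) M,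
      HasDerivWithinAt (fun y => G (x, y)) (fderiv ℂ G (x, z) (0, 1)) (Metric.closedBall 0 M) z :=
    fun z hz => by
      have h3 : HasDerivAt (fun y : ℂ => (x, y)) ((0 : ℂ), (1 : ℂ)) z :=
        (hasDerivAt_const z x).prodMk (hasDerivAt_id z)
      refine (HasFDerivAt.comp_hasDerivAt (f := fun y : ℂ => (x, y)) z
        (h2 _ ?_).differentiableAt.hasFDerivAt h3).hasDerivWithinAt
      simpa [Prod.norm_def, hx] using hz
  have := (convex_closedBall (0 : ℂ) M).norm_image_sub_le_of_norm_hasDerivWithin_le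
    (C := C * M ^ n) hd (fun z hz => h1 _ (by simpa [Prod.norm_def, hx] using hz))
    (x := 0) (y := y) (by simpa using (norm_nonneg x).trans hx) (by simpa using hy)
  simpa using this

/-- The restriction of a complexification to the `x`-axis has the same order at `0` as `f(x, 0)`. -/
lemma IsComplexification.analyticOrderAt_eq {f : ℝ × ℝ → ℝ} {F : ℂ × ℂ → ℂ} (hf : AnalyticAt ℝ f 0)
    (hF : IsComplexification f F) {n : ℕ}
    (hn : analyticOrderAt (fun x : ℝ => f (x, 0)) 0 = n) :
    analyticOrderAt (fun x : ℂ => F (x, 0)) 0 = n := by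
  have hA : AnalyticAt ℝ (fun x : ℝ => f (x, 0)) 0 :=
    AnalyticAt.comp₂ (h := f) (f := fun x => x) (g := fun _ => (0 : ℝ)) (x := (0 : ℝ)) hf
      analyticAt_id analyticAt_const
  have hB : AnalyticAt ℂ (fun x : ℂ => F (x, 0)) 0 :=
    AnalyticAt.comp₂ (h := F) (f := fun x => x) (g := fun _ => (0 : ℂ)) (x := (0 : ℂ)) hF.1
      analyticAt_id analyticAt_const
  obtain ⟨g, hg, hg0, hgeq⟩ := hA.analyticOrderAt_eq_natCast.1 hn
  have hlim : Tendsto (fun x : ℝ => (x : ℂ)) (𝓝[>] 0) (𝓝 0) :=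
    (Complex.continuous_ofReal.tendsto' 0 0 (by simp)).mono_left nhdsWithin_le_nhds
  have hax : ∀ᶠ x : ℝ in 𝓝[>] 0, F ((x : ℂ), 0) = (f (x, 0) : ℂ) := by
    have : Tendsto (fun x : ℝ => (x, (0 : ℝ))) (𝓝[>] (0 : ℝ)) (𝓝 0) :=
      (Continuous.tendsto' (by fun_prop : Continuous fun x : ℝ => (x, (0 : ℝ))) 0 0 rfl).mono_left
        nhdsWithin_le_nhds
    simpa using this.eventually hF.2
  have hgC : Tendsto (fun x : ℝ => (g x : ℂ)) (𝓝[>] 0) (𝓝 ((g 0 : ℝ) : ℂ)) :=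
    (Complex.continuous_ofReal.tendsto _).comp
      (hg.continuousAt.tendsto.mono_left nhdsWithin_le_nhds)
  have hgne : ∀ᶠ x : ℝ in 𝓝[>] 0, g x ≠ 0 :=
    (hg.continuousAt.tendsto.mono_left nhdsWithin_le_nhds).eventually_ne hg0
  have hfin : analyticOrderAt (fun x : ℂ => F (x, 0)) 0 ≠ ⊤ := fun htop => by
    obtain ⟨x, h1, h2, h3, h4, h5⟩ :=
      ((hlim.eventually (analyticOrderAt_eq_top.1 htop)).and
        (hax.and ((hgeq.filter_mono nhdsWithin_le_nhds).and
          ((eventually_mem_nhdsWithin (s := Set.Ioi (0 : ℝ))).and hgne)))).exists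
    rw [h1] at h2
    rw [sub_zero, smul_eq_mul] at h3
    have : f (x, 0) = 0 := by exact_mod_cast h2.symm
    rw [h3] at this
    rcases mul_eq_zero.1 this with h | h
    · exact (pow_pos h4 n).ne' h
    · exact h5 h
  obtain ⟨N, hN⟩ := ENat.ne_top_iff_exists.1 hfin
  obtain ⟨H, hH, hH0, hHeq⟩ := hB.analyticOrderAt_eq_natCast.1 hN.symm
  have hHlim : Tendsto (fun x : ℝ => H (x : ℂ)) (𝓝[>] 0) (𝓝 (H 0)) :=
    hH.continuousAt.tendsto.comp hlim
  have key : ∀ᶠ x : ℝ in 𝓝[>] 0, 0 < x ∧ (x : ℂ) ^ n * (g x : ℂ) = (x : ℂ) ^ N * H x := by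
    filter_upwards [hax, hgeq.filter_mono nhdsWithin_le_nhds, hlim.eventually hHeq,
      self_mem_nhdsWithin] with x h1 h2 h3 h4
    refine ⟨h4, ?_⟩
    rw [sub_zero, smul_eq_mul] at h2 h3
    rw [← h3, h1, h2]
    push_cast
    rfl
  rw [← hN]
  have hcomp : ∀ {a b : ℕ} {u v : ℝ → ℂ} {v₀ : ℂ}, a < b → Tendsto u (𝓝[>] 0) (𝓝 v₀) → v₀ ≠ 0 →
      ∀ v₁, Tendsto v (𝓝[>] 0) (𝓝 v₁) →
      ¬ ∀ᶠ x : ℝ in 𝓝[>] 0, 0 < x ∧ (x : ℂ) ^ a * u x = (x : ℂ) ^ b * v x := by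
    intro a b u v v₀ hab hu hv₀ v₁ hv hev
    have h1 : Tendsto (fun x : ℝ => (x : ℂ) ^ (b - a) * v x) (𝓝[>] 0) (𝓝 0) := by
      simpa [(Nat.sub_pos_of_lt hab).ne'] using (hlim.pow (b - a)).mul hv
    refine hv₀ (tendsto_nhds_unique (hu.congr' ?_) h1)
    filter_upwards [hev] with x hx
    have hx0 : (x : ℂ) ≠ 0 := by exact_mod_cast hx.1.ne'
    refine mul_left_cancel₀ (pow_ne_zero a hx0) ?_
    rw [hx.2, ← mul_assoc, ← pow_add, Nat.add_sub_cancel' hab.le]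
  rcases lt_trichotomy n N with h | h | h
  · exact absurd key (hcomp h hgC (by exact_mod_cast hg0) _ hHlim)
  · rw [h]
  · refine absurd ?_ (hcomp h hHlim hH0 _ hgC)
    filter_upwards [key] with x hx
    exact ⟨hx.1, hx.2.symm⟩

/-! ### The Newton–Puiseux theorem -/

lemma AnalyticAt.axis {G : ℂ × ℂ → ℂ} (hG : AnalyticAt ℂ G 0) :
    AnalyticAt ℂ (fun x : ℂ => G (x, 0)) 0 :=
  AnalyticAt.comp₂ (h := G) (f := fun x => x) (g := fun _ => (0 : ℂ)) (x := (0 : ℂ)) hG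
    analyticAt_id analyticAt_const

lemma tendsto_axis : Tendsto (fun x : ℂ => (x, (0 : ℂ))) (𝓝 0) (𝓝 0) :=
  Continuous.tendsto' (by fun_prop : Continuous fun x : ℂ => (x, (0 : ℂ))) 0 0 rfl

/-- The analytic implicit function theorem in two variables. -/
lemma AnalyticAt.exists_implicit {K : ℂ × ℂ → ℂ} (hK : AnalyticAt ℂ K 0) (h0 : K 0 = 0)
    (hx : complexPartialX K 0 ≠ 0) :
    ∃ τ : ℂ → ℂ, AnalyticAt ℂ τ 0 ∧ τ 0 = 0 ∧ ∀ᶠ s in 𝓝 0, K (τ s, s) = 0 := by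
  rw [complexPartialX_eq_fderiv hK.differentiableAt] at hx
  set a := fderiv ℂ K 0 (1, 0) with ha
  set b := fderiv ℂ K 0 (0, 1) with hb
  have hlin : ∀ p : ℂ × ℂ, fderiv ℂ K 0 p = p.1 * a + p.2 * b := fun p => by
    have : p = p.1 • ((1 : ℂ), (0 : ℂ)) + p.2 • ((0 : ℂ), (1 : ℂ)) := by ext <;> simp
    conv_lhs => rw [this, map_add, map_smul, map_smul]
    simp [ha, hb]
  set A : ℂ × ℂ →L[ℂ] ℂ × ℂ := (fderiv ℂ K 0).prod (ContinuousLinearMap.snd ℂ ℂ ℂ) with hA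
  set B : ℂ × ℂ →L[ℂ] ℂ × ℂ := (a⁻¹ • (ContinuousLinearMap.fst ℂ ℂ ℂ -
    b • ContinuousLinearMap.snd ℂ ℂ ℂ)).prod (ContinuousLinearMap.snd ℂ ℂ ℂ) with hB
  let e : (ℂ × ℂ) ≃L[ℂ] (ℂ × ℂ) := ContinuousLinearEquiv.equivOfInverse A B
    (fun p => by
      ext
      · simp only [hA, hB, ContinuousLinearMap.prod_apply, hlin, _root_.smul_apply,
          _root_.sub_apply, ContinuousLinearMap.coe_fst', ContinuousLinearMap.coe_snd', smul_eq_mul]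
        field_simp
        ring
      · simp [hA, hB])
    (fun p => by
      ext
      · simp only [hA, hB, ContinuousLinearMap.prod_apply, hlin, _root_.smul_apply,
          _root_.sub_apply, ContinuousLinearMap.coe_fst', ContinuousLinearMap.coe_snd', smul_eq_mul]
        field_simp
        ring
      · simp [hA, hB])
  have hΦ : HasStrictFDerivAt (fun p : ℂ × ℂ => (K p, p.2)) (e : ℂ × ℂ →L[ℂ] ℂ × ℂ) 0 :=
    hK.hasStrictFDerivAt.prodMk hasStrictFDerivAt_snd
  have hΦA : AnalyticAt ℂ (fun p : ℂ × ℂ => (K p, p.2)) 0 := hK.prod analyticAt_snd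
  set Ψ := hΦ.toOpenPartialHomeomorph _ with hΨ
  have hΦ0 : (K 0, (0 : ℂ × ℂ).2) = 0 := by simp [h0]
  have hsymm0 : Ψ.symm 0 = 0 := by
    have := Ψ.left_inv hΦ.mem_toOpenPartialHomeomorph_source
    rwa [hΨ, HasStrictFDerivAt.toOpenPartialHomeomorph_coe, hΦ0, ← hΨ] at this
  have htarget : (0 : ℂ × ℂ) ∈ Ψ.target := by
    have := hΦ.image_mem_toOpenPartialHomeomorph_target
    rwa [hΦ0] at this
  have hΨA : AnalyticAt ℂ Ψ.symm 0 := by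
    refine Ψ.analyticAt_symm (i := e) htarget ?_ ?_
    · rw [hsymm0]; exact hΦA
    · rw [hsymm0]; exact hΦ.hasFDerivAt.fderiv
  have hlim : Tendsto (fun s : ℂ => ((0 : ℂ), s)) (𝓝 0) (𝓝 0) :=
    Continuous.tendsto' (by fun_prop : Continuous fun s : ℂ => ((0 : ℂ), s)) 0 0 rfl
  refine ⟨fun s => (Ψ.symm (0, s)).1, ?_, ?_, ?_⟩
  · have h1 : AnalyticAt ℂ (fun s : ℂ => Ψ.symm ((0 : ℂ), s)) 0 :=
      AnalyticAt.comp₂ (h := Ψ.symm) (f := fun _ => (0 : ℂ)) (g := fun s => s) (x := (0 : ℂ)) hΨA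
        analyticAt_const analyticAt_id
    exact analyticAt_fst.comp h1
  · change (Ψ.symm 0).1 = 0
    rw [hsymm0]
    rfl
  · filter_upwards [hlim.eventually (Ψ.open_target.mem_nhds htarget)] with s hs
    have h1 := Ψ.right_inv hs
    rw [hΨ, HasStrictFDerivAt.toOpenPartialHomeomorph_coe, ← hΨ] at h1
    have h2 : (Ψ.symm (0, s)).2 = s := congrArg Prod.snd h1
    have h3 : K (Ψ.symm (0, s)) = 0 := congrArg Prod.fst h1
    calc K ((Ψ.symm (0, s)).1, s) = K ((Ψ.symm (0, s)).1, (Ψ.symm (0, s)).2) := by rw [h2]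
      _ = 0 := h3

lemma analyticOrderAt_id_mul {g h : ℂ → ℂ} (hh : AnalyticAt ℂ h 0)
    (heq : ∀ᶠ x in 𝓝 0, g x = x * h x) : analyticOrderAt g 0 = 1 + analyticOrderAt h 0 := by
  rw [analyticOrderAt_congr (show g =ᶠ[𝓝 0] id * h from heq), analyticOrderAt_mul analyticAt_id hh,
    analyticOrderAt_id]

lemma order_axis_of_eq_fst_mul {G H : ℂ × ℂ → ℂ} (hH : AnalyticAt ℂ H 0)
    (heq : ∀ᶠ v in 𝓝 (0 : ℂ × ℂ), G v = v.1 * H v) {n : ℕ}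
    (hn : analyticOrderAt (fun x : ℂ => G (x, 0)) 0 = (n + 1 : ℕ)) :
    analyticOrderAt (fun x : ℂ => H (x, 0)) 0 = n := by
  rw [analyticOrderAt_id_mul hH.axis (tendsto_axis.eventually heq)] at hn
  push_cast at hn
  rw [add_comm] at hn
  exact (ENat.add_left_injective_of_ne_top ENat.one_ne_top) hn

/-- Expansion in powers of `x`, up to the order `n` of `G(x, 0)`. -/
lemma AnalyticAt.exists_taylor (n : ℕ) : ∀ {G : ℂ × ℂ → ℂ}, AnalyticAt ℂ G 0 →
    analyticOrderAt (fun x : ℂ => G (x, 0)) 0 = n →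
    ∃ (a : ℕ → ℂ → ℂ) (R : ℂ × ℂ → ℂ), (∀ k, AnalyticAt ℂ (a k) 0) ∧ (∀ k < n, a k 0 = 0) ∧
      AnalyticAt ℂ R 0 ∧ R 0 ≠ 0 ∧
      ∀ᶠ v in 𝓝 (0 : ℂ × ℂ), G v = ∑ k ∈ Finset.range n, a k v.2 * v.1 ^ k + v.1 ^ n * R v := by
  induction n with
  | zero =>
    intro G hG hn
    refine ⟨fun _ _ => 0, G, fun _ => analyticAt_const, fun _ _ => rfl, hG, ?_, by simp⟩
    exact hG.axis.analyticOrderAt_eq_zero.1 hn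
  | succ n ih =>
    intro G hG hn
    have hG0 : G 0 = 0 := apply_eq_zero_of_analyticOrderAt_ne_zero (f := fun x : ℂ => G (x, 0))
      (by rw [hn]; exact_mod_cast n.succ_ne_zero)
    obtain ⟨H, hH, hHeq⟩ := hG.exists_eq_add_fst_mul
    have hord : analyticOrderAt (fun x : ℂ => H (x, 0)) 0 = n := by
      rw [analyticOrderAt_id_mul (g := fun x : ℂ => G (x, 0)) hH.axis (by
        filter_upwards [tendsto_axis.eventually hHeq] with x hx
        rw [hx, show ((0 : ℂ), ((x, (0 : ℂ)) : ℂ × ℂ).2) = 0 from rfl, hG0, zero_add])] at hn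
      push_cast at hn
      rw [add_comm] at hn
      exact (ENat.add_left_injective_of_ne_top ENat.one_ne_top) hn
    obtain ⟨a, R, ha, ha0, hR, hR0, heq⟩ := ih hH hord
    have hG1 : AnalyticAt ℂ (fun s : ℂ => G (0, s)) 0 :=
      AnalyticAt.comp₂ (h := G) (f := fun _ => (0 : ℂ)) (g := fun s => s) (x := (0 : ℂ)) hG
        analyticAt_const analyticAt_id
    refine ⟨fun k => Nat.casesOn k (fun s => G (0, s)) a, R, ?_, ?_, hR, hR0, ?_⟩
    · rintro (_ | k)
      exacts [hG1, ha k]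
    · rintro (_ | k) hk
      exacts [hG0, ha0 k (by omega)]
    · filter_upwards [hHeq, heq] with v h1 h2
      rw [h1, h2, Finset.sum_range_succ', mul_add, Finset.mul_sum]
      simp only [pow_zero, mul_one]
      rw [add_comm (G _), add_right_comm]
      congr 1
      · congr 1
        exact Finset.sum_congr rfl fun k _ => by ring
      · ring

/-- The orders of the coefficients, as the Newton polygon needs them: `a` is a power of `s` times a
function `b` that is either nonzero at `0` or identically zero. -/
lemma AnalyticAt.exists_eq_pow_mul_of_zero {a : ℂ → ℂ} (ha : AnalyticAt ℂ a 0) (h0 : a 0 = 0) :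
    ∃ (ν : ℕ) (b : ℂ → ℂ), 0 < ν ∧ AnalyticAt ℂ b 0 ∧ (b 0 ≠ 0 ∨ b = 0) ∧
      ∀ᶠ s in 𝓝 0, a s = s ^ ν * b s := by
  by_cases htop : analyticOrderAt a 0 = ⊤
  · refine ⟨1, 0, one_pos, analyticAt_const, Or.inr rfl, ?_⟩
    filter_upwards [analyticOrderAt_eq_top.1 htop] with s hs
    simp [hs]
  · obtain ⟨ν, hν⟩ := ENat.ne_top_iff_exists.1 htop
    obtain ⟨b, hb, hb0, hbeq⟩ := ha.analyticOrderAt_eq_natCast.1 hν.symm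
    refine ⟨ν, b, Nat.pos_of_ne_zero fun h => ?_, hb, Or.inl hb0, by simpa using hbeq⟩
    subst h
    exact ha.analyticOrderAt_eq_zero.1 (by simpa using hν.symm) h0

/-- A polynomial with vanishing linear term which is not a monomial has, in degree `n ≥ 2`, a root
of multiplicity less than `n`. -/
lemma exists_root_of_coeff_one_eq_zero {n : ℕ} (hn : 2 ≤ n) {Q : ℂ[X]} (hdeg : Q.natDegree = n)
    (h1 : Q.coeff 1 = 0) {k₀ : ℕ} (hk : k₀ < n) (hk₀ : Q.coeff k₀ ≠ 0) :
    ∃ (c : ℂ) (N : ℕ) (Q₁ : ℂ[X]), 0 < N ∧ N < n ∧ Q = (X - C c) ^ N * Q₁ ∧ Q₁.eval c ≠ 0 := by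
  have hQ0 : Q ≠ 0 := by rintro rfl; simp at hk₀
  obtain ⟨c, hc⟩ := Complex.exists_root (f := Q) (by
    rw [degree_eq_natDegree hQ0, hdeg]; exact_mod_cast (by omega : 0 < n))
  obtain ⟨Q₁, hQ₁, hdvd⟩ := exists_eq_pow_rootMultiplicity_mul_and_not_dvd Q hQ0 c
  refine ⟨c, Q.rootMultiplicity c, Q₁, (rootMultiplicity_pos hQ0).2 hc, ?_, hQ₁,
    fun h => hdvd (dvd_iff_isRoot.2 h)⟩
  by_contra! hlt
  have hQ₁0 : Q₁ ≠ 0 := by rintro rfl; simp at hdvd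
  have hdeg' : Q.natDegree = Q.rootMultiplicity c + Q₁.natDegree := by
    conv_lhs => rw [hQ₁]
    rw [natDegree_mul (pow_ne_zero _ (X_sub_C_ne_zero c)) hQ₁0, natDegree_pow, natDegree_X_sub_C,
      mul_one]
  have hmult : Q.rootMultiplicity c = n := by omega
  obtain ⟨a, rfl⟩ : ∃ a, Q₁ = C a := ⟨_, eq_C_of_natDegree_eq_zero (by omega)⟩
  rw [hmult] at hQ₁
  have ha : a ≠ 0 := by rintro rfl; simp at hQ₁0
  rw [hQ₁, coeff_mul_C, sub_eq_add_neg, ← C_neg, coeff_X_add_C_pow] at h1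
  have hc0 : c = 0 := by
    have hn1 : n - 1 ≠ 0 := by omega
    have hn0 : n ≠ 0 := by omega
    simpa [ha, hn1, hn0] using h1
  rw [hQ₁, hc0, coeff_mul_C, C_0, sub_zero, coeff_X_pow, if_neg hk.ne, zero_mul] at hk₀
  exact hk₀ rfl

/-- One step of the Newton–Puiseux algorithm: if `G(x, 0)` has order `n ≥ 2`, the coefficient of
`x` in `G` vanishes, and `x = 0` is not a root, then along a side of the Newton polygon `G`
transforms to a function of smaller order in `x`. -/
lemma AnalyticAt.exists_newton_step {G : ℂ × ℂ → ℂ} {n : ℕ} (hn : 2 ≤ n) {a : ℕ → ℂ → ℂ}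
    {R : ℂ × ℂ → ℂ} (ha : ∀ k, AnalyticAt ℂ (a k) 0) (ha0 : ∀ k < n, a k 0 = 0)
    (hR : AnalyticAt ℂ R 0) (hR0 : R 0 ≠ 0) (ha1 : ∀ᶠ s in 𝓝 0, a 1 s = 0)
    (hne : ¬ ∀ᶠ s in 𝓝 0, a 0 s = 0)
    (hG : ∀ᶠ v in 𝓝 (0 : ℂ × ℂ),
      G v = ∑ k ∈ Finset.range n, a k v.2 * v.1 ^ k + v.1 ^ n * R v) :
    ∃ (p q : ℕ) (c : ℂ) (G' : ℂ × ℂ → ℂ) (N : ℕ), 0 < p ∧ 0 < q ∧ AnalyticAt ℂ G' 0 ∧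
      0 < N ∧ N < n ∧ analyticOrderAt (fun x : ℂ => G' (x, 0)) 0 = N ∧
      ∀ᶠ v in 𝓝 (0 : ℂ × ℂ), G (v.2 ^ p * (c + v.1), v.2 ^ q) = v.2 ^ (p * n) * G' v := by
  have hex : ∀ k, ∃ (ν : ℕ) (b : ℂ → ℂ), 0 < ν ∧ AnalyticAt ℂ b 0 ∧ (b 0 ≠ 0 ∨ b = 0) ∧
      (k < n → ∀ᶠ s in 𝓝 0, a k s = s ^ ν * b s) := fun k => by
    by_cases hk : k < n
    · obtain ⟨ν, b, h1, h2, h3, h4⟩ := (ha k).exists_eq_pow_mul_of_zero (ha0 k hk)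
      exact ⟨ν, b, h1, h2, h3, fun _ => h4⟩
    · exact ⟨1, 0, one_pos, analyticAt_const, Or.inr rfl, fun h => absurd h hk⟩
  choose ν b hν hb hb0 hab using hex
  have hzero : ∀ k < n, b k 0 = 0 ↔ ∀ᶠ s in 𝓝 0, a k s = 0 := fun k hk => by
    constructor
    · intro h
      filter_upwards [hab k hk] with s hs
      rw [hs, ((hb0 k).resolve_left (not_not.2 h))]
      simp
    · intro h
      by_contra hne
      have h1 : ∀ᶠ s in 𝓝[≠] (0 : ℂ), b k s ≠ 0 :=
        ((hb k).continuousAt.eventually_ne hne).filter_mono nhdsWithin_le_nhds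
      obtain ⟨s, hs1, hs2, hs3, hs4⟩ := (h1.and (((hab k hk).filter_mono nhdsWithin_le_nhds).and
        ((h.filter_mono nhdsWithin_le_nhds).and
          (eventually_mem_nhdsWithin (s := {(0 : ℂ)}ᶜ))))).exists
      rw [hs3] at hs2
      exact mul_ne_zero (pow_ne_zero _ (by simpa using hs4)) hs1 hs2.symm
  set S := (Finset.range n).filter fun k => b k 0 ≠ 0 with hS
  have h0S : 0 ∈ S := by
    simp only [hS, Finset.mem_filter, Finset.mem_range]
    exact ⟨by omega, fun h => hne ((hzero 0 (by omega)).1 h)⟩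
  have hb1 : b 1 0 = 0 := (hzero 1 (by omega)).2 ha1
  -- the side of the Newton polygon through the vertex `(n, 0)`
  obtain ⟨k₀, hk₀S, hmin⟩ := S.exists_min_image (fun k => (ν k : ℚ) / ((n : ℚ) - k)) ⟨0, h0S⟩
  have hk₀n : k₀ < n := Finset.mem_range.1 (Finset.mem_filter.1 hk₀S).1
  have hk₀b : b k₀ 0 ≠ 0 := (Finset.mem_filter.1 hk₀S).2
  set p := ν k₀ with hp
  set q := n - k₀ with hq
  have hslope : ∀ k ∈ S, p * (n - k) ≤ q * ν k := fun k hk => by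
    have hkn : k < n := Finset.mem_range.1 (Finset.mem_filter.1 hk).1
    have h1 := hmin k hk
    have h2 : (0 : ℚ) < (n : ℚ) - k := by rw [sub_pos]; exact_mod_cast hkn
    have h3 : (0 : ℚ) < (n : ℚ) - k₀ := by rw [sub_pos]; exact_mod_cast hk₀n
    rw [div_le_div_iff₀ h3 h2] at h1
    have h4 : (p : ℚ) * ((n - k : ℕ) : ℚ) ≤ ((n - k₀ : ℕ) : ℚ) * ν k := by
      rw [Nat.cast_sub hkn.le, Nat.cast_sub hk₀n.le]
      linarith
    exact_mod_cast h4
  have hq0 : 0 < q := by omega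
  have hp0 : 0 < p := hν k₀
  -- the coefficients after the substitution `x = tᵖ w`, `y = t^q` and division by `t^(p n)`; the
  -- exponents are nonnegative since no vertex lies below the chosen side
  let coef : ℕ → ℂ → ℂ := fun k t => t ^ (q * ν k - p * (n - k)) * b k (t ^ q)
  have hcoefA : ∀ k, AnalyticAt ℂ (coef k) 0 := fun k => by
    refine (analyticAt_id.pow _).mul (AnalyticAt.fun_comp (g := b k) ?_ (analyticAt_id.pow q))
    simpa [hq0.ne'] using hb k
  -- the polynomial of the side: its linear coefficient vanishes and that of `k₀` does not, so that
  -- it has a root of multiplicity less than `n`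
  set Q : ℂ[X] := ∑ k ∈ Finset.range n, C (coef k 0) * X ^ k + C (R 0) * X ^ n with hQ
  have hQcoeff : ∀ k < n, Q.coeff k = coef k 0 := fun k hk => by
    rw [hQ, coeff_add, finsetSum_coeff]
    simp [coeff_C_mul, coeff_X_pow, hk, hk.ne]
  have hQn : Q.coeff n = R 0 := by
    rw [hQ, coeff_add, finsetSum_coeff, Finset.sum_eq_zero]
    · simp
    · intro k hk
      rw [coeff_C_mul, coeff_X_pow, if_neg (Finset.mem_range.1 hk).ne', mul_zero]
  have hQdeg : Q.natDegree = n := by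
    refine natDegree_eq_of_le_of_coeff_ne_zero ?_ (by rwa [hQn])
    refine natDegree_add_le_of_degree_le (natDegree_sum_le_of_forall_le _ _ fun k hk => ?_)
      (natDegree_C_mul_X_pow_le _ _)
    exact (natDegree_C_mul_X_pow_le _ _).trans (Finset.mem_range.1 hk).le
  obtain ⟨c, N, Q₁, hN0, hNn, hQ₁, hQ₁c⟩ := exists_root_of_coeff_one_eq_zero hn hQdeg
    (by rw [hQcoeff 1 (by omega)]; simp [coef, hq0.ne', hb1]) hk₀n
    (by
      have h1 : q * ν k₀ - p * (n - k₀) = 0 := by simp [hp, hq, mul_comm]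
      rw [hQcoeff k₀ hk₀n]
      simp [coef, hq0.ne', hk₀b, h1])
  let φ : ℂ × ℂ → ℂ × ℂ := fun v => (v.2 ^ p * (c + v.1), v.2 ^ q)
  have hφA : AnalyticAt ℂ φ 0 :=
    ((analyticAt_snd.pow p).mul (analyticAt_const.add analyticAt_fst)).prod (analyticAt_snd.pow q)
  have hφ0 : φ 0 = 0 := by simp [φ, hp0.ne', hq0.ne']
  let G' : ℂ × ℂ → ℂ := fun v =>
    ∑ k ∈ Finset.range n, coef k v.2 * (c + v.1) ^ k + (c + v.1) ^ n * R (φ v)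
  have hG'A : AnalyticAt ℂ G' 0 := by
    refine AnalyticAt.add (Finset.analyticAt_fun_sum _ fun k _ => ?_) ?_
    · exact (AnalyticAt.fun_comp (g := coef k) (f := Prod.snd) (x := (0 : ℂ × ℂ)) (hcoefA k)
        analyticAt_snd).mul ((analyticAt_const.add analyticAt_fst).pow k)
    · refine ((analyticAt_const.add analyticAt_fst).pow n).mul (AnalyticAt.fun_comp (g := R) ?_ hφA)
      rwa [hφ0]
  refine ⟨p, q, c, G', N, hp0, hq0, hG'A, hN0, hNn, ?_, ?_⟩
  · have heval : ∀ x, G' (x, 0) = x ^ N * Q₁.eval (c + x) := fun x => by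
      have h1 : G' (x, 0) = Q.eval (c + x) := by
        have : φ (x, 0) = 0 := by simp [φ, hp0.ne', hq0.ne']
        simp only [G', this, hQ, eval_add, eval_finsetSum, eval_mul, eval_C, eval_pow, eval_X]
        ring
      rw [h1, hQ₁]
      simp
    rw [hG'A.axis.analyticOrderAt_eq_natCast]
    refine ⟨fun x => Q₁.eval (c + x), ?_, by simpa using hQ₁c, Eventually.of_forall fun x => ?_⟩
    · exact (Differentiable.analyticAt (f := fun x => Q₁.eval (c + x))
        (Q₁.differentiable.comp (differentiable_id.const_add c)) 0)
    · simpa using heval x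
  · have hpow : Tendsto (fun v : ℂ × ℂ => v.2 ^ q) (𝓝 0) (𝓝 0) :=
      Continuous.tendsto' (by fun_prop) 0 0 (by simp [hq0.ne'])
    have hall : ∀ᶠ s in 𝓝 (0 : ℂ), ∀ k ∈ Finset.range n, a k s = s ^ ν k * b k s :=
      (Filter.eventually_all_finset _).2 fun k hk => hab k (Finset.mem_range.1 hk)
    have hφlim : Tendsto φ (𝓝 0) (𝓝 0) := by simpa [hφ0] using hφA.continuousAt.tendsto
    filter_upwards [hφlim.eventually hG, hpow.eventually hall] with v h1 h2
    change G (φ v) = _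
    rw [h1]
    simp only [G', mul_add, Finset.mul_sum]
    congr 1
    · refine Finset.sum_congr rfl fun k hk => ?_
      have hkn : k < n := Finset.mem_range.1 hk
      change a k (v.2 ^ q) * (v.2 ^ p * (c + v.1)) ^ k = _
      rw [h2 k hk]
      simp only [coef]
      by_cases hkS : k ∈ S
      · have hexp : q * ν k + p * k = p * n + (q * ν k - p * (n - k)) := by
          have h3 := hslope k hkS
          have h4 : p * n = p * (n - k) + p * k := by rw [← mul_add, Nat.sub_add_cancel hkn.le]
          omega
        have := congrArg (fun e => v.2 ^ e) hexp
        simp only [pow_add, pow_mul] at this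
        simp only [mul_pow, ← pow_mul] at this ⊢
        linear_combination b k (v.2 ^ q) * (c + v.1) ^ k * this
      · have : b k = 0 := (hb0 k).resolve_left fun h => hkS (Finset.mem_filter.2 ⟨hk, h⟩)
        simp [this]
    · simp only [φ, mul_pow, ← pow_mul]
      ring

/-- A function `G` with `G(x, 0)` of finite positive order in `x` has a root `x = r(y^{1/d})` with
`r` analytic. -/
theorem AnalyticAt.exists_puiseux_root (n : ℕ) : ∀ {G : ℂ × ℂ → ℂ}, AnalyticAt ℂ G 0 →
    0 < n → analyticOrderAt (fun x : ℂ => G (x, 0)) 0 = n →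
    ∃ (d : ℕ) (r : ℂ → ℂ), 0 < d ∧ AnalyticAt ℂ r 0 ∧ r 0 = 0 ∧
      ∀ᶠ s in 𝓝 0, G (r s, s ^ d) = 0 := by
  induction n using Nat.strong_induction_on with
  | _ n ih =>
  intro G hG hn0 hn
  have hG0 : G 0 = 0 := apply_eq_zero_of_analyticOrderAt_ne_zero (f := fun x : ℂ => G (x, 0))
    (by rw [hn]; exact_mod_cast hn0.ne')
  have hPA := analyticAt_complexPartialX hG
  obtain ⟨m, rfl⟩ : ∃ m, n = m + 1 := ⟨n - 1, by omega⟩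
  have hordP : analyticOrderAt (fun x : ℂ => complexPartialX G (x, 0)) 0 = m :=
    analyticOrderAt_deriv_of_pos hG.axis (by rw [hn]; push_cast; rfl)
  rcases Nat.eq_zero_or_pos m with rfl | hm
  · obtain ⟨τ, hτ, hτ0, hτeq⟩ := hG.exists_implicit hG0 (hPA.axis.analyticOrderAt_eq_zero.1 hordP)
    exact ⟨1, τ, one_pos, hτ, hτ0, by simpa using hτeq⟩
  -- after a translation by a root of the partial derivative, the coefficient of `x` vanishes
  obtain ⟨d₀, r₀, hd₀, hr₀, hr₀0, hr₀eq⟩ := ih m (by omega) hPA hm hordP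
  let θ : ℂ × ℂ → ℂ × ℂ := fun v => (v.1 + r₀ v.2, v.2 ^ d₀)
  have hr₀A : AnalyticAt ℂ (fun v : ℂ × ℂ => r₀ v.2) 0 :=
    AnalyticAt.fun_comp (g := r₀) (f := Prod.snd) (x := (0 : ℂ × ℂ)) hr₀ analyticAt_snd
  have hθA : AnalyticAt ℂ θ 0 := (analyticAt_fst.add hr₀A).prod (analyticAt_snd.pow d₀)
  have hθ0 : θ 0 = 0 := by simp [θ, hd₀.ne', hr₀0]
  have hθlim : Tendsto θ (𝓝 0) (𝓝 0) := by simpa [hθ0] using hθA.continuousAt.tendsto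
  have hG₁A : AnalyticAt ℂ (fun v => G (θ v)) 0 :=
    AnalyticAt.fun_comp (g := G) (by rwa [hθ0]) hθA
  obtain ⟨H, hH, hHeq⟩ := hG₁A.exists_eq_add_fst_mul
  have hsndlim : Tendsto (fun s : ℂ => ((0 : ℂ), s)) (𝓝 0) (𝓝 0) :=
    Continuous.tendsto' (by fun_prop : Continuous fun s : ℂ => ((0 : ℂ), s)) 0 0 rfl
  -- `H(0, s)` is the `x`-derivative of `G` at the root `r₀(s)` of the partial derivative
  have hH0 : ∀ᶠ s in 𝓝 (0 : ℂ), H (0, s) = 0 := by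
    filter_upwards [hsndlim.eventually hHeq.eventually_nhds, hr₀eq,
      hsndlim.eventually hH.eventually_analyticAt,
      hsndlim.eventually (hθlim.eventually hG.eventually_analyticAt)] with s h1 h2 h3 h4
    have hx : Tendsto (fun x : ℂ => (x, s)) (𝓝 0) (𝓝 (0, s)) :=
      Continuous.tendsto' (by fun_prop : Continuous fun x : ℂ => (x, s)) 0 (0, s) rfl
    have hd1 : HasDerivAt (fun x : ℂ => G (x + r₀ s, s ^ d₀)) 0 0 := by
      have h5 : HasDerivAt (fun x : ℂ => G (x, s ^ d₀)) 0 (0 + r₀ s) := by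
        rw [zero_add, ← h2]
        have : AnalyticAt ℂ G (r₀ s, s ^ d₀) := by simpa [θ] using h4
        exact (AnalyticAt.comp₂ (h := G) (f := fun x => x) (g := fun _ => s ^ d₀) (x := r₀ s) this
          analyticAt_id analyticAt_const).differentiableAt.hasDerivAt
      exact h5.comp_add_const 0 (r₀ s)
    have hHs : DifferentiableAt ℂ (fun x : ℂ => H (x, s)) 0 :=
      (AnalyticAt.comp₂ (h := H) (f := fun x => x) (g := fun _ => s) (x := (0 : ℂ)) h3
        analyticAt_id analyticAt_const).differentiableAt
    have hd2 : HasDerivAt (fun x : ℂ => G (θ (0, s)) + x * H (x, s)) (H (0, s)) 0 := by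
      have := ((hasDerivAt_id (0 : ℂ)).mul hHs.hasDerivAt).const_add (G (θ (0, s)))
      simpa using this
    exact (hd2.congr_of_eventuallyEq (hx.eventually h1)).unique hd1
  -- if the root of the partial derivative is a root of `G`, nothing remains to be done; otherwise a
  -- step of the algorithm lowers the order
  by_cases hroot : ∀ᶠ s in 𝓝 (0 : ℂ), G (θ (0, s)) = 0
  · exact ⟨d₀, r₀, hd₀, hr₀, hr₀0, by simpa [θ] using hroot⟩
  obtain ⟨H₂, hH₂, hH₂eq⟩ := hH.exists_eq_add_fst_mul
  have hsnd : Tendsto (fun v : ℂ × ℂ => v.2) (𝓝 0) (𝓝 0) :=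
    Continuous.tendsto' continuous_snd 0 0 rfl
  have hG₁eq : ∀ᶠ v in 𝓝 (0 : ℂ × ℂ), G (θ v) = G (θ (0, v.2)) + v.1 * (v.1 * H₂ v) := by
    filter_upwards [hHeq, hH₂eq, hsnd.eventually hH0] with v h1 h2 h3
    rw [h1, h2, h3, zero_add]
  have hθ00 : θ (0, 0) = 0 := hθ0
  obtain ⟨l, rfl⟩ : ∃ l, m = l + 1 := ⟨m - 1, by omega⟩
  have hordH₂ : analyticOrderAt (fun x : ℂ => H₂ (x, 0)) 0 = l := by
    have h1 : ∀ᶠ x in 𝓝 (0 : ℂ), G (x, 0) = x * (x * H₂ (x, 0)) := by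
      filter_upwards [tendsto_axis.eventually hG₁eq] with x hx
      simpa [θ, hr₀0, hd₀.ne', show G (0, 0) = 0 from hG0] using hx
    rw [analyticOrderAt_id_mul (h := fun x => x * H₂ (x, 0)) (analyticAt_id.mul hH₂.axis) h1,
      analyticOrderAt_id_mul hH₂.axis (Eventually.of_forall fun x => rfl)] at hn
    have hn' : analyticOrderAt (fun x : ℂ => H₂ (x, 0)) 0 + 2 = (l : ℕ∞) + 2 := by
      rw [show ((l + 1 + 1 : ℕ) : ℕ∞) = (l : ℕ∞) + 2 by push_cast; rw [add_assoc]; norm_num] at hn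
      rw [← hn, ← add_assoc, add_comm]
      norm_num
    exact (ENat.add_left_injective_of_ne_top (by norm_num : (2 : ℕ∞) ≠ ⊤)) hn'
  obtain ⟨a, R, ha, ha0, hR, hR0, hRtaylor⟩ := hH₂.exists_taylor l hordH₂
  let a' : ℕ → ℂ → ℂ := fun k => match k with
    | 0 => fun s => G (θ (0, s))
    | 1 => fun _ => 0
    | k + 2 => a k
  have ha'A : ∀ k, AnalyticAt ℂ (a' k) 0 := by
    rintro (_ | _ | k)
    · exact AnalyticAt.comp₂ (h := fun v => G (θ v)) (f := fun _ => (0 : ℂ)) (g := fun s => s)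
        (x := (0 : ℂ)) hG₁A analyticAt_const analyticAt_id
    · exact analyticAt_const
    · exact ha k
  obtain ⟨p, q, c, G', N, hp, hq, hG', hN0, hN, hG'ord, hG'eq⟩ :=
    AnalyticAt.exists_newton_step (G := fun v => G (θ v)) (n := l + 1 + 1) (a := a') (R := R)
      (by omega) ha'A
      (by
        rintro (_ | _ | k) hk
        · change G (θ (0, 0)) = 0
          rw [hθ00, hG0]
        · rfl
        · exact ha0 k (by omega))
      hR hR0 (Eventually.of_forall fun _ => rfl) hroot
      (by
        filter_upwards [hG₁eq, hRtaylor] with v h1 h2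
        rw [h1, h2, Finset.sum_range_succ', Finset.sum_range_succ', mul_add, mul_add,
          Finset.mul_sum, Finset.mul_sum]
        simp only [a', zero_mul, add_zero, pow_zero, mul_one]
        rw [add_comm (G _), add_right_comm]
        congr 1
        · congr 1
          exact Finset.sum_congr rfl fun k _ => by ring
        · ring)
  obtain ⟨d', r', hd', hr', hr'0, hr'eq⟩ := ih N hN hG' hN0 hG'ord
  have hpow : AnalyticAt ℂ (fun s : ℂ => s ^ d') 0 := analyticAt_id.pow d'
  refine ⟨d' * (q * d₀), fun s => (s ^ d') ^ p * (c + r' s) + r₀ ((s ^ d') ^ q), by positivity,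
    ?_, ?_, ?_⟩
  · refine ((hpow.pow p).mul (analyticAt_const.add hr')).add
      (AnalyticAt.fun_comp (g := r₀) ?_ (hpow.pow q))
    simpa [hq.ne', hd'.ne'] using hr₀
  · simp [hp.ne', hd'.ne', hq.ne', hr₀0]
  · have hlim : Tendsto (fun s : ℂ => (r' s, s ^ d')) (𝓝 0) (𝓝 0) := by
      have := (hr'.continuousAt.prodMk hpow.continuousAt).tendsto
      simp only [hr'0, zero_pow hd'.ne'] at this
      exact this
    filter_upwards [hlim.eventually hG'eq, hr'eq] with s h1 h2
    rw [h2, mul_zero] at h1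
    simpa [θ, pow_mul] using h1

/-- A factorization `G(x, sᵈ) = U(x, s) ∏ᵢ (x - rᵢ(s))` into Newton–Puiseux factors, up to a unit
`U`. -/
structure PuiseuxFactors (G : ℂ × ℂ → ℂ) (n d : ℕ) (r : Fin n → ℂ → ℂ) (U : ℂ × ℂ → ℂ) : Prop where
  pos : 0 < d
  analytic : ∀ i, AnalyticAt ℂ (r i) 0
  map_zero : ∀ i, r i 0 = 0
  unit_analytic : AnalyticAt ℂ U 0
  unit_ne_zero : U 0 ≠ 0
  eventually_eq : ∀ᶠ v in 𝓝 (0 : ℂ × ℂ), G (v.1, v.2 ^ d) = U v * ∏ i, (v.1 - r i v.2)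

/-- The Newton–Puiseux factorization. A root `x = r(s)` of `G(x, sᵈ)` is divided out by means of
Hadamard's lemma, which lowers the order in `x`; the exponent `d` is the product
of the exponents needed for the successive roots. -/
theorem AnalyticAt.exists_puiseuxFactors (n : ℕ) : ∀ {G : ℂ × ℂ → ℂ}, AnalyticAt ℂ G 0 →
    analyticOrderAt (fun x : ℂ => G (x, 0)) 0 = n →
    ∃ (d : ℕ) (r : Fin n → ℂ → ℂ) (U : ℂ × ℂ → ℂ), PuiseuxFactors G n d r U := by
  induction n with
  | zero =>
    intro G hG hn
    exact ⟨1, fun _ _ => 0, G, one_pos, fun _ => analyticAt_const, fun _ => rfl, hG,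
      hG.axis.analyticOrderAt_eq_zero.1 hn, by simp⟩
  | succ n ih =>
    intro G hG hn
    obtain ⟨d₁, r₁, hd₁, hr₁, hr₁0, hr₁eq⟩ := hG.exists_puiseux_root (n + 1) n.succ_pos hn
    let θ : ℂ × ℂ → ℂ × ℂ := fun v => (v.1 + r₁ v.2, v.2 ^ d₁)
    have hr₁A : AnalyticAt ℂ (fun v : ℂ × ℂ => r₁ v.2) 0 :=
      AnalyticAt.fun_comp (g := r₁) (f := Prod.snd) (x := (0 : ℂ × ℂ)) hr₁ analyticAt_snd
    have hθA : AnalyticAt ℂ θ 0 := (analyticAt_fst.add hr₁A).prod (analyticAt_snd.pow d₁)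
    have hθ0 : θ 0 = 0 := by simp [θ, hd₁.ne', hr₁0]
    have hG₁A : AnalyticAt ℂ (fun v => G (θ v)) 0 :=
      AnalyticAt.fun_comp (g := G) (by rwa [hθ0]) hθA
    obtain ⟨H, hH, hHeq⟩ := hG₁A.exists_eq_add_fst_mul
    have hsnd : Tendsto (fun v : ℂ × ℂ => v.2) (𝓝 0) (𝓝 0) :=
      Continuous.tendsto' continuous_snd 0 0 rfl
    have hHeq' : ∀ᶠ v in 𝓝 (0 : ℂ × ℂ), G (θ v) = v.1 * H v := by
      filter_upwards [hHeq, hsnd.eventually hr₁eq] with v h1 h2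
      rw [h1]
      simp [θ, h2]
    have hord : analyticOrderAt (fun x : ℂ => H (x, 0)) 0 = n := by
      refine order_axis_of_eq_fst_mul (G := fun v => G (θ v)) hH hHeq' ?_
      simpa [θ, hr₁0, hd₁.ne'] using hn
    obtain ⟨d₂, r₂, U, hr₂⟩ := ih hH hord
    have hpow : AnalyticAt ℂ (fun s : ℂ => s ^ d₂) 0 := analyticAt_id.pow d₂
    have hr₁pow : AnalyticAt ℂ (fun s : ℂ => r₁ (s ^ d₂)) 0 :=
      AnalyticAt.fun_comp (g := r₁) (by simpa [hr₂.pos.ne'] using hr₁) hpow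
    let ψ : ℂ × ℂ → ℂ × ℂ := fun v => (v.1 - r₁ (v.2 ^ d₂), v.2)
    have hψA : AnalyticAt ℂ ψ 0 :=
      (analyticAt_fst.sub (AnalyticAt.fun_comp (g := fun s : ℂ => r₁ (s ^ d₂)) (f := Prod.snd)
        (x := (0 : ℂ × ℂ)) hr₁pow analyticAt_snd)).prod analyticAt_snd
    have hψ0 : ψ 0 = 0 := by simp [ψ, hr₁0, hr₂.pos.ne']
    have hψlim : Tendsto ψ (𝓝 0) (𝓝 0) := by simpa [hψ0] using hψA.continuousAt.tendsto
    have hχlim : Tendsto (fun v : ℂ × ℂ => ((ψ v).1, v.2 ^ d₂)) (𝓝 0) (𝓝 0) := by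
      have h1 : Tendsto (fun v : ℂ × ℂ => (ψ v).1) (𝓝 0) (𝓝 0) :=
        (Continuous.tendsto' continuous_fst 0 0 rfl).comp hψlim
      have h2 : Tendsto (fun v : ℂ × ℂ => v.2 ^ d₂) (𝓝 0) (𝓝 0) :=
        Continuous.tendsto' (by fun_prop) 0 0 (by simp [hr₂.pos.ne'])
      exact h1.prodMk_nhds h2
    refine ⟨d₂ * d₁, Fin.cons (fun s => r₁ (s ^ d₂)) fun i s => r₁ (s ^ d₂) + r₂ i s,
      fun v => U (ψ v), Nat.mul_pos hr₂.pos hd₁, ?_, ?_, ?_, ?_, ?_⟩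
    · intro i
      refine Fin.cases ?_ (fun i => ?_) i
      exacts [hr₁pow, hr₁pow.add (hr₂.analytic i)]
    · intro i
      refine Fin.cases ?_ (fun i => ?_) i
      · simp [hr₂.pos.ne', hr₁0]
      · simp [hr₂.pos.ne', hr₁0, hr₂.map_zero]
    · exact AnalyticAt.fun_comp (g := U) (by rw [hψ0]; exact hr₂.unit_analytic) hψA
    · rw [hψ0]
      exact hr₂.unit_ne_zero
    · filter_upwards [hχlim.eventually hHeq', hψlim.eventually hr₂.eventually_eq] with v h1 h2
      rw [Fin.prod_univ_succ]
      simp only [Fin.cons_zero, Fin.cons_succ, pow_mul]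
      have h3 : G (v.1, (v.2 ^ d₂) ^ d₁) = G (θ ((ψ v).1, v.2 ^ d₂)) := by simp [θ, ψ]
      rw [h3, h1, show H ((ψ v).1, v.2 ^ d₂) = H ((ψ v).1, (ψ v).2 ^ d₂) from rfl, h2]
      simp only [ψ, sub_sub]
      ring

/-- The Newton–Puiseux roots of a function whose multiplicity at `0` equals its order in `x` are
`O(|y|)`. -/
lemma PuiseuxFactors.isBigO {G : ℂ × ℂ → ℂ} {n d : ℕ} {r : Fin n → ℂ → ℂ} {U : ℂ × ℂ → ℂ}
    (h : PuiseuxFactors G n d r U) (hG : AnalyticAt ℂ G 0) (hord : OrderGE n G)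
    (hn : analyticOrderAt (fun x : ℂ => G (x, 0)) 0 = n) (i : Fin n) :
    r i =O[𝓝 0] fun s => s ^ d := by
  obtain ⟨k, rfl⟩ : ∃ k, n = k + 1 := ⟨n - 1, by have := i.pos; omega⟩
  obtain ⟨C, hC⟩ := hord.exists_norm_sub_le hG
  obtain ⟨u, hu, hu0, hueq⟩ := hG.axis.analyticOrderAt_eq_natCast.1 hn
  have hrlim : Tendsto (r i) (𝓝 0) (𝓝 0) := by
    simpa [h.map_zero] using (h.analytic i).continuousAt.tendsto
  have hpowlim : Tendsto (fun s : ℂ => s ^ d) (𝓝 0) (𝓝 0) :=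
    Continuous.tendsto' (by fun_prop) 0 0 (by simp [h.pos.ne'])
  -- at a point where `|r(s)| ≥ |s|ᵈ`, compare `G(r(s), 0)` with `G(r(s), sᵈ) = 0`
  have hroot : ∀ᶠ s in 𝓝 0, G (r i s, s ^ d) = 0 := by
    have hl : Tendsto (fun s : ℂ => (r i s, s)) (𝓝 0) (𝓝 0) := hrlim.prodMk_nhds tendsto_id
    filter_upwards [hl.eventually h.eventually_eq] with s hs
    rw [hs, Finset.prod_eq_zero (Finset.mem_univ i) (by simp), mul_zero]
  have hulow : ∀ᶠ s in 𝓝 0, ‖u 0‖ / 2 ≤ ‖u (r i s)‖ := by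
    have h1 : Tendsto (fun s => ‖u (r i s)‖) (𝓝 0) (𝓝 ‖u 0‖) :=
      (hu.continuousAt.tendsto.comp hrlim).norm
    exact (h1.eventually (lt_mem_nhds (half_lt_self (norm_pos_iff.2 hu0)))).mono fun _ => le_of_lt
  obtain ⟨ε, hε, hCε⟩ := mem_nhdsGT_iff_exists_Ioo_subset.1 hC
  have hrε : ∀ᶠ s in 𝓝 0, ‖r i s‖ < ε := by
    simpa using hrlim.norm.eventually (gt_mem_nhds (by simpa using hε))
  refine IsBigO.of_bound (max 1 (2 * C / ‖u 0‖)) ?_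
  filter_upwards [hroot, hulow, hrε, hrlim.eventually hueq] with s h1 h2 h3 h4
  rcases le_or_gt ‖r i s‖ ‖s ^ d‖ with hle | hlt
  · exact hle.trans (le_mul_of_one_le_left (norm_nonneg _) (le_max_left _ _))
  have hpos : 0 < ‖r i s‖ := (norm_nonneg _).trans_lt hlt
  have h5 := hCε ⟨hpos, h3⟩ (r i s) (s ^ d) le_rfl hlt.le
  rw [h1, zero_sub, norm_neg, h4, sub_zero, norm_smul, norm_pow, pow_succ] at h5
  have h6 : ‖r i s‖ * (‖u 0‖ / 2) ≤ C * ‖s ^ d‖ := by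
    have h7 : ‖r i s‖ ^ k * (‖r i s‖ * (‖u 0‖ / 2)) ≤ ‖r i s‖ ^ k * (C * ‖s ^ d‖) := by
      calc _ ≤ ‖r i s‖ ^ k * (‖r i s‖ * ‖u (r i s)‖) := by gcongr
        _ = ‖r i s‖ ^ k * ‖r i s‖ * ‖u (r i s)‖ := by ring
        _ ≤ _ := h5
        _ = _ := by ring
    exact le_of_mul_le_mul_left h7 (pow_pos hpos k)
  have hu0' : 0 < ‖u 0‖ := norm_pos_iff.2 hu0
  calc ‖r i s‖ ≤ 2 * C / ‖u 0‖ * ‖s ^ d‖ := by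
        rw [div_mul_eq_mul_div, le_div_iff₀ hu0']
        linarith
    _ ≤ _ := by gcongr; exact le_max_right _ _

/-! ### Fractional power series -/

section ScalarSeries

variable {𝕜 : Type} [RCLike 𝕜]

/-- The sum of the power series `∑ cₙ sⁿ`. -/
noncomputable def scalarSum (c : ℕ → 𝕜) (s : 𝕜) : 𝕜 := ∑' n, c n * s ^ n

/-- The power series `∑ cₙ sⁿ` has a positive radius of convergence. -/
def PosRadius (c : ℕ → 𝕜) : Prop := ∃ r : ℝ, 0 < r ∧ Summable fun n : ℕ => ‖c n‖ * r ^ n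

lemma PosRadius.eventually_hasSum {c : ℕ → 𝕜} (hc : PosRadius c) :
    ∀ᶠ s in 𝓝 (0 : 𝕜), HasSum (fun n => c n * s ^ n) (scalarSum c s) := by
  obtain ⟨r, hr, hs⟩ := hc
  filter_upwards [Metric.ball_mem_nhds (0 : 𝕜) hr] with s hsr
  refine (Summable.of_norm_bounded hs fun n => ?_).hasSum
  rw [norm_mul, norm_pow]
  gcongr
  simpa using (mem_ball_zero_iff.1 hsr).le

lemma PosRadius.analyticAt {c : ℕ → 𝕜} (hc : PosRadius c) : AnalyticAt 𝕜 (scalarSum c) 0 := by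
  refine ⟨FormalMultilinearSeries.ofScalars 𝕜 c, hasFPowerSeriesAt_iff.2 ?_⟩
  filter_upwards [hc.eventually_hasSum] with s hs
  rw [zero_add]
  refine HasSum.congr_fun hs fun n => ?_
  rw [FormalMultilinearSeries.coeff_ofScalars, smul_eq_mul, mul_comm]

lemma scalarSum_zero (c : ℕ → 𝕜) : scalarSum c 0 = c 0 := by
  rw [scalarSum, tsum_eq_single 0 fun n hn => by simp [hn]]
  simp

lemma PosRadius.tendsto {c : ℕ → 𝕜} (hc : PosRadius c) :
    Tendsto (scalarSum c) (𝓝 0) (𝓝 (c 0)) := by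
  simpa [scalarSum_zero] using hc.analyticAt.continuousAt.tendsto

lemma PosRadius.shift {c : ℕ → 𝕜} (hc : PosRadius c) (N : ℕ) : PosRadius fun n => c (n + N) := by
  obtain ⟨r, hr, hs⟩ := hc
  refine ⟨r, hr, ?_⟩
  have h1 := ((summable_nat_add_iff N).2 hs).mul_right (r ^ N)⁻¹
  refine h1.congr fun n => ?_
  rw [pow_add]
  field_simp

lemma PosRadius.eventually_eq_pow_mul {c : ℕ → 𝕜} (hc : PosRadius c) {N : ℕ}
    (h0 : ∀ n < N, c n = 0) :
    ∀ᶠ s in 𝓝 (0 : 𝕜), scalarSum c s = s ^ N * scalarSum (fun n => c (n + N)) s := by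
  filter_upwards [hc.eventually_hasSum, (hc.shift N).eventually_hasSum] with s h1 h2
  have h3 := (hasSum_nat_add_iff' N).2 h1
  rw [Finset.sum_eq_zero fun n hn => by rw [h0 n (Finset.mem_range.1 hn), zero_mul], sub_zero]
    at h3
  refine h3.unique (HasSum.congr_fun (h2.mul_left (s ^ N)) fun n => ?_)
  rw [pow_add]
  ring

lemma AnalyticAt.exists_posRadius {A : 𝕜 → 𝕜} (hA : AnalyticAt 𝕜 A 0) :
    ∃ c, PosRadius c ∧ ∀ᶠ s in 𝓝 0, A s = scalarSum c s := by
  obtain ⟨p, hp⟩ := hA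
  have hc : PosRadius p.coeff := by
    obtain ⟨r, hr0, hr⟩ := ENNReal.lt_iff_exists_nnreal_btwn.1 hp.radius_pos
    refine ⟨r, by exact_mod_cast hr0, (p.summable_norm_mul_pow hr).congr fun n => ?_⟩
    rw [FormalMultilinearSeries.norm_apply_eq_norm_coef]
  refine ⟨p.coeff, hc, ?_⟩
  filter_upwards [hasFPowerSeriesAt_iff.1 hp, hc.eventually_hasSum] with s h1 h2
  rw [zero_add] at h1
  exact h1.unique (HasSum.congr_fun h2 fun n => by rw [smul_eq_mul, mul_comm])

end ScalarSeries

namespace FracSeries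

variable {𝕜 : Type} [RCLike 𝕜]

/-- The exponents of `α` lie in `(1/d)ℕ`. -/
def HasDen (α : FracSeries 𝕜) (d : ℕ) : Prop :=
  0 < d ∧ (∀ e, α.coeff e ≠ 0 → ∃ n : ℕ, e = (n : ℝ) / d) ∧
    PosRadius fun n : ℕ => α.coeff ((n : ℝ) / d)

lemma exists_hasDen (α : FracSeries 𝕜) : ∃ d, α.HasDen d := α.convergent

lemma HasDen.mul {α : FracSeries 𝕜} {d : ℕ} (h : α.HasDen d) {k : ℕ} (hk : 0 < k) :
    α.HasDen (d * k) := by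
  obtain ⟨hd, hsupp, r, hr, hs⟩ := h
  have hd' : (d : ℝ) ≠ 0 := by exact_mod_cast hd.ne'
  have hk' : (k : ℝ) ≠ 0 := by exact_mod_cast hk.ne'
  refine ⟨Nat.mul_pos hd hk, fun e he => ?_, r ^ (1 / k : ℝ), by positivity, ?_⟩
  · obtain ⟨n, rfl⟩ := hsupp e he
    refine ⟨n * k, ?_⟩
    push_cast
    field_simp
  · have hinj : Function.Injective fun n : ℕ => k * n := fun a b hab =>
      Nat.eq_of_mul_eq_mul_left hk hab
    refine (hinj.summable_iff fun n hn => ?_).1 (hs.congr fun n => ?_)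
    · by_contra hne
      have : α.coeff ((n : ℝ) / ((d * k : ℕ) : ℝ)) ≠ 0 := fun h0 =>
        hne (by beta_reduce; rw [h0, norm_zero, zero_mul])
      obtain ⟨m, hm⟩ := hsupp _ this
      refine hn ⟨m, ?_⟩
      push_cast at hm
      rw [div_eq_div_iff (by positivity) hd'] at hm
      have h2 : (d : ℝ) * ((k * m : ℕ) : ℝ) = (d : ℝ) * n := by push_cast; linarith
      exact_mod_cast mul_left_cancel₀ hd' h2
    · have h1 : ((k * n : ℕ) : ℝ) / ((d * k : ℕ) : ℝ) = (n : ℝ) / d := by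
        push_cast
        field_simp
      have h2 : (r ^ (1 / k : ℝ)) ^ (k * n) = r ^ n := by
        rw [pow_mul, ← Real.rpow_natCast (r ^ (1 / k : ℝ)), ← Real.rpow_mul hr.le,
          one_div_mul_cancel hk', Real.rpow_one]
      simp only [Function.comp, h1, h2]

lemma coeff_of_neg (α : FracSeries 𝕜) {e : ℝ} (he : e < 0) : α.coeff e = 0 := by
  by_contra h
  obtain ⟨d, hd, hsupp, -⟩ := α.exists_hasDen
  obtain ⟨n, rfl⟩ := hsupp e h
  exact he.not_ge (by positivity)

lemma exists_common_hasDen (α β : FracSeries 𝕜) : ∃ d, α.HasDen d ∧ β.HasDen d := by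
  obtain ⟨a, ha⟩ := α.exists_hasDen
  obtain ⟨b, hb⟩ := β.exists_hasDen
  exact ⟨a * b, ha.mul hb.1, mul_comm b a ▸ hb.mul ha.1⟩

lemma HasDen.eval_eq {α : FracSeries 𝕜} {d : ℕ} (h : α.HasDen d) {y : ℝ} (hy : 0 < y) :
    α.eval y = scalarSum (fun n : ℕ => α.coeff ((n : ℝ) / d)) ((y ^ (1 / d : ℝ) : ℝ) : 𝕜) := by
  have hd : (d : ℝ) ≠ 0 := by exact_mod_cast h.1.ne'
  have hinj : Function.Injective fun n : ℕ => (n : ℝ) / d := fun a b hab => by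
    have := (div_left_inj' hd).1 hab
    exact_mod_cast this
  rw [FracSeries.eval, ← hinj.tsum_eq (f := fun e : ℝ => (y ^ e) • α.coeff e)]
  · refine tsum_congr fun n => ?_
    rw [RCLike.real_smul_eq_coe_mul, mul_comm, ← RCLike.ofReal_pow, ← Real.rpow_natCast,
      ← Real.rpow_mul hy.le, one_div_mul_eq_div]
  · intro e he
    have : α.coeff e ≠ 0 := fun h0 => he (by simp [h0])
    obtain ⟨n, rfl⟩ := h.2.1 e this
    exact ⟨n, rfl⟩

lemma tendsto_root {d : ℕ} (hd : 0 < d) :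
    Tendsto (fun y : ℝ => y ^ (1 / d : ℝ)) (𝓝[>] 0) (𝓝[>] 0) := by
  have hd' : (0 : ℝ) < 1 / d := by positivity
  refine tendsto_nhdsWithin_iff.2 ⟨?_, ?_⟩
  · have := (Real.continuousAt_rpow_const 0 (1 / d : ℝ) (Or.inr hd'.le)).tendsto
    rw [Real.zero_rpow hd'.ne'] at this
    exact this.mono_left nhdsWithin_le_nhds
  · filter_upwards [self_mem_nhdsWithin] with y (hy : 0 < y)
    exact Real.rpow_pos_of_pos hy _

lemma tendsto_root' {d : ℕ} (hd : 0 < d) :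
    Tendsto (fun y : ℝ => ((y ^ (1 / d : ℝ) : ℝ) : 𝕜)) (𝓝[>] 0) (𝓝 0) := by
  have h : Tendsto (fun x : ℝ => (x : 𝕜)) (𝓝 0) (𝓝 0) :=
    RCLike.continuous_ofReal.tendsto' 0 0 (by simp)
  exact h.comp ((tendsto_root hd).mono_right nhdsWithin_le_nhds)

/-- If `α` has no terms of exponent less than `e`, then `α = cₑ yᵉ + o(yᵉ)`. -/
lemma tendsto_eval_smul (α : FracSeries 𝕜) {e : ℝ} (h : ∀ e' < e, α.coeff e' = 0) :
    Tendsto (fun y : ℝ => (y ^ (-e)) • α.eval y) (𝓝[>] 0) (𝓝 (α.coeff e)) := by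
  obtain ⟨d, hd⟩ := α.exists_hasDen
  have hd0 : (0 : ℝ) < d := by exact_mod_cast hd.1
  set c : ℕ → 𝕜 := fun n => α.coeff ((n : ℝ) / d)
  set N := ⌈e * d⌉₊ with hN
  have hc0 : ∀ n < N, c n = 0 := fun n hn => h _ (by rw [div_lt_iff₀ hd0]; exact Nat.lt_ceil.1 hn)
  have hNe : e ≤ N / d := by rw [le_div_iff₀ hd0]; exact Nat.le_ceil _
  have h1 : ∀ᶠ y : ℝ in 𝓝[>] 0, ((y ^ ((N : ℝ) / d - e) : ℝ) : ℝ) •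
      scalarSum (fun n => c (n + N)) ((y ^ (1 / d : ℝ) : ℝ) : 𝕜) = (y ^ (-e)) • α.eval y := by
    filter_upwards [(tendsto_root' (𝕜 := 𝕜) hd.1).eventually (hd.2.2.eventually_eq_pow_mul hc0),
      self_mem_nhdsWithin] with y h2 (hy : 0 < y)
    rw [hd.eval_eq hy, h2, RCLike.real_smul_eq_coe_mul, RCLike.real_smul_eq_coe_mul, ← mul_assoc,
      ← RCLike.ofReal_pow, ← RCLike.ofReal_mul, ← Real.rpow_natCast, ← Real.rpow_mul hy.le,
      ← Real.rpow_add hy]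
    congr 3
    ring
  refine Tendsto.congr' h1 ?_
  have h2 : Tendsto (fun y : ℝ => scalarSum (fun n => c (n + N)) ((y ^ (1 / d : ℝ) : ℝ) : 𝕜))
      (𝓝[>] 0) (𝓝 (c N)) := by
    have := (hd.2.2.shift N).tendsto.comp (tendsto_root' (𝕜 := 𝕜) hd.1)
    rwa [zero_add] at this
  rcases hNe.eq_or_lt with heq | hlt
  · have : c N = α.coeff e := by rw [heq]
    rw [← this]
    simpa [← heq] using h2
  · have h3 : α.coeff e = 0 := by
      by_contra hne
      obtain ⟨n, hn⟩ := hd.2.1 e hne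
      have : e * d = n := by rw [hn, div_mul_cancel₀ _ hd0.ne']
      rw [hN, this, Nat.ceil_natCast, ← hn] at hlt
      exact hlt.false
    have h4 : Tendsto (fun y : ℝ => y ^ ((N : ℝ) / d - e)) (𝓝[>] 0) (𝓝 0) := by
      have h5 : (0 : ℝ) < (N : ℝ) / d - e := sub_pos.2 hlt
      have := (Real.continuousAt_rpow_const 0 ((N : ℝ) / d - e) (Or.inr h5.le)).tendsto
      rw [Real.zero_rpow h5.ne'] at this
      exact this.mono_left nhdsWithin_le_nhds
    rw [h3]
    simpa using h4.smul h2

/-- The fractional power series `A(y^{1/d})`, for `A` analytic. -/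
lemma exists_of_analyticAt {A : 𝕜 → 𝕜} (hA : AnalyticAt 𝕜 A 0) {d : ℕ} (hd : 0 < d) :
    ∃ α : FracSeries 𝕜, α.HasDen d ∧
      ∀ᶠ y : ℝ in 𝓝[>] 0, α.eval y = A ((y ^ (1 / d : ℝ) : ℝ) : 𝕜) := by
  obtain ⟨c, hc, hcA⟩ := hA.exists_posRadius
  have hd0 : (d : ℝ) ≠ 0 := by exact_mod_cast hd.ne'
  let co : ℝ → 𝕜 := fun e => if e = (⌊e * d⌋₊ : ℝ) / d then c ⌊e * d⌋₊ else 0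
  have hco : ∀ n : ℕ, co ((n : ℝ) / d) = c n := fun n => by
    have : ⌊(n : ℝ) / d * d⌋₊ = n := by rw [div_mul_cancel₀ _ hd0, Nat.floor_natCast]
    simp only [co, this, if_true]
  have hsupp : ∀ e, co e ≠ 0 → ∃ n : ℕ, e = (n : ℝ) / d := fun e he => by
    by_cases h : e = (⌊e * d⌋₊ : ℝ) / d
    · exact ⟨_, h⟩
    · exact absurd (if_neg h) he
  have hrad : PosRadius fun n : ℕ => co ((n : ℝ) / d) := by simpa only [hco] using hc
  let α : FracSeries 𝕜 := ⟨co, d, hd, hsupp, hrad⟩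
  have hα : α.HasDen d := ⟨hd, hsupp, hrad⟩
  refine ⟨α, hα, ?_⟩
  filter_upwards [(tendsto_root' (𝕜 := 𝕜) hd).eventually hcA, self_mem_nhdsWithin]
    with y h1 (hy : 0 < y)
  rw [hα.eval_eq hy, h1]
  congr 1
  funext n
  exact hco n

instance : Sub (FracSeries 𝕜) where
  sub α β := ⟨fun e => α.coeff e - β.coeff e, by
    obtain ⟨d, hα, hβ⟩ := exists_common_hasDen α β
    refine ⟨d, hα.1, fun e he => ?_, ?_⟩
    · by_cases h : α.coeff e = 0
      · exact hβ.2.1 e fun h' => he (by rw [h, h', sub_zero])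
      · exact hα.2.1 e h
    · obtain ⟨r₁, hr₁, h₁⟩ := hα.2.2
      obtain ⟨r₂, hr₂, h₂⟩ := hβ.2.2
      refine ⟨min r₁ r₂, lt_min hr₁ hr₂, Summable.of_nonneg_of_le (fun n => by positivity)
        (fun n => ?_) (h₁.add h₂)⟩
      have h3 : 0 < min r₁ r₂ := lt_min hr₁ hr₂
      calc _ ≤ (‖α.coeff ((n : ℝ) / d)‖ + ‖β.coeff ((n : ℝ) / d)‖) * min r₁ r₂ ^ n := by
            gcongr; exact norm_sub_le _ _
        _ = ‖α.coeff ((n : ℝ) / d)‖ * min r₁ r₂ ^ n +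
            ‖β.coeff ((n : ℝ) / d)‖ * min r₁ r₂ ^ n := add_mul _ _ _
        _ ≤ _ := by
            gcongr
            exacts [min_le_left _ _, min_le_right _ _]⟩

@[simp] lemma coeff_sub (α β : FracSeries 𝕜) (e : ℝ) :
    (α - β).coeff e = α.coeff e - β.coeff e := rfl

lemma eventually_eval_sub (α β : FracSeries 𝕜) :
    ∀ᶠ y : ℝ in 𝓝[>] 0, (α - β).eval y = α.eval y - β.eval y := by
  obtain ⟨d₀, hα, hβ⟩ := exists_common_hasDen α β
  obtain ⟨d₁, hγ⟩ := (α - β).exists_hasDen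
  replace hα := hα.mul hγ.1
  replace hβ := hβ.mul hγ.1
  have hd : 0 < d₀ := Nat.pos_of_ne_zero fun h => by simp [h, HasDen] at hα
  replace hγ := hγ.mul hd
  rw [mul_comm] at hγ
  have ht := tendsto_root' (𝕜 := 𝕜) hα.1
  filter_upwards [ht.eventually hα.2.2.eventually_hasSum, ht.eventually hβ.2.2.eventually_hasSum,
    ht.eventually hγ.2.2.eventually_hasSum, self_mem_nhdsWithin] with y h1 h2 h3 (hy : 0 < y)
  rw [hα.eval_eq hy, hβ.eval_eq hy, hγ.eval_eq hy]
  exact h3.unique (HasSum.congr_fun (h1.sub h2) fun n => by simp [sub_mul])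

/-- The fractional power series `v y^{n/d}`. -/
noncomputable def monomial (n d : ℕ) (hd : 0 < d) (v : 𝕜) : FracSeries 𝕜 :=
  ⟨fun e => if e = (n : ℝ) / d then v else 0, d, hd,
    fun e he => ⟨n, by by_contra h; exact he (if_neg h)⟩, 1, one_pos, by
      refine summable_of_ne_finset_zero (s := {n}) fun k hk => ?_
      have hd0 : (d : ℝ) ≠ 0 := by exact_mod_cast hd.ne'
      rw [if_neg fun h => hk ?_]
      · simp
      · have h' : (k : ℝ) = n := (div_left_inj' hd0).1 h
        simpa using (by exact_mod_cast h' : k = n)⟩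

/-- A real fractional power series as a complex one. -/
noncomputable def ofReal (α : FracSeries ℝ) : FracSeries ℂ :=
  ⟨fun e => (α.coeff e : ℂ), by
    obtain ⟨d, hd, hsupp, r, hr, hs⟩ := α.convergent
    exact ⟨d, hd, fun e he => hsupp e (by simpa using he), r, hr, by
      simpa [Complex.norm_real] using hs⟩⟩

@[simp] lemma coeff_ofReal (α : FracSeries ℝ) (e : ℝ) : (ofReal α).coeff e = (α.coeff e : ℂ) := rfl

lemma eval_ofReal (α : FracSeries ℝ) (y : ℝ) : (ofReal α).eval y = (α.eval y : ℂ) := by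
  rw [FracSeries.eval, FracSeries.eval, Complex.ofReal_tsum]
  exact tsum_congr fun e => by simp

lemma ofReal_sub (α β : FracSeries ℝ) : ofReal (α - β) = ofReal α - ofReal β := by
  ext e
  simp

lemma ofReal_injective : Function.Injective ofReal := fun α β h => by
  ext e
  have := congrArg (fun γ => γ.coeff e) h
  simpa using this

/-- The order in `y` of a fractional power series (`∞` for the zero series). -/
noncomputable def ord (α : FracSeries 𝕜) : ℝ≥0∞ :=
  ⨅ (e : ℝ) (_ : α.coeff e ≠ 0), ENNReal.ofReal e

lemma exists_leading (α : FracSeries 𝕜) (h : ∃ e, α.coeff e ≠ 0) :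
    ∃ e, 0 ≤ e ∧ α.coeff e ≠ 0 ∧ ∀ e' < e, α.coeff e' = 0 := by
  obtain ⟨d, hd, hsupp, -⟩ := α.exists_hasDen
  have hd0 : (0 : ℝ) < d := by exact_mod_cast hd
  have hex : ∃ n : ℕ, α.coeff ((n : ℝ) / d) ≠ 0 := by
    obtain ⟨e, he⟩ := h
    obtain ⟨n, rfl⟩ := hsupp e he
    exact ⟨n, he⟩
  classical
  refine ⟨(Nat.find hex : ℝ) / d, by positivity, Nat.find_spec hex, fun e' he' => ?_⟩
  by_contra hne
  obtain ⟨n, rfl⟩ := hsupp e' hne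
  rw [div_lt_div_iff_of_pos_right hd0] at he'
  exact Nat.find_min hex (by exact_mod_cast he') hne

lemma ofReal_le_ord {α : FracSeries 𝕜} {h : ℝ} :
    ENNReal.ofReal h ≤ α.ord ↔ ∀ e < h, α.coeff e = 0 := by
  constructor
  · intro hle e he
    by_contra hne
    have h1 : ENNReal.ofReal h ≤ ENNReal.ofReal e := hle.trans (iInf₂_le e hne)
    have h0 : 0 ≤ e := by
      by_contra hneg
      exact hne (α.coeff_of_neg (not_le.1 hneg))
    exact he.not_ge ((ENNReal.ofReal_le_ofReal_iff h0).1 h1)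
  · intro hz
    refine le_iInf₂ fun e he => ENNReal.ofReal_le_ofReal ?_
    by_contra hlt
    exact he (hz e (not_le.1 hlt))

lemma ord_eq_of_leading {α : FracSeries 𝕜} {e : ℝ} (he : α.coeff e ≠ 0)
    (h : ∀ e' < e, α.coeff e' = 0) : α.ord = ENNReal.ofReal e :=
  le_antisymm (iInf₂_le e he) (ofReal_le_ord.2 h)

lemma ord_eq_top {α : FracSeries 𝕜} : α.ord = ⊤ ↔ ∀ e, α.coeff e = 0 := by
  constructor
  · intro h e
    by_contra hne
    have h1 : α.ord ≤ ENNReal.ofReal e := iInf₂_le e hne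
    rw [h, top_le_iff] at h1
    exact ENNReal.ofReal_ne_top h1
  · intro h
    simp [ord, h]

lemma ofReal_lt_ord {α : FracSeries 𝕜} {h : ℝ} (h0 : 0 ≤ h) :
    ENNReal.ofReal h < α.ord ↔ ∀ e ≤ h, α.coeff e = 0 := by
  constructor
  · intro hlt e he
    by_contra hne
    exact (hlt.trans_le (iInf₂_le e hne)).not_ge (ENNReal.ofReal_le_ofReal he)
  · intro hz
    by_cases hex : ∃ e, α.coeff e ≠ 0
    · obtain ⟨e, he0, he, hlow⟩ := α.exists_leading hex
      rw [ord_eq_of_leading he hlow]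
      have : h < e := by
        by_contra hle
        exact he (hz e (not_lt.1 hle))
      exact (ENNReal.ofReal_lt_ofReal_iff (h0.trans_lt this)).2 this
    · push Not at hex
      rw [ord_eq_top.2 hex]
      exact ENNReal.ofReal_lt_top

lemma ord_ofReal (α : FracSeries ℝ) : (ofReal α).ord = α.ord := by simp [ord]

/-- The order of `α` is its growth exponent, along every filter on which `y → 0⁺`. -/
lemma isBigO_eval_iff {ι : Type*} {l : Filter ι} [l.NeBot] {y : ι → ℝ}
    (hy : Tendsto y l (𝓝[>] 0)) (α : FracSeries 𝕜) {h : ℝ} :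
    (fun s => α.eval (y s)) =O[l] (fun s => y s ^ h) ↔ ENNReal.ofReal h ≤ α.ord := by
  have hpos : ∀ᶠ s in l, 0 < y s := hy.eventually self_mem_nhdsWithin
  constructor
  · intro hO
    by_contra hlt
    rw [not_le] at hlt
    have hex : ∃ e, α.coeff e ≠ 0 := by
      by_contra! hz
      rw [ord_eq_top.2 hz] at hlt
      exact not_top_lt hlt
    obtain ⟨e, he0, he, hlow⟩ := α.exists_leading hex
    rw [ord_eq_of_leading he hlow] at hlt
    have heh : e < h := by
      by_contra hle
      exact hlt.not_ge (ENNReal.ofReal_le_ofReal (not_lt.1 hle))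
    have h1 : Tendsto (fun s => (y s ^ (-e)) • α.eval (y s)) l (𝓝 (α.coeff e)) :=
      (α.tendsto_eval_smul hlow).comp hy
    have h2 : (fun s => (y s ^ (-e)) • α.eval (y s)) =O[l] fun s => y s ^ (h - e) := by
      refine ((isBigO_refl (fun s => y s ^ (-e)) l).smul hO).congr' EventuallyEq.rfl ?_
      filter_upwards [hpos] with s hs
      rw [smul_eq_mul, ← Real.rpow_add hs]
      congr 1
      ring
    have h3 : Tendsto (fun s => y s ^ (h - e)) l (𝓝 0) := by
      have h5 : (0 : ℝ) < h - e := sub_pos.2 heh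
      have := (Real.continuousAt_rpow_const 0 (h - e) (Or.inr h5.le)).tendsto
      rw [Real.zero_rpow h5.ne'] at this
      exact this.comp (hy.mono_right nhdsWithin_le_nhds)
    exact he (tendsto_nhds_unique h1 (h2.trans_tendsto h3))
  · intro hle
    have h1 : Tendsto (fun s => (y s ^ (-h)) • α.eval (y s)) l (𝓝 (α.coeff h)) :=
      (α.tendsto_eval_smul (ofReal_le_ord.1 hle)).comp hy
    refine ((isBigO_refl (fun s => y s ^ h) l).smul (h1.isBigO_one ℝ)).congr' ?_ ?_
    · filter_upwards [hpos] with s hs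
      rw [smul_smul, ← Real.rpow_add hs, add_neg_cancel, Real.rpow_zero, one_smul]
    · exact Eventually.of_forall fun s => by simp

lemma eventually_eval_ne_zero (α : FracSeries 𝕜) (h : ∃ e, α.coeff e ≠ 0) :
    ∀ᶠ y : ℝ in 𝓝[>] 0, α.eval y ≠ 0 := by
  obtain ⟨e, -, he, hlow⟩ := α.exists_leading h
  filter_upwards [(α.tendsto_eval_smul hlow).eventually_ne he] with y hy h0
  simp [h0] at hy

lemma eventually_eval_ne {α β : FracSeries 𝕜} (h : α ≠ β) :
    ∀ᶠ y : ℝ in 𝓝[>] 0, α.eval y ≠ β.eval y := by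
  have hex : ∃ e, (α - β).coeff e ≠ 0 := by
    by_contra! hz
    exact h (FracSeries.ext (funext fun e => sub_eq_zero.1 (hz e)))
  filter_upwards [(α - β).eventually_eval_ne_zero hex, eventually_eval_sub α β] with y h1 h2 h3
  exact h1 (by rw [h2, h3, sub_self])

lemma tendsto_eval (α : FracSeries 𝕜) : Tendsto α.eval (𝓝[>] 0) (𝓝 (α.coeff 0)) := by
  have := α.tendsto_eval_smul (e := 0) fun e he => α.coeff_of_neg he
  simpa using this

end FracSeries

/-! ### Newton–Puiseux roots as fractional power series -/

/-- The function `G(x, σ y)`. -/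
def signTwist (σ : ℤˣ) (G : ℂ × ℂ → ℂ) : ℂ × ℂ → ℂ := fun v => G (v.1, ((σ : ℤ) : ℂ) * v.2)

lemma norm_signTwist_point (σ : ℤˣ) (v : ℂ × ℂ) : ‖(v.1, ((σ : ℤ) : ℂ) * v.2)‖ = ‖v‖ := by
  rcases Int.units_eq_one_or σ with rfl | rfl <;> simp [Prod.norm_def]

lemma continuous_signTwist_point (σ : ℤˣ) :
    Continuous fun v : ℂ × ℂ => (v.1, ((σ : ℤ) : ℂ) * v.2) := by fun_prop

lemma AnalyticAt.signTwist {G : ℂ × ℂ → ℂ} (hG : AnalyticAt ℂ G 0) (σ : ℤˣ) :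
    AnalyticAt ℂ (signTwist σ G) 0 := by
  refine AnalyticAt.fun_comp (g := G) (f := fun v : ℂ × ℂ => (v.1, ((σ : ℤ) : ℂ) * v.2)) ?_
    (analyticAt_fst.prod (analyticAt_const.mul analyticAt_snd))
  simpa [Prod.mk_zero_zero] using hG

lemma OrderGE.signTwist {G : ℂ × ℂ → ℂ} {n : ℕ} (hG : OrderGE n G) (σ : ℤˣ) :
    OrderGE n (signTwist σ G) := by
  obtain ⟨C, hC⟩ := hG
  refine ⟨C, hC.mono fun M hM v hv => hM _ ?_⟩
  rwa [norm_signTwist_point]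

lemma axis_signTwist (G : ℂ × ℂ → ℂ) (σ : ℤˣ) :
    (fun x : ℂ => signTwist σ G (x, 0)) = fun x => G (x, 0) := by
  simp [signTwist]

/-- `ρ` lists the Newton–Puiseux roots `x = ρᵢ(|y|)` of `g` in `σ y > 0`, with multiplicities; all
of them are `O(|y|)`. -/
structure PuiseuxRoots (g : ℝ × ℝ → ℝ) (σ : ℤˣ) (n : ℕ) (ρ : Fin n → FracSeries ℂ) : Prop where
  exists_factors : ∃ (G : ℂ × ℂ → ℂ) (d : ℕ) (r : Fin n → ℂ → ℂ) (U : ℂ × ℂ → ℂ),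
    IsComplexification g G ∧ PuiseuxFactors (signTwist σ G) n d r U ∧
      (∀ i, r i =O[𝓝 0] fun s => s ^ d) ∧
      ∀ i, ∀ᶠ y : ℝ in 𝓝[>] 0, (ρ i).eval y = r i ((y ^ (1 / d : ℝ) : ℝ) : ℂ)
  coeff_eq_zero : ∀ i, ∀ e < 1, (ρ i).coeff e = 0

lemma root_pow {d : ℕ} (hd : 0 < d) {y : ℝ} (hy : 0 < y) : (y ^ (1 / d : ℝ)) ^ d = y := by
  rw [one_div, Real.rpow_inv_natCast_pow hy.le hd.ne']

/-- A function of order `n` at the origin, whose restriction to the `x`-axis has the same order, has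
exactly `n` Newton–Puiseux roots on each side of the `x`-axis. For `σ = -1` these are the roots of
`G(x, -y)` over `y > 0`. -/
lemma exists_puiseuxRoots {g : ℝ × ℝ → ℝ} {G : ℂ × ℂ → ℂ} (hG : IsComplexification g G) {n : ℕ}
    (hord : OrderGE n G) (hn : analyticOrderAt (fun x : ℂ => G (x, 0)) 0 = n) (σ : ℤˣ) :
    ∃ ρ, PuiseuxRoots g σ n ρ := by
  have hn' : analyticOrderAt (fun x : ℂ => signTwist σ G (x, 0)) 0 = n := by
    rwa [axis_signTwist]
  obtain ⟨d, r, U, hr⟩ := (hG.1.signTwist σ).exists_puiseuxFactors n hn'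
  have hO := fun i => hr.isBigO (hG.1.signTwist σ) (hord.signTwist σ) hn' i
  choose ρ hρd hρ using fun i => FracSeries.exists_of_analyticAt (hr.analytic i) hr.pos
  refine ⟨ρ, ⟨G, d, r, U, hG, hr, hO, hρ⟩, fun i => FracSeries.ofReal_le_ord.1 ?_⟩
  refine (FracSeries.isBigO_eval_iff (y := fun y : ℝ => y) tendsto_id (ρ i)).1 ?_
  have h1 := ((hO i).comp_tendsto (FracSeries.tendsto_root' (𝕜 := ℂ) hr.pos)).congr'
    ((hρ i).mono fun y hy => hy.symm) EventuallyEq.rfl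
  refine h1.trans (IsBigO.of_bound 1 ?_)
  filter_upwards [self_mem_nhdsWithin] with y (hy : 0 < y)
  have h2 : ((y ^ (1 / d : ℝ) : ℝ) : ℂ) ^ d = (y : ℂ) := by
    rw [← Complex.ofReal_pow, root_pow hr.pos hy]
  simp [Function.comp, h2, -one_div]

lemma ofReal_sign_mul (σ : ℤˣ) (y : ℝ) :
    (((((σ : ℤ) : ℝ) * y : ℝ)) : ℂ) = ((σ : ℤ) : ℂ) * (y : ℂ) := by
  push_cast
  rfl

/-- The factorization of `G(x, σ y)`, for real `y > 0`, into a unit `V` and the factors given by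
the Newton–Puiseux roots; `V` has a nonzero limit and a bounded logarithmic derivative. -/
lemma PuiseuxRoots.exists_factorization {g : ℝ × ℝ → ℝ} {σ : ℤˣ} {n : ℕ}
    {ρ : Fin n → FracSeries ℂ} (h : PuiseuxRoots g σ n ρ) {G : ℂ × ℂ → ℂ}
    (hG : IsComplexification g G) :
    ∃ (V : ℝ → ℂ → ℂ) (u : ℂ) (ε B : ℝ), u ≠ 0 ∧ 0 < ε ∧
      (∀ᶠ y : ℝ in 𝓝[>] 0, ∀ x : ℂ, ‖x‖ < ε → AnalyticAt ℂ (V y) x ∧ V y x ≠ 0 ∧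
        ‖deriv (V y) x‖ ≤ B * ‖V y x‖ ∧
        G (x, ((((σ : ℤ) : ℝ) * y : ℝ) : ℂ)) = V y x * ∏ i, (x - (ρ i).eval y)) ∧
      ∀ φ : ℝ → ℂ, Tendsto φ (𝓝[>] 0) (𝓝 0) → Tendsto (fun y => V y (φ y)) (𝓝[>] 0) (𝓝 u) := by
  obtain ⟨G', d, r, U, hG', hr, -, hρ⟩ := h.exists_factors
  have hGG : ∀ᶠ v in 𝓝 (0 : ℂ × ℂ), signTwist σ G v = signTwist σ G' v :=
    ((continuous_signTwist_point σ).tendsto' 0 0 (by simp)).eventually (hG.eventually_eq hG')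
  have hP := analyticAt_complexPartialX hr.unit_analytic
  set B := (‖complexPartialX U 0‖ + 1) / ‖U 0‖
  have hU0 : 0 < ‖U 0‖ := norm_pos_iff.2 hr.unit_ne_zero
  have hB : ∀ᶠ v in 𝓝 (0 : ℂ × ℂ), ‖complexPartialX U v‖ < B * ‖U v‖ := by
    refine hP.continuousAt.norm.eventually_lt
      (continuousAt_const.mul hr.unit_analytic.continuousAt.norm) ?_
    rw [div_mul_cancel₀ _ hU0.ne']
    exact lt_add_one _
  have hpow : Tendsto (fun v : ℂ × ℂ => (v.1, v.2 ^ d)) (𝓝 0) (𝓝 0) :=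
    Continuous.tendsto' (by fun_prop) 0 0 (by simp [hr.pos.ne'])
  obtain ⟨ε, hε, hall⟩ := eventually_prodMk_zero (hr.eventually_eq.and ((hpow.eventually hGG).and
    (hB.and ((hr.unit_analytic.continuousAt.eventually_ne hr.unit_ne_zero).and
      hr.unit_analytic.eventually_analyticAt))))
  refine ⟨fun y x => U (x, ((y ^ (1 / d : ℝ) : ℝ) : ℂ)), U 0, ε, B, hr.unit_ne_zero, hε, ?_, ?_⟩
  · have hroot : ∀ᶠ y : ℝ in 𝓝[>] 0, ‖((y ^ (1 / d : ℝ) : ℝ) : ℂ)‖ < ε := by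
      simpa using (FracSeries.tendsto_root' (𝕜 := ℂ) hr.pos).eventually
        (Metric.ball_mem_nhds 0 hε)
    filter_upwards [hroot, eventually_all.2 hρ, self_mem_nhdsWithin] with y h1 h2 (hy : 0 < y) x hx
    obtain ⟨h3, h4, h5, h6, h7⟩ := hall x _ hx h1
    refine ⟨?_, h6, h5.le, ?_⟩
    · exact AnalyticAt.comp₂ (h := U) (f := fun x => x) (g := fun _ => _) (x := x) h7
        analyticAt_id analyticAt_const
    · have h8 : ((y ^ (1 / d : ℝ) : ℝ) : ℂ) ^ d = (y : ℂ) := by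
        rw [← Complex.ofReal_pow, root_pow hr.pos hy]
      rw [ofReal_sign_mul, ← h8]
      simp only [h2]
      exact h4.trans h3
  · intro φ hφ
    have h1 : Tendsto (fun y : ℝ => (φ y, ((y ^ (1 / d : ℝ) : ℝ) : ℂ))) (𝓝[>] 0) (𝓝 0) :=
      hφ.prodMk_nhds (FracSeries.tendsto_root' (𝕜 := ℂ) hr.pos)
    exact hr.unit_analytic.continuousAt.tendsto.comp h1

lemma analyticOrderAt_sub_const (a x₀ : ℂ) [Decidable (a = x₀)] :
    analyticOrderAt (fun x : ℂ => x - a) x₀ = if a = x₀ then 1 else 0 := by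
  split_ifs with h
  · subst h
    exact analyticOrderAt_id_sub_const_self
  · exact analyticOrderAt_id_sub_const_of_ne (Ne.symm h)

lemma analyticOrderAt_unit_mul_prod {n : ℕ} {V : ℂ → ℂ} {x₀ : ℂ} (hV : AnalyticAt ℂ V x₀)
    (hV0 : V x₀ ≠ 0) (a : Fin n → ℂ) :
    analyticOrderAt (fun x => V x * ∏ i, (x - a i)) x₀ = ({i | a i = x₀}.ncard : ℕ∞) := by
  classical
  have hA : ∀ i ∈ Finset.univ, AnalyticAt ℂ (fun x : ℂ => x - a i) x₀ :=
    fun i _ => analyticAt_id.sub analyticAt_const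
  have hprod : ∀ s : Finset (Fin n), analyticOrderAt (fun x => ∏ i ∈ s, (x - a i)) x₀ =
      ∑ i ∈ s, analyticOrderAt (fun x : ℂ => x - a i) x₀ := fun s => by
    induction s using Finset.induction_on with
    | empty =>
      simp only [Finset.prod_empty, Finset.sum_empty]
      exact analyticAt_const.analyticOrderAt_eq_zero.2 one_ne_zero
    | insert i s hi ih =>
      simp only [Finset.prod_insert hi, Finset.sum_insert hi]
      rw [← ih]
      exact analyticOrderAt_mul (hA i (Finset.mem_univ i))
        (Finset.analyticAt_fun_prod s fun j _ => hA j (Finset.mem_univ j))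
  have h1 : analyticOrderAt (fun x => V x * ∏ i, (x - a i)) x₀ =
      analyticOrderAt V x₀ + analyticOrderAt (fun x => ∏ i, (x - a i)) x₀ :=
    analyticOrderAt_mul hV (Finset.analyticAt_fun_prod _ hA)
  rw [h1, hV.analyticOrderAt_eq_zero.2 hV0, zero_add, hprod, Set.ncard_eq_toFinset_card']
  simp only [analyticOrderAt_sub_const, Finset.sum_boole]
  congr 2
  ext i
  simp

/-- For small `y > 0`, the value `β(y)` is a zero of `G(·, σ y)` of order the number of `i` with `ρᵢ
= β`: distinct fractional power series have distinct values there. -/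
lemma PuiseuxRoots.eventually_iteratedDeriv_iff {g : ℝ × ℝ → ℝ} {σ : ℤˣ} {n : ℕ}
    {ρ : Fin n → FracSeries ℂ} (h : PuiseuxRoots g σ n ρ) {G : ℂ × ℂ → ℂ}
    (hG : IsComplexification g G) {β : FracSeries ℂ} (hβ : β.coeff 0 = 0) (j : ℕ) :
    ∀ᶠ y : ℝ in 𝓝[>] 0, ((∀ i ≤ j,
      iteratedDeriv i (fun x : ℂ => G (x, ((((σ : ℤ) : ℝ) * y : ℝ) : ℂ))) (β.eval y) = 0) ↔
        j < {i | ρ i = β}.ncard) := by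
  obtain ⟨V, u, ε, B, -, hε, hV, -⟩ := h.exists_factorization hG
  have hβlim : Tendsto β.eval (𝓝[>] 0) (𝓝 0) := by simpa [hβ] using β.tendsto_eval
  have hne : ∀ᶠ y : ℝ in 𝓝[>] 0, ∀ i, (ρ i).eval y = β.eval y ↔ ρ i = β := by
    refine eventually_all.2 fun i => ?_
    by_cases hi : ρ i = β
    · exact Eventually.of_forall fun y => by simp [hi]
    · exact (FracSeries.eventually_eval_ne hi).mono fun y hy => by simp [hi, hy]
  filter_upwards [hV, hne, hβlim.eventually (Metric.ball_mem_nhds 0 hε)] with y h1 h2 h3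
  have h3' : ‖β.eval y‖ < ε := by simpa using h3
  have heq : (fun x : ℂ => G (x, ((((σ : ℤ) : ℝ) * y : ℝ) : ℂ))) =ᶠ[𝓝 (β.eval y)]
      fun x => V y x * ∏ i, (x - (ρ i).eval y) := by
    filter_upwards [Metric.isOpen_ball.mem_nhds h3] with x hx
    exact (h1 x (by simpa using hx)).2.2.2
  obtain ⟨hVA, hV0, -, -⟩ := h1 _ h3'
  have hA : AnalyticAt ℂ (fun x => V y x * ∏ i, (x - (ρ i).eval y)) (β.eval y) :=
    hVA.mul (Finset.analyticAt_fun_prod _ fun i _ => analyticAt_id.sub analyticAt_const)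
  have hord := analyticOrderAt_unit_mul_prod hVA hV0 fun i => (ρ i).eval y
  rw [show {i | (ρ i).eval y = β.eval y} = {i | ρ i = β} by ext i; simp [h2],
    ← analyticOrderAt_congr heq] at hord
  have := natCast_le_analyticOrderAt_iff_iteratedDeriv_eq_zero (n := j + 1) (hA.congr heq.symm)
  rw [hord] at this
  simp only [Nat.lt_succ_iff] at this
  rw [← this]
  norm_cast

/-- The multiplicity of `β` as a Newton–Puiseux root is the number of its occurrences in the list
`ρ`. -/
lemma PuiseuxRoots.isRootGT_iff {g : ℝ × ℝ → ℝ} {σ : ℤˣ} {n : ℕ} {ρ : Fin n → FracSeries ℂ}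
    (h : PuiseuxRoots g σ n ρ) (β : FracSeries ℂ) (j : ℕ) :
    IsRootGT g σ β j ↔ j < {i | ρ i = β}.ncard := by
  constructor
  · rintro ⟨hβ, G, hG, hroot⟩
    have h1 : ∀ᶠ y : ℝ in 𝓝[>] 0, ∀ i ∈ Finset.range (j + 1),
        iteratedDeriv i (fun x : ℂ => G (x, ((((σ : ℤ) : ℝ) * y : ℝ) : ℂ))) (β.eval y) = 0 :=
      (Filter.eventually_all_finset _).2 fun i hi => hroot i (Nat.lt_succ_iff.1
        (Finset.mem_range.1 hi))
    obtain ⟨y, h2, h3⟩ := (h1.and (h.eventually_iteratedDeriv_iff hG hβ j)).exists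
    exact h3.1 fun i hi => h2 i (Finset.mem_range.2 (Nat.lt_succ_of_le hi))
  · intro hj
    obtain ⟨i, rfl⟩ : ∃ i, ρ i = β := by
      by_contra! hne
      have : {i | ρ i = β} = ∅ := by
        ext i
        simp [hne i]
      simp [this] at hj
    have hβ : (ρ i).coeff 0 = 0 := h.coeff_eq_zero i 0 one_pos
    obtain ⟨G, -, -, -, hG, -⟩ := h.exists_factors
    refine ⟨hβ, G, hG, fun k hk => ?_⟩
    filter_upwards [h.eventually_iteratedDeriv_iff hG hβ j] with y hy
    exact hy.2 hj k hk

/-- Counting the values of a finite family with multiplicities. -/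
lemma encard_setOf_lt_ncard_fiber {n : ℕ} {α : Type*} (ρ : Fin n → α) (Q : α → Prop) :
    {p : α × ℕ | Q p.1 ∧ p.2 < {i | ρ i = p.1}.ncard}.encard = ({i | Q (ρ i)}.ncard : ℕ∞) := by
  have hfin : ∀ β, Finite {i | ρ i = β} := fun β => inferInstance
  let e : ∀ β, {i | ρ i = β} ≃ Fin {i | ρ i = β}.ncard := fun β => Finite.equivFin _
  let f : Fin n → α × ℕ := fun i => (ρ i, e (ρ i) ⟨i, rfl⟩)
  have key : ∀ β i (h : ρ i = β), ((e (ρ i) ⟨i, rfl⟩ : Fin _) : ℕ) = e β ⟨i, h⟩ := by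
    rintro β i rfl
    rfl
  have hinj : Function.Injective f := fun i i' hii => by
    have h1 : ρ i = ρ i' := congrArg Prod.fst hii
    have h2 : ((e (ρ i) ⟨i, rfl⟩ : Fin _) : ℕ) = e (ρ i') ⟨i', rfl⟩ := congrArg Prod.snd hii
    rw [key _ i h1] at h2
    have h3 := (e (ρ i')).injective (Fin.ext h2)
    exact congrArg Subtype.val h3
  have himage : {p : α × ℕ | Q p.1 ∧ p.2 < {i | ρ i = p.1}.ncard} = f '' {i | Q (ρ i)} := by
    ext ⟨β, k⟩
    constructor
    · rintro ⟨hQ, hk⟩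
      obtain ⟨⟨i, hi⟩, hik⟩ := (e β).surjective ⟨k, hk⟩
      subst hi
      exact ⟨i, hQ, Prod.ext rfl (congrArg Fin.val hik)⟩
    · rintro ⟨i, hi, hf⟩
      obtain ⟨rfl, rfl⟩ := Prod.mk.inj hf
      exact ⟨hi, Fin.is_lt _⟩
  rw [himage, hinj.encard_image, ← (Set.toFinite _).cast_ncard_eq]

/-! ### Contact orders of graphs of fractional power series -/

section Contact

variable {𝕜 : Type} [RCLike 𝕜]

lemma AnalyticAt.exists_eq_pow_mul_of_isBigO {r : 𝕜 → 𝕜} (hr : AnalyticAt 𝕜 r 0) {d : ℕ}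
    (hO : r =O[𝓝 0] fun s => s ^ d) :
    ∃ g, AnalyticAt 𝕜 g 0 ∧ ∀ᶠ s in 𝓝 0, r s = s ^ d * g s := by
  suffices h : (d : ℕ∞) ≤ analyticOrderAt r 0 by
    simpa using (natCast_le_analyticOrderAt hr).1 h
  by_contra hlt
  rw [not_le] at hlt
  obtain ⟨N, hN⟩ := ENat.ne_top_iff_exists.1 hlt.ne_top
  rw [← hN] at hlt
  have hNd : N < d := by exact_mod_cast hlt
  obtain ⟨u, hu, hu0, hueq⟩ := hr.analyticOrderAt_eq_natCast.1 hN.symm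
  have h1 : u =O[𝓝[≠] 0] fun s => s ^ (d - N) := by
    obtain ⟨C, hC⟩ := hO.bound
    refine IsBigO.of_bound C ?_
    filter_upwards [hC.filter_mono nhdsWithin_le_nhds, hueq.filter_mono nhdsWithin_le_nhds,
      self_mem_nhdsWithin] with s h2 h3 (h4 : s ≠ 0)
    rw [h3, sub_zero, smul_eq_mul, norm_mul, ← Nat.add_sub_cancel' hNd.le, pow_add, norm_mul] at h2
    have h5 : 0 < ‖s ^ N‖ := norm_pos_iff.2 (pow_ne_zero _ h4)
    rw [show C * (‖s ^ N‖ * ‖s ^ (d - N)‖) = ‖s ^ N‖ * (C * ‖s ^ (d - N)‖) by ring] at h2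
    exact le_of_mul_le_mul_left h2 h5
  have h2 : Tendsto (fun s : 𝕜 => s ^ (d - N)) (𝓝[≠] 0) (𝓝 0) :=
    (Continuous.tendsto' (by fun_prop) 0 0 (by simp [(Nat.sub_pos_of_lt hNd).ne'])).mono_left
      nhdsWithin_le_nhds
  exact hu0 (tendsto_nhds_unique (hu.continuousAt.tendsto.mono_left nhdsWithin_le_nhds)
    (h1.trans_tendsto h2))

/-- If `r(s) = O(sᵈ)` then `r` is a Lipschitz function of `sᵈ`, as long as the chosen `d`-th roots
`s, s'` satisfy `|s'|ᵈ⁻¹ |s - s'| = O(|sᵈ - s'ᵈ|)`. -/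
lemma AnalyticAt.exists_lipschitz_pow {r : 𝕜 → 𝕜} (hr : AnalyticAt 𝕜 r 0) {d : ℕ} (hd : 0 < d)
    (hO : r =O[𝓝 0] fun s => s ^ d) {K : ℝ} :
    ∃ C ε : ℝ, 0 < ε ∧ ∀ s s' : 𝕜, ‖s‖ < ε → ‖s'‖ < ε →
      ‖s'‖ ^ (d - 1) * ‖s - s'‖ ≤ K * ‖s ^ d - s' ^ d‖ → ‖r s - r s'‖ ≤ C * ‖s ^ d - s' ^ d‖ := by
  obtain ⟨g, hg, hgeq⟩ := hr.exists_eq_pow_mul_of_isBigO hO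
  obtain ⟨L, T, hT, hLip⟩ := hg.hasStrictFDerivAt.exists_lipschitzOnWith
  have hbd : ∀ᶠ s in 𝓝 (0 : 𝕜), ‖g s‖ < ‖g 0‖ + 1 :=
    hg.continuousAt.norm.eventually (gt_mem_nhds (lt_add_one _))
  obtain ⟨ε, hε, hall⟩ := Metric.eventually_nhds_iff.1
    (hgeq.and (hbd.and (show ∀ᶠ s in 𝓝 (0 : 𝕜), s ∈ T from hT)))
  refine ⟨‖g 0‖ + 1 + ε * L * K, ε, hε, fun s s' hs hs' hle => ?_⟩
  obtain ⟨h1, h2, h3⟩ := hall (y := s) (by simpa using hs)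
  obtain ⟨h1', h2', h3'⟩ := hall (y := s') (by simpa using hs')
  rw [h1, h1', show s ^ d * g s - s' ^ d * g s' =
    (s ^ d - s' ^ d) * g s + s' ^ d * (g s - g s') by ring]
  have h4 : ‖g s - g s'‖ ≤ L * ‖s - s'‖ := by
    simpa [dist_eq_norm] using hLip.dist_le_mul s h3 s' h3'
  have h5 : ‖s'‖ ^ d = ‖s'‖ * ‖s'‖ ^ (d - 1) := by
    rw [← pow_succ', Nat.sub_add_cancel hd]
  calc _ ≤ ‖s ^ d - s' ^ d‖ * ‖g s‖ + ‖s'‖ ^ d * ‖g s - g s'‖ := by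
        refine (norm_add_le _ _).trans ?_
        rw [norm_mul, norm_mul, norm_pow]
    _ ≤ ‖s ^ d - s' ^ d‖ * (‖g 0‖ + 1) + ‖s'‖ ^ d * (L * ‖s - s'‖) := by gcongr
    _ = ‖s ^ d - s' ^ d‖ * (‖g 0‖ + 1) + ‖s'‖ * L * (‖s'‖ ^ (d - 1) * ‖s - s'‖) := by
        rw [h5]; ring
    _ ≤ ‖s ^ d - s' ^ d‖ * (‖g 0‖ + 1) + ε * L * (K * ‖s ^ d - s' ^ d‖) := by gcongr
    _ = _ := by ring

/-- The path `P` runs on the graph `x = α(|y|)` in `σ y > 0`, with `y s` the value of `|y|` at the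
parameter `s`; the graph is not tangent to the `x`-axis. -/
structure GraphPath (σ : ℤˣ) (α : FracSeries 𝕜) (P : ℝ → EuclideanSpace 𝕜 (Fin 2)) (y : ℝ → ℝ) :
    Prop where
  tendsto : Tendsto y (𝓝[>] 0) (𝓝[>] 0)
  fst : ∀ᶠ s in 𝓝[>] (0 : ℝ), P s 0 = α.eval (y s)
  snd : ∀ᶠ s in 𝓝[>] (0 : ℝ), P s 1 = ((σ : ℤ) : 𝕜) * (y s : 𝕜)
  coeff_eq_zero : ∀ e < 1, α.coeff e = 0

lemma norm_sign (σ : ℤˣ) : ‖((σ : ℤ) : 𝕜)‖ = 1 := by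
  rcases Int.units_eq_one_or σ with rfl | rfl <;> simp

lemma norm_sign_mul (σ : ℤˣ) (y : 𝕜) : ‖((σ : ℤ) : 𝕜) * y‖ = ‖y‖ := by
  rw [norm_mul, norm_sign, one_mul]

lemma EuclideanSpace.norm_le_add (v : EuclideanSpace 𝕜 (Fin 2)) : ‖v‖ ≤ ‖v 0‖ + ‖v 1‖ := by
  rw [EuclideanSpace.norm_eq, Fin.sum_univ_two]
  refine Real.sqrt_le_iff.2 ⟨by positivity, ?_⟩
  nlinarith [norm_nonneg (v 0), norm_nonneg (v 1)]

lemma FracSeries.isBigO_of_coeff {α : FracSeries 𝕜} (h : ∀ e < 1, α.coeff e = 0) :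
    α.eval =O[𝓝[>] 0] fun y => y := by
  have := (FracSeries.isBigO_eval_iff (y := fun y : ℝ => y) tendsto_id α (h := 1)).2
    (FracSeries.ofReal_le_ord.2 h)
  simpa using this

lemma GraphPath.eventually_le_norm {σ : ℤˣ} {α : FracSeries 𝕜} {P : ℝ → EuclideanSpace 𝕜 (Fin 2)}
    {y : ℝ → ℝ} (h : GraphPath σ α P y) : ∀ᶠ s in 𝓝[>] (0 : ℝ), 0 < y s ∧ y s ≤ ‖P s‖ := by
  filter_upwards [h.snd, h.tendsto.eventually self_mem_nhdsWithin] with s h1 (h2 : 0 < y s)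
  refine ⟨h2, ?_⟩
  have := PiLp.norm_apply_le (P s) 1
  rwa [h1, norm_sign_mul, RCLike.norm_ofReal, abs_of_pos h2] at this

lemma GraphPath.norm_isBigO {σ : ℤˣ} {α : FracSeries 𝕜} {P : ℝ → EuclideanSpace 𝕜 (Fin 2)}
    {y : ℝ → ℝ} (h : GraphPath σ α P y) : ∃ C : ℝ, 0 < C ∧
      ∀ᶠ s in 𝓝[>] (0 : ℝ), ‖P s‖ ≤ C * y s := by
  obtain ⟨C, hC, hb⟩ := ((FracSeries.isBigO_of_coeff h.coeff_eq_zero).comp_tendsto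
    h.tendsto).exists_pos
  refine ⟨C + 1, by positivity, ?_⟩
  filter_upwards [h.fst, h.snd, h.tendsto.eventually self_mem_nhdsWithin, hb.bound]
    with s h1 h2 (h3 : 0 < y s) h4
  refine (EuclideanSpace.norm_le_add _).trans ?_
  rw [h1, h2, norm_sign_mul, RCLike.norm_ofReal, abs_of_pos h3, add_mul, one_mul]
  simp only [Function.comp, Real.norm_eq_abs, abs_of_pos h3] at h4
  linarith

/-- Along a graph not tangent to the `x`-axis the distance to the origin is comparable to `|y|`, so
orders may be measured in either. -/
lemma GraphPath.rpow_isTheta {σ : ℤˣ} {α : FracSeries 𝕜} {P : ℝ → EuclideanSpace 𝕜 (Fin 2)}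
    {y : ℝ → ℝ} (h : GraphPath σ α P y) {e : ℝ} (he : 0 ≤ e) :
    (fun s => ‖P s‖ ^ e) =Θ[𝓝[>] (0 : ℝ)] fun s => y s ^ e := by
  obtain ⟨C, hC, hb⟩ := h.norm_isBigO
  constructor
  · refine IsBigO.of_bound (C ^ e) ?_
    filter_upwards [hb, h.eventually_le_norm] with s h1 h2
    rw [Real.norm_of_nonneg (Real.rpow_nonneg (norm_nonneg _) e),
      Real.norm_of_nonneg (Real.rpow_nonneg h2.1.le e), ← Real.mul_rpow hC.le h2.1.le]
    exact Real.rpow_le_rpow (norm_nonneg _) h1 he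
  · refine IsBigO.of_bound 1 ?_
    filter_upwards [h.eventually_le_norm] with s h2
    rw [Real.norm_of_nonneg (Real.rpow_nonneg (norm_nonneg _) e),
      Real.norm_of_nonneg (Real.rpow_nonneg h2.1.le e), one_mul]
    exact Real.rpow_le_rpow h2.1.le h2.2 he

/-- If `q` passes through the points of the graph of `β`, the distance from `P` to `q` is at most
the horizontal distance of the two graphs. -/
lemma GraphPath.le_contactOrder {σ : ℤˣ} {α : FracSeries 𝕜} {P : ℝ → EuclideanSpace 𝕜 (Fin 2)}
    {y : ℝ → ℝ} (h : GraphPath σ α P y) {β : FracSeries 𝕜} {q : ℝ → EuclideanSpace 𝕜 (Fin 2)}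
    (hq : ∀ ε > 0, ∀ᶠ s in 𝓝[>] (0 : ℝ), ∃ t ∈ Set.Ico 0 ε,
      q t 0 = β.eval (y s) ∧ q t 1 = ((σ : ℤ) : 𝕜) * (y s : 𝕜)) :
    (α - β).ord ≤ contactOrder P q := by
  refine ENNReal.le_of_forall_nnreal_lt fun e he => ?_
  refine le_iSup₂_of_le (f := fun (h : ℝ≥0) (_ : ∀ᶠ ε in 𝓝[>] (0 : ℝ),
    (fun s => Metric.infDist (P s) (q '' Set.Ico 0 ε)) =O[𝓝[>] (0 : ℝ)]
      fun s => ‖P s‖ ^ (h : ℝ)) => (h : ℝ≥0∞)) e ?_ le_rfl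
  filter_upwards [self_mem_nhdsWithin] with ε (hε : 0 < ε)
  have h1 : (fun s => (α - β).eval (y s)) =O[𝓝[>] 0] fun s => y s ^ (e : ℝ) :=
    (FracSeries.isBigO_eval_iff h.tendsto _).2 (by simpa using he.le)
  refine IsBigO.trans (IsBigO.of_bound 1 ?_) (h1.trans (h.rpow_isTheta e.2).2)
  filter_upwards [hq ε hε, h.fst, h.snd,
    h.tendsto.eventually (FracSeries.eventually_eval_sub α β)] with s ⟨t, ht, ht0, ht1⟩ h2 h3 h4
  rw [one_mul, Real.norm_of_nonneg Metric.infDist_nonneg, h4]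
  refine (Metric.infDist_le_dist_of_mem (Set.mem_image_of_mem q ht)).trans ?_
  rw [dist_eq_norm]
  refine (EuclideanSpace.norm_le_add _).trans ?_
  simp [h2, h3, ht0, ht1]

/-- If every point of `q` is, up to a constant, at least as far from `P` as the nearest of the
graphs of the `ρᵢ`, then the contact order with `q` is at most the greatest order of coincidence
with some `ρᵢ`. -/
lemma GraphPath.contactOrder_le {σ : ℤˣ} {α : FracSeries 𝕜} {P : ℝ → EuclideanSpace 𝕜 (Fin 2)}
    {y : ℝ → ℝ} (h : GraphPath σ α P y) {n : ℕ} {ρ : Fin n → FracSeries 𝕜}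
    {q : ℝ → EuclideanSpace 𝕜 (Fin 2)} (C : ℝ)
    (hq : ∀ᶠ ε in 𝓝[>] (0 : ℝ), ∀ᶠ s in 𝓝[>] (0 : ℝ), ∀ t ∈ Set.Ico 0 ε,
      ∃ i, ‖α.eval (y s) - (ρ i).eval (y s)‖ ≤ C * dist (P s) (q t)) :
    contactOrder P q ≤ ⨆ i, (α - ρ i).ord := by
  refine iSup₂_le fun e he => ?_
  obtain ⟨ε, ⟨hε, hqε⟩, hε0⟩ := ((he.and hq).and self_mem_nhdsWithin).exists
  replace hε0 : 0 < ε := hε0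
  have h0 : (0 : ℝ) ∈ Set.Ico 0 ε := ⟨le_rfl, hε0⟩
  -- some root comes infinitely often within `C · dist` of the path
  have hfreq : ∃ i, ∃ᶠ s in 𝓝[>] (0 : ℝ), ‖α.eval (y s) - (ρ i).eval (y s)‖ ≤
      |C| * Metric.infDist (P s) (q '' Set.Ico 0 ε) := by
    by_contra hnot
    simp only [not_exists, Filter.not_frequently] at hnot
    obtain ⟨s, hs, hsnot⟩ := (hqε.and (Filter.eventually_all.2 hnot)).exists
    refine not_exists.2 hsnot ?_
    have hne : (Finset.univ : Finset (Fin n)).Nonempty := by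
      obtain ⟨i, -⟩ := hs 0 h0
      exact ⟨i, Finset.mem_univ i⟩
    obtain ⟨i, -, hi⟩ := Finset.univ.exists_min_image
      (fun i => ‖α.eval (y s) - (ρ i).eval (y s)‖) hne
    refine ⟨i, ?_⟩
    rcases (abs_nonneg C).eq_or_lt with hC | hC
    · obtain ⟨j, hj⟩ := hs 0 h0
      rw [abs_eq_zero.1 hC.symm, zero_mul] at hj
      rw [← hC, zero_mul]
      exact (hi j (Finset.mem_univ j)).trans hj
    · rw [← div_le_iff₀' hC]
      refine (Metric.le_infDist ⟨_, Set.mem_image_of_mem q h0⟩).2 ?_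
      rintro _ ⟨t, ht, rfl⟩
      obtain ⟨j, hj⟩ := hs t ht
      rw [div_le_iff₀' hC]
      exact (hi j (Finset.mem_univ j)).trans (hj.trans (by gcongr; exact le_abs_self C))
  obtain ⟨i, hi⟩ := hfreq
  refine le_iSup_of_le i ?_
  set S := {s : ℝ | ‖α.eval (y s) - (ρ i).eval (y s)‖ ≤
      |C| * Metric.infDist (P s) (q '' Set.Ico 0 ε)}
  have : (𝓝[>] (0 : ℝ) ⊓ 𝓟 S).NeBot := Filter.frequently_mem_iff_neBot.1 hi
  have htend : Tendsto y (𝓝[>] (0 : ℝ) ⊓ 𝓟 S) (𝓝[>] 0) := h.tendsto.mono_left inf_le_left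
  have hO : (fun s => (α - ρ i).eval (y s)) =O[𝓝[>] (0 : ℝ) ⊓ 𝓟 S] fun s => y s ^ (e : ℝ) := by
    refine IsBigO.trans (IsBigO.of_bound |C| ?_)
      ((hε.trans (h.rpow_isTheta e.2).1).mono inf_le_left)
    have h1 : ∀ᶠ s in 𝓝[>] (0 : ℝ) ⊓ 𝓟 S, s ∈ S :=
      Filter.mem_inf_of_right (Filter.mem_principal_self S)
    filter_upwards [h1, htend.eventually (FracSeries.eventually_eval_sub α (ρ i))] with s hs h2
    rw [h2, Real.norm_of_nonneg Metric.infDist_nonneg]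
    exact hs
  have := (FracSeries.isBigO_eval_iff htend (α - ρ i)).1 hO
  simpa using this

end Contact

/-- The principal `d`-th root is a contraction towards `1` on the right half plane. -/
lemma norm_cpow_sub_one_le {z : ℂ} (hz : 0 < z.re) {d : ℕ} (hd : 0 < d) :
    ‖z ^ (1 / d : ℂ) - 1‖ ≤ ‖z - 1‖ := by
  set w := z ^ (1 / d : ℂ) with hw
  have hz0 : z ≠ 0 := by rintro rfl; simp at hz
  have hd0 : (d : ℂ) ≠ 0 := by exact_mod_cast hd.ne'
  have hwd : w ^ d = z := by
    rw [hw, one_div]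
    exact Complex.cpow_nat_inv_pow z hd.ne'
  have hre : ∀ k < d, 0 ≤ (w ^ k).re := fun k hk => by
    have h1 : w ^ k = Complex.exp (Complex.log z * (k / d : ℂ)) := by
      rw [hw, Complex.cpow_def_of_ne_zero hz0, ← Complex.exp_nat_mul]
      congr 1
      ring
    rw [h1, Complex.exp_re]
    refine mul_nonneg (Real.exp_pos _).le (Real.cos_nonneg_of_mem_Icc ?_)
    have h2 : (Complex.log z * (k / d : ℂ)).im = z.arg * (k / d : ℝ) := by
      have : (k / d : ℂ) = ((k / d : ℝ) : ℂ) := by push_cast; rfl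
      rw [this, Complex.im_mul_ofReal, Complex.log_im]
    rw [h2]
    have h3 : |z.arg| < Real.pi / 2 := Complex.abs_arg_lt_pi_div_two_iff.2 (Or.inl hz)
    have h4 : (k / d : ℝ) ≤ 1 := by
      rw [div_le_one (by exact_mod_cast hd)]
      exact_mod_cast hk.le
    have h5 : |z.arg * (k / d : ℝ)| ≤ Real.pi / 2 := by
      rw [abs_mul, abs_of_nonneg (by positivity : (0 : ℝ) ≤ k / d)]
      calc _ ≤ |z.arg| * 1 := by gcongr
        _ ≤ _ := by rw [mul_one]; exact h3.le
    exact abs_le.1 h5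
  have hsum : 1 ≤ ‖∑ k ∈ Finset.range d, w ^ k‖ := by
    refine le_trans ?_ (Complex.re_le_norm _)
    rw [Complex.re_sum]
    obtain ⟨m, rfl⟩ : ∃ m, d = m + 1 := ⟨d - 1, by omega⟩
    rw [Finset.sum_range_succ']
    have := Finset.sum_nonneg fun k (hk : k ∈ Finset.range m) =>
      hre (k + 1) (by have := Finset.mem_range.1 hk; omega)
    simpa using this
  have h6 : z - 1 = (∑ k ∈ Finset.range d, w ^ k) * (w - 1) := by
    rw [geom_sum_mul, hwd]
  rw [h6, norm_mul]
  exact le_mul_of_one_le_left (norm_nonneg _) hsum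

/-- If `(x₀, w)` is a zero of `G` and `(X, σ y)` is a point with real `y > 0`, `X = O(y)`, then some
Newton–Puiseux root `ρᵢ(y)` is as close to `X` as `(x₀, w)` is to `(X, σ y)`, up to a constant. -/
lemma PuiseuxRoots.exists_dist_le {g : ℝ × ℝ → ℝ} {σ : ℤˣ} {n : ℕ} (hn : 0 < n)
    {ρ : Fin n → FracSeries ℂ} (h : PuiseuxRoots g σ n ρ) {G : ℂ × ℂ → ℂ}
    (hG : IsComplexification g G) (K : ℝ) :
    ∃ C ε : ℝ, 0 < ε ∧ ∀ᶠ y : ℝ in 𝓝[>] 0, ∀ X x₀ w : ℂ, ‖X‖ ≤ K * y → ‖x₀‖ < ε → ‖w‖ < ε →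
      G (x₀, w) = 0 →
      ∃ i, ‖X - (ρ i).eval y‖ ≤ C * max ‖X - x₀‖ ‖((σ : ℤ) : ℂ) * (y : ℂ) - w‖ := by
  obtain ⟨G', d, r, U, hG', hr, hO, hρ⟩ := h.exists_factors
  have hd := hr.pos
  choose C₁ ε₁ hε₁ hLip using fun i =>
    (hr.analytic i).exists_lipschitz_pow hd (hO i) (K := 2 ^ (d - 1))
  obtain ⟨C, hC⟩ := Finite.exists_le C₁
  obtain ⟨η, hη, hηle⟩ : ∃ η > 0, ∀ i, η ≤ ε₁ i := by
    obtain ⟨M, hM⟩ := Finite.exists_le fun i => (ε₁ i)⁻¹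
    refine ⟨(max M 1)⁻¹, by positivity, fun i => ?_⟩
    rw [inv_le_comm₀ (by positivity) (hε₁ i)]
    exact (hM i).trans (le_max_left _ _)
  have hbd : ∀ i, ∃ B : ℝ, ∀ᶠ y : ℝ in 𝓝[>] 0, ‖(ρ i).eval y‖ ≤ B * ‖y‖ := fun i =>
    (FracSeries.isBigO_of_coeff (h.coeff_eq_zero i)).bound
  choose B₁ hB₁ using hbd
  obtain ⟨B, hB⟩ := Finite.exists_le B₁
  have hEq : ∀ᶠ v in 𝓝 (0 : ℂ × ℂ), G v = G' v := hG.eventually_eq hG'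
  obtain ⟨ε₂, hε₂, hGG⟩ := eventually_prodMk_zero hEq
  obtain ⟨ε₃, hε₃, hfac⟩ := eventually_prodMk_zero
    (hr.eventually_eq.and (hr.unit_analytic.continuousAt.eventually_ne hr.unit_ne_zero))
  refine ⟨max (2 * (K + B)) (1 + |C|), min ε₂ ε₃, lt_min hε₂ hε₃, ?_⟩
  have hroot : ∀ᶠ y : ℝ in 𝓝[>] 0, ‖((y ^ (1 / d : ℝ) : ℝ) : ℂ)‖ < min η ε₃ / 2 := by
    simpa using (FracSeries.tendsto_root' (𝕜 := ℂ) hr.pos).eventually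
      (Metric.ball_mem_nhds 0 (half_pos (lt_min hη hε₃)))
  filter_upwards [hroot, eventually_all.2 hρ, eventually_all.2 hB₁, self_mem_nhdsWithin]
    with y ht h1 h2 (hy : 0 < y) X x₀ w hX hx₀ hw hzero
  set D := max ‖X - x₀‖ ‖((σ : ℤ) : ℂ) * (y : ℂ) - w‖ with hD
  have hD0 : 0 ≤ D := (norm_nonneg _).trans (le_max_left _ _)
  -- far from the point, every root will do, since both `X` and the roots are `O(y)`; near it, the
  -- right root is found by extracting a `d`-th root of `σ w` close to that of `y`
  rcases le_or_gt (y / 2) D with hle | hlt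
  · refine ⟨⟨0, hn⟩, ?_⟩
    have h3 : ‖(ρ ⟨0, hn⟩).eval y‖ ≤ B * y := by
      refine (h2 _).trans ?_
      rw [Real.norm_of_nonneg hy.le]
      gcongr
      exact hB _
    have h4 : ‖X - (ρ ⟨0, hn⟩).eval y‖ ≤ (K + B) * y := by
      refine (norm_sub_le _ _).trans ?_
      linarith
    have h5 : 0 ≤ K + B := by
      by_contra hneg
      have := (norm_nonneg _).trans h4
      nlinarith
    calc _ ≤ (K + B) * y := h4
      _ ≤ (K + B) * (2 * D) := by gcongr; linarith
      _ = 2 * (K + B) * D := by ring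
      _ ≤ _ := by gcongr; exact le_max_left _ _
  · set t := y ^ (1 / d : ℝ) with htdef
    have ht0 : 0 < t := Real.rpow_pos_of_pos hy _
    have htd : (t : ℂ) ^ d = (y : ℂ) := by rw [← Complex.ofReal_pow, htdef, root_pow hd hy]
    rw [Complex.norm_real, Real.norm_of_nonneg ht0.le] at ht
    have hσ : ((σ : ℤ) : ℂ) * ((σ : ℤ) : ℂ) = 1 := by
      rcases Int.units_eq_one_or σ with rfl | rfl <;> simp
    set z := ((σ : ℤ) : ℂ) * w / y with hz
    have hy0 : (y : ℂ) ≠ 0 := by exact_mod_cast hy.ne'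
    have hzy : ((σ : ℤ) : ℂ) * w = y * z := by rw [hz]; field_simp
    have hdist : ‖(y : ℂ) - y * z‖ ≤ D := by
      have : ((σ : ℤ) : ℂ) * (y : ℂ) - w = ((σ : ℤ) : ℂ) * (y - ((σ : ℤ) : ℂ) * w) := by
        rw [mul_sub, ← mul_assoc, hσ, one_mul]
      rw [← hzy, ← norm_sign_mul (𝕜 := ℂ) σ, ← this]
      exact le_max_right _ _
    have hz1 : y * ‖z - 1‖ ≤ D := by
      have : ‖(y : ℂ) - y * z‖ = y * ‖z - 1‖ := by
        rw [show (y : ℂ) - y * z = -(y * (z - 1)) by ring, norm_neg, norm_mul, Complex.norm_real,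
          Real.norm_of_nonneg hy.le]
      rwa [← this]
    have hz2 : ‖z - 1‖ < 1 / 2 := by
      by_contra hge
      rw [not_lt] at hge
      nlinarith
    have hzre : 0 < z.re := by
      have := (Complex.abs_re_le_norm (z - 1)).trans_lt hz2
      rw [Complex.sub_re, Complex.one_re, abs_lt] at this
      linarith
    set ω := z ^ (1 / d : ℂ) with hω
    have hω1 : ‖ω - 1‖ ≤ ‖z - 1‖ := norm_cpow_sub_one_le hzre hd
    have hωd : ω ^ d = z := by
      rw [hω, one_div]
      exact Complex.cpow_nat_inv_pow z hd.ne'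
    have hω2 : ‖ω‖ ≤ 2 := by
      have : ‖ω‖ ≤ ‖ω - 1‖ + ‖(1 : ℂ)‖ := by simpa using norm_add_le (ω - 1) 1
      rw [norm_one] at this
      linarith
    -- the `d`-th root of `σ w` close to `t`
    set s' := (t : ℂ) * ω with hs'
    have hs'd : s' ^ d = ((σ : ℤ) : ℂ) * w := by rw [hs', mul_pow, htd, hωd, hzy]
    have hs'norm : ‖s'‖ ≤ t * 2 := by
      rw [hs', norm_mul, Complex.norm_real, Real.norm_of_nonneg ht0.le]
      gcongr
    have hs'lt : ‖s'‖ < min η ε₃ := by linarith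
    have hw3 := hfac x₀ s' (hx₀.trans_le (min_le_right _ _)) (hs'lt.trans_le (min_le_right _ _))
    have hG0 : signTwist σ G' (x₀, s' ^ d) = 0 := by
      have : signTwist σ G' (x₀, s' ^ d) = G' (x₀, w) := by
        simp only [signTwist, hs'd, ← mul_assoc, hσ, one_mul]
      rw [this, ← hGG x₀ w (hx₀.trans_le (min_le_left _ _)) (hw.trans_le (min_le_left _ _)), hzero]
    rw [show signTwist σ G' (x₀, s' ^ d) = _ from hw3.1] at hG0
    obtain ⟨i, -, hi⟩ := Finset.prod_eq_zero_iff.1 ((mul_eq_zero.1 hG0).resolve_left hw3.2)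
    have hi' : x₀ = r i s' := sub_eq_zero.1 hi
    refine ⟨i, ?_⟩
    have htlt : ‖(t : ℂ)‖ < ε₁ i := by
      rw [Complex.norm_real, Real.norm_of_nonneg ht0.le]
      have := min_le_left η ε₃
      have := hηle i
      linarith
    have hs'lt' : ‖s'‖ < ε₁ i := hs'lt.trans_le ((min_le_left _ _).trans (hηle i))
    have hdiff : ‖(t : ℂ) ^ d - s' ^ d‖ = y * ‖z - 1‖ := by
      rw [htd, hs'd, hzy, show (y : ℂ) - y * z = -(y * (z - 1)) by ring, norm_neg, norm_mul,
        Complex.norm_real, Real.norm_of_nonneg hy.le]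
    have hcond : ‖s'‖ ^ (d - 1) * ‖(t : ℂ) - s'‖ ≤ 2 ^ (d - 1) * ‖(t : ℂ) ^ d - s' ^ d‖ := by
      rw [hdiff]
      have h5 : ‖(t : ℂ) - s'‖ = t * ‖ω - 1‖ := by
        rw [hs', show (t : ℂ) - t * ω = -(t * (ω - 1)) by ring, norm_neg, norm_mul,
          Complex.norm_real, Real.norm_of_nonneg ht0.le]
      have h6 : t ^ (d - 1) * t = y := by
        rw [← pow_succ, Nat.sub_add_cancel hd, htdef, root_pow hd hy]
      calc _ ≤ (t * 2) ^ (d - 1) * (t * ‖z - 1‖) := by rw [h5]; gcongr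
        _ = 2 ^ (d - 1) * ((t ^ (d - 1) * t) * ‖z - 1‖) := by rw [mul_pow]; ring
        _ = _ := by rw [h6]
    have hL := hLip i t s' htlt hs'lt' hcond
    rw [h1 i]
    calc ‖X - r i t‖ ≤ ‖X - x₀‖ + ‖x₀ - r i t‖ := norm_sub_le_norm_sub_add_norm_sub _ _ _
      _ ≤ D + |C| * D := by
          gcongr
          · exact le_max_left _ _
          · rw [hi', norm_sub_rev]
            refine hL.trans ?_
            rw [hdiff]
            calc _ ≤ |C| * (y * ‖z - 1‖) := by gcongr; exact (hC i).trans (le_abs_self C)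
              _ ≤ _ := by gcongr
      _ = (1 + |C|) * D := by ring
      _ ≤ _ := by gcongr; exact le_max_right _ _

/-! ### Arcs as graphs of fractional power series -/

namespace FracSeries

variable {𝕜 : Type} [RCLike 𝕜]

/-- A fractional power series without terms of exponent less than `1` is `A(y^{1/d})` with `A`
analytic and `A(s) = O(sᵈ)`. -/
lemma exists_germ {α : FracSeries 𝕜} (h : ∀ e < 1, α.coeff e = 0) :
    ∃ (d : ℕ) (A : 𝕜 → 𝕜), 0 < d ∧ AnalyticAt 𝕜 A 0 ∧ A 0 = 0 ∧ (A =O[𝓝 0] fun s => s ^ d) ∧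
      ∀ y : ℝ, 0 < y → α.eval y = A ((y ^ (1 / d : ℝ) : ℝ) : 𝕜) := by
  obtain ⟨d, hd⟩ := α.exists_hasDen
  have hd0 : (0 : ℝ) < d := by exact_mod_cast hd.1
  have hc : ∀ n < d, α.coeff ((n : ℝ) / d) = 0 := fun n hn =>
    h _ ((div_lt_one hd0).2 (by exact_mod_cast hn))
  have hpow := hd.2.2.eventually_eq_pow_mul hc
  refine ⟨d, scalarSum fun n : ℕ => α.coeff ((n : ℝ) / d), hd.1, hd.2.2.analyticAt, ?_, ?_,
    fun y hy => hd.eval_eq hy⟩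
  · rw [hpow.self_of_nhds, zero_pow hd.1.ne', zero_mul]
  · refine EventuallyEq.trans_isBigO hpow ?_
    simpa using (isBigO_refl (fun s : 𝕜 => s ^ d) (𝓝 0)).mul
      ((hd.2.2.shift d).analyticAt.continuousAt.isBigO_one 𝕜)

/-- The graph `x = α(|y|)`, `σ y ≥ 0`, as an arc. -/
lemma exists_arc {α : FracSeries 𝕜} (h : ∀ e < 1, α.coeff e = 0) (σ : ℤˣ) :
    ∃ (l : Arc 𝕜) (d : ℕ), 0 < d ∧ (∀ s : ℝ, l.toFun s 1 = ((σ : ℤ) : 𝕜) * ((s ^ d : ℝ) : 𝕜)) ∧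
      ∀ s : ℝ, 0 < s → l.toFun s 0 = α.eval (s ^ d) := by
  obtain ⟨d, A, hd, hA, hA0, -, heval⟩ := exists_germ h
  have hcast : AnalyticAt ℝ (fun s : ℝ => (s : 𝕜)) 0 := (RCLike.ofRealCLM (K := 𝕜)).analyticAt 0
  have hreal : ∀ B : 𝕜 → 𝕜, AnalyticAt 𝕜 B 0 → AnalyticAt ℝ (fun s : ℝ => B (s : 𝕜)) 0 :=
    fun B hB => AnalyticAt.fun_comp (g := B) (f := fun s : ℝ => (s : 𝕜)) (x := (0 : ℝ))
      (by simpa using hB.restrictScalars (𝕜 := ℝ)) hcast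
  have hA' := hreal A hA
  have hpow : AnalyticAt ℝ (fun s : ℝ => ((σ : ℤ) : 𝕜) * ((s ^ d : ℝ) : 𝕜)) 0 := by
    simpa using hreal (fun s => ((σ : ℤ) : 𝕜) * s ^ d) (by fun_prop)
  have hpi : AnalyticAt ℝ (fun s : ℝ => (![A (s : 𝕜), ((σ : ℤ) : 𝕜) * ((s ^ d : ℝ) : 𝕜)] :
      Fin 2 → 𝕜)) 0 := by
    refine AnalyticAt.pi fun i => ?_
    fin_cases i
    · simpa using hA'
    · simpa using hpow
  let l : Arc 𝕜 :=
    { toFun := fun s => !₂[A (s : 𝕜), ((σ : ℤ) : 𝕜) * ((s ^ d : ℝ) : 𝕜)]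
      analytic := (((EuclideanSpace.equiv (Fin 2) 𝕜).symm.toContinuousLinearMap.restrictScalars
        ℝ).analyticAt _).comp hpi
      map_zero := by
        ext i
        fin_cases i <;> simp [hA0, hd.ne']
      ne_zero := fun hzero => by
        obtain ⟨s, hs, hs0⟩ := ((hzero.filter_mono (nhdsWithin_mono 0 Set.Ioi_subset_Ici_self)).and
          (self_mem_nhdsWithin (a := (0 : ℝ)) (s := Set.Ioi 0))).exists
        have h1 := congrArg (fun v : EuclideanSpace 𝕜 (Fin 2) => ‖v 1‖) hs
        simp [norm_sign, hd.ne', (ne_of_gt hs0 : s ≠ 0)] at h1 }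
  refine ⟨l, d, hd, fun s => by simp [l], fun s hs => ?_⟩
  rw [heval _ (pow_pos hs d), one_div, Real.pow_rpow_inv_natCast hs.le hd.ne']
  simp [l]

lemma eval_zero (α : FracSeries 𝕜) : α.eval 0 = α.coeff 0 := by
  rw [FracSeries.eval, tsum_eq_single 0 fun e he => by rw [Real.zero_rpow he, zero_smul]]
  simp

/-- A real fractional power series with no terms of exponent less than `1` is Lipschitz. -/
lemma exists_lipschitz {α : FracSeries ℝ} (h : ∀ e < 1, α.coeff e = 0) :
    ∃ C ε : ℝ, 0 < ε ∧ ∀ y y' : ℝ, 0 ≤ y → y < ε → 0 ≤ y' → y' < ε →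
      |α.eval y - α.eval y'| ≤ C * |y - y'| := by
  obtain ⟨d, A, hd, hA, hA0, hO, heval⟩ := exists_germ h
  obtain ⟨C, ε, hε, hLip⟩ := hA.exists_lipschitz_pow hd hO (K := 1)
  have heval' : ∀ y : ℝ, 0 ≤ y → α.eval y = A (y ^ (1 / d : ℝ)) := fun y hy => by
    rcases hy.eq_or_lt with rfl | hy
    · have : (1 / d : ℝ) ≠ 0 := by
        have : (d : ℝ) ≠ 0 := by exact_mod_cast hd.ne'
        positivity
      rw [eval_zero, h 0 one_pos, Real.zero_rpow this, hA0]
    · exact heval y hy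
  have hpow : ∀ y : ℝ, 0 ≤ y → (y ^ (1 / d : ℝ)) ^ d = y := fun y hy => by
    rw [one_div, Real.rpow_inv_natCast_pow hy hd.ne']
  have hlt : ∀ y : ℝ, 0 ≤ y → y < ε ^ d → ‖y ^ (1 / d : ℝ)‖ < ε := fun y hy hyε => by
    rw [Real.norm_of_nonneg (Real.rpow_nonneg hy _)]
    refine lt_of_pow_lt_pow_left₀ d hε.le ?_
    rwa [hpow y hy]
  refine ⟨C, ε ^ d, pow_pos hε d, fun y y' hy hyε hy' hyε' => ?_⟩
  rw [heval' y hy, heval' y' hy']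
  have := hLip _ _ (hlt y hy hyε) (hlt y' hy' hyε') ?_
  · rwa [hpow y hy, hpow y' hy', Real.norm_eq_abs, Real.norm_eq_abs] at this
  set s := y ^ (1 / d : ℝ) with hs
  set s' := y' ^ (1 / d : ℝ) with hs'
  have hs0 : 0 ≤ s := Real.rpow_nonneg hy _
  have hs0' : 0 ≤ s' := Real.rpow_nonneg hy' _
  rw [one_mul, ← geom_sum₂_mul s s' d, norm_mul]
  gcongr
  rw [Real.norm_of_nonneg hs0', Real.norm_of_nonneg (by positivity)]
  have := Finset.single_le_sum (f := fun i => s ^ i * s' ^ (d - 1 - i))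
    (fun i _ => by positivity) (Finset.mem_range.2 hd)
  simpa using this

end FracSeries

lemma Arc.analyticAt_apply {𝕜 : Type} [RCLike 𝕜] (l : Arc 𝕜) (i : Fin 2) :
    AnalyticAt ℝ (fun s => l.toFun s i) 0 :=
  (((EuclideanSpace.proj (𝕜 := 𝕜) i).restrictScalars ℝ).analyticAt _).comp l.analytic

/-- The value of `|y|` along an arc in `σ y > 0`. -/
def Arc.absY (σ : ℤˣ) (l : Arc ℝ) (s : ℝ) : ℝ := ((σ : ℤ) : ℝ) * l.toFun s 1

lemma units_mul_self (σ : ℤˣ) : ((σ : ℤ) : ℝ) * ((σ : ℤ) : ℝ) = 1 := by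
  rcases Int.units_eq_one_or σ with rfl | rfl <;> simp

lemma Arc.sign_mul_absY (σ : ℤˣ) (l : Arc ℝ) (s : ℝ) :
    l.toFun s 1 = ((σ : ℤ) : ℝ) * l.absY σ s := by
  rw [Arc.absY, ← mul_assoc, units_mul_self, one_mul]

lemma Arc.analyticAt_absY (σ : ℤˣ) (l : Arc ℝ) : AnalyticAt ℝ (l.absY σ) 0 :=
  analyticAt_const.mul (l.analyticAt_apply 1)

lemma Arc.absY_zero (σ : ℤˣ) (l : Arc ℝ) : l.absY σ 0 = 0 := by simp [Arc.absY, l.map_zero]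

lemma tendsto_absY {σ : ℤˣ} {l : Arc ℝ} (hl : l ∈ halfArcs σ) :
    Tendsto (l.absY σ) (𝓝[>] 0) (𝓝[>] 0) := by
  refine tendsto_nhdsWithin_iff.2 ⟨?_, hl.1⟩
  have := (l.analyticAt_absY σ).continuousAt.tendsto
  rw [l.absY_zero] at this
  exact this.mono_left nhdsWithin_le_nhds

/-- Near `0`, `Y(s) = φ(s)ᵏ` for an analytic change of parameter `φ`, whose inverse is `ψ`. -/
lemma AnalyticAt.exists_root_param {Y : ℝ → ℝ} (hY : AnalyticAt ℝ Y 0) (hY0 : Y 0 = 0)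
    (hpos : ∀ᶠ s in 𝓝[>] (0 : ℝ), 0 < Y s) :
    ∃ (k : ℕ) (ψ : ℝ → ℝ), 0 < k ∧ AnalyticAt ℝ ψ 0 ∧
      ∀ᶠ s in 𝓝[>] (0 : ℝ), ψ (Y s ^ (1 / k : ℝ)) = s := by
  have hne : analyticOrderAt Y 0 ≠ ⊤ := fun htop => by
    obtain ⟨s, h1, h2⟩ := (((analyticOrderAt_eq_top.1 htop).filter_mono
      nhdsWithin_le_nhds).and hpos).exists
    exact h2.ne' h1
  obtain ⟨k, hk⟩ := ENat.ne_top_iff_exists.1 hne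
  obtain ⟨g, hg, hg0, hgeq⟩ := hY.analyticOrderAt_eq_natCast.1 hk.symm
  simp only [sub_zero, smul_eq_mul] at hgeq
  have hk0 : 0 < k := by
    rw [Nat.pos_iff_ne_zero]
    rintro rfl
    have := hgeq.self_of_nhds
    rw [hY0, pow_zero, one_mul] at this
    exact hg0 this.symm
  have hg0' : 0 < g 0 := by
    refine lt_of_le_of_ne ?_ hg0.symm
    refine ge_of_tendsto
      (hg.continuousAt.tendsto.mono_left (nhdsWithin_le_nhds (s := Set.Ioi 0))) ?_
    filter_upwards [hpos, hgeq.filter_mono nhdsWithin_le_nhds, self_mem_nhdsWithin]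
      with s h1 h2 (h3 : 0 < s)
    rw [h2] at h1
    exact (pos_of_mul_pos_right h1 (pow_pos h3 k).le).le
  let φ : ℝ → ℝ := fun s => s * Real.exp (Real.log (g s) * (1 / k))
  have hexp : AnalyticAt ℝ (fun s => Real.exp (Real.log (g s) * (1 / k))) 0 :=
    ((hg.log hg0').mul analyticAt_const).rexp'
  have hφ : AnalyticAt ℝ φ 0 := analyticAt_id.mul hexp
  have hφ' : deriv φ 0 ≠ 0 := by
    have : HasDerivAt φ (1 * Real.exp (Real.log (g 0) * (1 / k)) + 0 * _) 0 :=
      (hasDerivAt_id 0).mul hexp.differentiableAt.hasDerivAt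
    rw [this.deriv]
    simp [Real.exp_ne_zero]
  refine ⟨k, hφ.hasStrictDerivAt.localInverse _ _ _ hφ', hk0, ?_, ?_⟩
  · have := hφ.analyticAt_localInverse hφ'
    rwa [show φ 0 = 0 by simp [φ]] at this
  · have hinv : ∀ᶠ s in 𝓝 (0 : ℝ), hφ.hasStrictDerivAt.localInverse _ _ _ hφ' (φ s) = s :=
      HasStrictDerivAt.eventually_left_inverse ..
    filter_upwards [hinv.filter_mono nhdsWithin_le_nhds, hgeq.filter_mono nhdsWithin_le_nhds,
      (hg.continuousAt.eventually (lt_mem_nhds hg0')).filter_mono nhdsWithin_le_nhds,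
      self_mem_nhdsWithin] with s h1 h2 h3 (h4 : 0 < s)
    have : Y s ^ (1 / k : ℝ) = φ s := by
      rw [h2, Real.mul_rpow (pow_pos h4 k).le h3.le, one_div,
        Real.pow_rpow_inv_natCast h4.le hk0.ne',
        Real.rpow_def_of_pos h3, ← one_div]
    rw [this, h1]

/-- An arc in `σ y > 0` not tangent to the `x`-axis has an equation `x = α(|y|)`: `|y|` is the
`k`-th power of an analytic parameter, by which the arc is reparametrized. -/
lemma exists_isArcSeries {σ : ℤˣ} {l : Arc ℝ} (hl : l ∈ halfArcs σ) : ∃ α, IsArcSeries σ l α := by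
  obtain ⟨k, ψ, hk, hψ, hψs⟩ := (l.analyticAt_absY σ).exists_root_param (l.absY_zero σ) hl.1
  have htend := (FracSeries.tendsto_root hk).comp (tendsto_absY hl)
  have hψ0 : ψ 0 = 0 := by
    refine tendsto_nhds_unique (hψ.continuousAt.tendsto.comp
      (htend.mono_right nhdsWithin_le_nhds)) ?_
    exact ((tendsto_id (α := ℝ)).mono_left nhdsWithin_le_nhds).congr' (hψs.mono fun s hs => hs.symm)
  have hA : AnalyticAt ℝ (fun t => l.toFun (ψ t) 0) 0 :=
    AnalyticAt.fun_comp (g := fun s => l.toFun s 0) (f := ψ) (x := 0)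
      (by rw [hψ0]; exact l.analyticAt_apply 0) hψ
  obtain ⟨α, -, hα⟩ := FracSeries.exists_of_analyticAt hA hk
  refine ⟨α, ?_⟩
  filter_upwards [hψs, (tendsto_absY hl).eventually hα] with s h1 h2
  change l.toFun s 0 = α.eval (l.absY σ s)
  rw [h2]
  change _ = l.toFun (ψ (l.absY σ s ^ (1 / k : ℝ))) 0
  rw [h1]

lemma arcSeries_spec {σ : ℤˣ} {l : Arc ℝ} (hl : l ∈ halfArcs σ) :
    ∀ᶠ s in 𝓝[>] (0 : ℝ), l.toFun s 0 = (arcSeries σ l).eval (l.absY σ s) :=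
  Classical.epsilon_spec (exists_isArcSeries hl)

/-- Not being tangent to the `x`-axis means `x = O(|y|)`, so the equation of the arc has no terms of
exponent less than `1`. -/
lemma arcSeries_coeff {σ : ℤˣ} {l : Arc ℝ} (hl : l ∈ halfArcs σ) {e : ℝ} (he : e < 1) :
    (arcSeries σ l).coeff e = 0 := by
  refine FracSeries.ofReal_le_ord.1 ((FracSeries.isBigO_eval_iff (tendsto_absY hl) _).1 ?_) e he
  have h1 : (fun s => l.toFun s 0) =O[𝓝[>] 0] fun s => l.absY σ s ^ (1 : ℝ) := by
    refine hl.2.trans (IsBigO.of_bound 1 (Eventually.of_forall fun s => ?_))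
    rw [l.sign_mul_absY σ, norm_sign_mul (𝕜 := ℝ), Real.rpow_one, one_mul]
  exact h1.congr' (arcSeries_spec hl) EventuallyEq.rfl

lemma IsArcSeries.arcSeries_eq {σ : ℤˣ} {l : Arc ℝ} (hl : l ∈ halfArcs σ) {α : FracSeries ℝ}
    (h : IsArcSeries σ l α) : arcSeries σ l = α := by
  by_contra hne
  obtain ⟨s, h1, h2, h3⟩ := ((arcSeries_spec hl).and (h.and
    ((tendsto_absY hl).eventually (FracSeries.eventually_eval_ne hne)))).exists
  exact h3 (h1.symm.trans h2)

lemma graphPath_arcSeries {σ : ℤˣ} {l : Arc ℝ} (hl : l ∈ halfArcs σ) :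
    GraphPath σ (arcSeries σ l) l.toFun (l.absY σ) :=
  ⟨tendsto_absY hl, arcSeries_spec hl, Eventually.of_forall fun s => l.sign_mul_absY σ s,
    fun _ he => arcSeries_coeff hl he⟩

lemma graphPath_complexPath {σ : ℤˣ} {l : Arc ℝ} (hl : l ∈ halfArcs σ) :
    GraphPath σ (arcSeries σ l).ofReal (complexPath l) (l.absY σ) := by
  refine ⟨tendsto_absY hl, ?_, Eventually.of_forall fun s => ?_, fun e he => ?_⟩
  · filter_upwards [arcSeries_spec hl] with s hs
    simp [complexPath, hs, FracSeries.eval_ofReal]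
  · simp [complexPath, l.sign_mul_absY σ s]
  · rw [FracSeries.coeff_ofReal, arcSeries_coeff hl he, Complex.ofReal_zero]

/-- The arc with a given equation `x = α(|y|)`. -/
lemma exists_arc_arcSeries_eq {α : FracSeries ℝ} (h : ∀ e < 1, α.coeff e = 0) (σ : ℤˣ) :
    ∃ l ∈ halfArcs σ, arcSeries σ l = α := by
  obtain ⟨l, d, hd, h1, h0⟩ := FracSeries.exists_arc h σ
  have habs : ∀ s, l.absY σ s = s ^ d := fun s => by
    rw [Arc.absY, h1, ← mul_assoc, units_mul_self, one_mul]
    rfl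
  have ht : Tendsto (fun s : ℝ => s ^ d) (𝓝[>] 0) (𝓝[>] 0) := by
    refine tendsto_nhdsWithin_iff.2 ⟨?_, ?_⟩
    · exact (Continuous.tendsto' (by fun_prop) 0 0 (by simp [hd.ne'])).mono_left nhdsWithin_le_nhds
    · filter_upwards [self_mem_nhdsWithin] with s (hs : 0 < s) using pow_pos hs d
  have hl : l ∈ halfArcs σ := by
    constructor
    · filter_upwards [self_mem_nhdsWithin] with s (hs : 0 < s)
      exact (pow_pos hs d).trans_eq (habs s).symm
    · have h2 := (FracSeries.isBigO_of_coeff h).comp_tendsto ht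
      refine (h2.congr' ?_ EventuallyEq.rfl).trans (IsBigO.of_bound 1 (Eventually.of_forall
        fun s => ?_))
      · filter_upwards [self_mem_nhdsWithin] with s (hs : 0 < s) using (h0 s hs).symm
      · rw [l.sign_mul_absY σ, norm_sign_mul (𝕜 := ℝ), habs, one_mul]
        rfl
  refine ⟨l, hl, IsArcSeries.arcSeries_eq hl ?_⟩
  filter_upwards [self_mem_nhdsWithin] with s (hs : 0 < s)
  change _ = α.eval (l.absY σ s)
  rw [habs, h0 s hs]

/-- An arc passes over every small `|y|`. -/
lemma eventually_exists_mem_Ico {σ : ℤˣ} {l : Arc ℝ} (hl : l ∈ halfArcs σ) {ε : ℝ} (hε : 0 < ε) :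
    ∀ᶠ y in 𝓝[>] (0 : ℝ), ∃ t ∈ Set.Ico 0 ε,
      l.toFun t 0 = (arcSeries σ l).eval y ∧ l.toFun t 1 = ((σ : ℤ) : ℝ) * y := by
  obtain ⟨δ₁, hδ₁, hcont⟩ := Metric.eventually_nhds_iff.1
    (l.analyticAt_absY σ).eventually_continuousAt
  obtain ⟨δ₂, hδ₂, hser⟩ := mem_nhdsGT_iff_exists_Ioo_subset.1
    ((arcSeries_spec hl).and (show ∀ᶠ s in 𝓝[>] (0 : ℝ), 0 < l.absY σ s from hl.1))
  replace hδ₂ : 0 < δ₂ := hδ₂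
  set b := min ε (min δ₁ δ₂) / 2 with hb
  have hmin : 0 < min ε (min δ₁ δ₂) := lt_min hε (lt_min hδ₁ hδ₂)
  have hb0 : 0 < b := half_pos hmin
  have hbm : b < min ε (min δ₁ δ₂) := half_lt_self hmin
  have hbε : b < ε := hbm.trans_le (min_le_left _ _)
  have hb1 : b < δ₁ := hbm.trans_le ((min_le_right _ _).trans (min_le_left _ _))
  have hb2 : b < δ₂ := hbm.trans_le ((min_le_right _ _).trans (min_le_right _ _))
  have hc : ContinuousOn (l.absY σ) (Set.Icc 0 b) := fun s hs => by
    refine (hcont ?_).continuousWithinAt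
    rw [dist_zero_right, Real.norm_of_nonneg hs.1]
    exact hs.2.trans_lt hb1
  have hpos : 0 < l.absY σ b := (hser ⟨hb0, hb2⟩).2
  filter_upwards [Ioo_mem_nhdsGT hpos] with y hy
  obtain ⟨t, ht, hty⟩ := intermediate_value_Icc hb0.le hc
    (show y ∈ Set.Icc (l.absY σ 0) (l.absY σ b) by rw [l.absY_zero]; exact ⟨hy.1.le, hy.2.le⟩)
  have ht0 : 0 < t := by
    refine ht.1.lt_of_ne ?_
    rintro rfl
    rw [l.absY_zero] at hty
    exact hy.1.ne hty
  refine ⟨t, ⟨ht.1, ht.2.trans_lt hbε⟩, ?_, by rw [l.sign_mul_absY σ, hty]⟩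
  rw [(hser ⟨ht0, ht.2.trans_lt hb2⟩).1, hty]

/-! ### The ultrametric on fractional power series -/

namespace FracSeries

variable {𝕜 : Type} [RCLike 𝕜]

lemma ord_sub_comm (α β : FracSeries 𝕜) : (α - β).ord = (β - α).ord := by
  have : ∀ e, (α - β).coeff e ≠ 0 ↔ (β - α).coeff e ≠ 0 := fun e => by
    rw [coeff_sub, coeff_sub, sub_ne_zero, sub_ne_zero, ne_comm]
  simp only [ord, this]

/-- The ultrametric inequality for the order of coincidence. -/
lemma min_le_ord_sub (α β γ : FracSeries 𝕜) :
    min (α - β).ord (β - γ).ord ≤ (α - γ).ord := by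
  refine le_iInf₂ fun e he => ?_
  by_cases h : (α - β).coeff e = 0
  · have h' : (β - γ).coeff e ≠ 0 := fun h' => he (by
      simp only [coeff_sub] at h h' ⊢
      linear_combination h + h')
    exact (min_le_right _ _).trans (iInf₂_le e h')
  · exact (min_le_left _ _).trans (iInf₂_le e h)

lemma ord_sub_eq_top {α β : FracSeries 𝕜} : (α - β).ord = ⊤ ↔ α = β := by
  rw [ord_eq_top]
  refine ⟨fun h => ?_, fun h e => by simp [h]⟩
  ext e
  simpa [sub_eq_zero] using h e

end FracSeries

/-! ### Contact orders and heights of arcs in a half plane -/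

lemma Arc.tendsto_apply_zero {𝕜 : Type} [RCLike 𝕜] (l : Arc 𝕜) (i : Fin 2) :
    Tendsto (fun s => l.toFun s i) (𝓝 0) (𝓝 0) := by
  have := (l.analyticAt_apply i).continuousAt.tendsto
  rwa [l.map_zero] at this

lemma eventually_forall_mem_Ico {p : ℝ → Prop} (h : ∀ᶠ s in 𝓝[≥] (0 : ℝ), p s) :
    ∀ᶠ ε in 𝓝[>] (0 : ℝ), ∀ t ∈ Set.Ico 0 ε, p t := by
  obtain ⟨δ, hδ, hsub⟩ := mem_nhdsGE_iff_exists_Ico_subset.1 h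
  filter_upwards [Ioo_mem_nhdsGT hδ] with ε hε t ht
  exact hsub ⟨ht.1, ht.2.trans hε.2⟩

/-- The contact order of two arcs is the order of the difference of their equations. For the upper
bound, the Lipschitz estimate compares the horizontal distance of the arcs at height `|y|` with the
distance to an arbitrary point of the second arc. -/
lemma contactOrder_eq_ord {σ : ℤˣ} {l m : Arc ℝ} (hl : l ∈ halfArcs σ) (hm : m ∈ halfArcs σ) :
    contactOrder l.toFun m.toFun = (arcSeries σ l - arcSeries σ m).ord := by
  have hg := graphPath_arcSeries hl
  refine le_antisymm ?_ (hg.le_contactOrder fun ε hε =>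
    (tendsto_absY hl).eventually (eventually_exists_mem_Ico hm hε))
  obtain ⟨C, δ, hδ, hLip⟩ := FracSeries.exists_lipschitz
    (α := arcSeries σ m) fun e he => arcSeries_coeff hm he
  refine (hg.contactOrder_le (n := 1) (ρ := fun _ => arcSeries σ m) (1 + |C|) ?_).trans
    (iSup_le fun _ => le_rfl)
  have h1 : ∀ᶠ t in 𝓝[≥] (0 : ℝ), 0 ≤ m.absY σ t ∧ m.absY σ t < δ ∧
      m.toFun t 0 = (arcSeries σ m).eval (m.absY σ t) := by
    have hlt : ∀ᶠ t in 𝓝[>] (0 : ℝ), m.absY σ t < δ :=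
      ((tendsto_absY hm).mono_right nhdsWithin_le_nhds).eventually (gt_mem_nhds hδ)
    have hGT := hm.1.and (hlt.and (arcSeries_spec hm))
    rw [← Set.Ioi_insert, nhdsWithin_insert, eventually_sup]
    refine ⟨?_, hGT.mono fun t ht => ⟨ht.1.le, ht.2⟩⟩
    rw [eventually_pure, m.absY_zero, FracSeries.eval_zero, arcSeries_coeff hm one_pos, m.map_zero]
    exact ⟨le_rfl, hδ, rfl⟩
  filter_upwards [eventually_forall_mem_Ico h1] with ε hε
  have hlt : ∀ᶠ s in 𝓝[>] (0 : ℝ), l.absY σ s < δ :=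
    ((tendsto_absY hl).mono_right nhdsWithin_le_nhds).eventually (gt_mem_nhds hδ)
  filter_upwards [arcSeries_spec hl, hl.1, hlt] with s hs hs0 hsδ t ht
  refine ⟨0, ?_⟩
  obtain ⟨h0, hlt, hser⟩ := hε t ht
  have hx : |l.toFun s 0 - m.toFun t 0| ≤ dist (l.toFun s) (m.toFun t) := by
    rw [dist_eq_norm]
    exact PiLp.norm_apply_le (l.toFun s - m.toFun t) 0
  have hy : |l.absY σ s - m.absY σ t| ≤ dist (l.toFun s) (m.toFun t) := by
    rw [dist_eq_norm]
    refine le_trans ?_ (PiLp.norm_apply_le (l.toFun s - m.toFun t) 1)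
    rw [Arc.absY, Arc.absY, ← mul_sub]
    exact (norm_sign_mul (𝕜 := ℝ) σ _).le
  have hL := hLip (m.absY σ t) (l.absY σ s) h0 hlt hs0.le hsδ
  rw [abs_sub_comm (m.absY σ t)] at hL
  rw [← hs, Real.norm_eq_abs]
  calc _ ≤ |l.toFun s 0 - m.toFun t 0| + |m.toFun t 0 - (arcSeries σ m).eval (l.absY σ s)| :=
        abs_sub_le _ _ _
    _ ≤ dist (l.toFun s) (m.toFun t) + |C| * dist (l.toFun s) (m.toFun t) := by
        refine add_le_add hx ?_
        rw [hser]
        calc _ ≤ C * |l.absY σ s - m.absY σ t| := hL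
          _ ≤ |C| * |l.absY σ s - m.absY σ t| := by gcongr; exact le_abs_self C
          _ ≤ _ := by gcongr
    _ = _ := by ring

/-- An arc having contact order greater than `1` with an arc in `σ y > 0`, not tangent to the
`x`-axis, is of the same kind: it has the same tangent half line. -/
lemma mem_halfArcs_of_one_lt_contactOrder {σ : ℤˣ} {l : Arc ℝ} (hl : l ∈ halfArcs σ) {n : Arc ℝ}
    (h : 1 < contactOrder l.toFun n.toFun) : n ∈ halfArcs σ := by
  obtain ⟨e, he⟩ := lt_iSup_iff.1 h
  obtain ⟨hO, he1⟩ := lt_iSup_iff.1 he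
  replace he1 : (1 : ℝ) < e := by exact_mod_cast he1
  obtain ⟨C, hC, hCb⟩ := (graphPath_arcSeries hl).norm_isBigO
  have hle := (graphPath_arcSeries hl).eventually_le_norm
  have hne : analyticOrderAt n.toFun 0 ≠ ⊤ := fun htop =>
    n.ne_zero ((analyticOrderAt_eq_top.1 htop).filter_mono nhdsWithin_le_nhds)
  obtain ⟨k, hk⟩ := ENat.ne_top_iff_exists.1 hne
  obtain ⟨v, hv, hv0, hveq⟩ := n.analytic.analyticOrderAt_eq_natCast.1 hk.symm
  simp only [sub_zero] at hveq
  have hvc : ∀ η > 0, ∀ᶠ t in 𝓝 (0 : ℝ), ‖v t - v 0‖ < η := fun η hη => by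
    simpa [dist_eq_norm] using Metric.eventually_nhds_iff_ball.2
      (Metric.continuousAt_iff.1 hv.continuousAt η hη |>.imp fun δ hδ =>
        ⟨hδ.1, fun y hy => hδ.2 hy⟩)
  have hv0' : 0 < ‖v 0‖ := norm_pos_iff.2 hv0
  have happly : ∀ t, |((σ : ℤ) : ℝ) * v t 1 - ((σ : ℤ) : ℝ) * v 0 1| ≤ ‖v t - v 0‖ := fun t => by
    refine le_trans ?_ (PiLp.norm_apply_le (v t - v 0) 1)
    rw [← mul_sub]
    exact (norm_sign_mul (𝕜 := ℝ) σ _).le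
  -- the tangent vector `v 0` of `n` points into `σ y > 0`: otherwise `n` stays out of a cone around
  -- the tangent direction of `l`, which is impossible for contact order greater than `1`
  have hc : 0 < ((σ : ℤ) : ℝ) * v 0 1 := by
    by_contra hneg
    rw [not_lt] at hneg
    -- `σ y ≥ ‖(x, y)‖ / C` along `l`, so any slope less than `1 / (3 C)` separates the arcs
    set κ := min 1 (1 / (4 * C)) with hκ
    have hκ0 : 0 < κ := lt_min one_pos (by positivity)
    have hκ1 : κ ≤ 1 := min_le_left _ _
    have hκC : κ * (4 * C) ≤ 1 := by
      rw [← le_div_iff₀ (by positivity)]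
      exact min_le_right _ _
    -- the points of `n` near `0` lie below the cone `σ y ≤ κ ‖(x, y)‖`
    have hcone : ∀ᶠ t in 𝓝[≥] (0 : ℝ), n.absY σ t ≤ κ * ‖n.toFun t‖ := by
      filter_upwards [(hvc (κ * ‖v 0‖ / 2) (by positivity)).filter_mono nhdsWithin_le_nhds,
        hveq.filter_mono nhdsWithin_le_nhds, self_mem_nhdsWithin] with t h1 h2 (h3 : 0 ≤ t)
      have h4 := (abs_le.1 ((happly t).trans h1.le)).2
      have h5 : ‖v 0‖ - ‖v t‖ ≤ ‖v t - v 0‖ := by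
        rw [norm_sub_rev]; exact norm_sub_norm_le _ _
      have h6 : n.absY σ t = t ^ k * (((σ : ℤ) : ℝ) * v t 1) := by
        rw [Arc.absY, h2]
        simp only [PiLp.smul_apply, smul_eq_mul]
        ring
      rw [h6, h2, norm_smul, norm_pow, Real.norm_of_nonneg h3,
        show κ * (t ^ k * ‖v t‖) = t ^ k * (κ * ‖v t‖) by ring]
      refine mul_le_mul_of_nonneg_left ?_ (pow_nonneg h3 k)
      have h7 : κ * ‖v 0‖ ≤ 1 * ‖v 0‖ := by gcongr
      have h8 : κ * (‖v 0‖ / 2) ≤ κ * ‖v t‖ := by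
        gcongr
        linarith
      linarith
    have hnorm : Tendsto (fun s => ‖l.toFun s‖) (𝓝[>] 0) (𝓝 0) := by
      have := l.analytic.continuousAt.norm.tendsto
      rw [l.map_zero, norm_zero] at this
      exact this.mono_left nhdsWithin_le_nhds
    obtain ⟨ε, ⟨hOε, hεcone⟩, hε0⟩ := ((hO.and (eventually_forall_mem_Ico hcone)).and
      (self_mem_nhdsWithin (a := (0 : ℝ)) (s := Set.Ioi 0))).exists
    replace hε0 : 0 < ε := hε0
    obtain ⟨D, hD⟩ := hOε.bound
    have hsmall : ∀ᶠ s in 𝓝[>] (0 : ℝ), D * ‖l.toFun s‖ ^ ((e : ℝ) - 1) < κ := by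
      have h1 := (hnorm.rpow_const (p := (e : ℝ) - 1) (Or.inr (by linarith))).const_mul D
      rw [Real.zero_rpow (by linarith), mul_zero] at h1
      exact h1.eventually (gt_mem_nhds hκ0)
    obtain ⟨s, h1, h2, h3, h4, h5⟩ := (hD.and (hsmall.and (hCb.and hle))).exists
    have hpos : 0 < ‖l.toFun s‖ := h4.trans_le h5
    have hlt : Metric.infDist (l.toFun s) (n.toFun '' Set.Ico 0 ε) < κ * ‖l.toFun s‖ := by
      rw [Real.norm_of_nonneg Metric.infDist_nonneg,
        Real.norm_of_nonneg (Real.rpow_nonneg hpos.le _)] at h1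
      refine h1.trans_lt ?_
      have : ‖l.toFun s‖ ^ (e : ℝ) = ‖l.toFun s‖ ^ ((e : ℝ) - 1) * ‖l.toFun s‖ := by
        rw [← Real.rpow_add_one hpos.ne', sub_add_cancel]
      rw [this, ← mul_assoc]
      gcongr
    obtain ⟨_, ⟨t, ht, rfl⟩, hdist⟩ := (Metric.infDist_lt_iff
      ((Set.nonempty_Ico.2 hε0).image _)).1 hlt
    rw [dist_eq_norm] at hdist
    have h6 : l.absY σ s - n.absY σ t ≤ ‖l.toFun s - n.toFun t‖ := by
      refine le_trans (le_abs_self _) (le_trans ?_ (PiLp.norm_apply_le (l.toFun s - n.toFun t) 1))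
      rw [Arc.absY, Arc.absY, ← mul_sub]
      exact (norm_sign_mul (𝕜 := ℝ) σ _).le
    have h7 : ‖n.toFun t‖ ≤ ‖l.toFun s‖ + ‖l.toFun s - n.toFun t‖ := by
      rw [norm_sub_rev]
      exact norm_le_norm_add_norm_sub' _ _
    have h8 := hεcone t ht
    have h9 : l.absY σ s ≤ 3 * κ * ‖l.toFun s‖ := by
      have : κ * ‖n.toFun t‖ ≤ κ * (2 * ‖l.toFun s‖) := by
        gcongr
        nlinarith
      linarith
    have h10 : 3 * κ * ‖l.toFun s‖ ≤ 3 * κ * (C * l.absY σ s) := by gcongr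
    nlinarith
  have h1 : ∀ᶠ t in 𝓝[>] (0 : ℝ), 0 < t ^ k ∧ n.toFun t = t ^ k • v t ∧
      ((σ : ℤ) : ℝ) * v 0 1 / 2 < ((σ : ℤ) : ℝ) * v t 1 ∧ ‖v t‖ ≤ ‖v 0‖ + 1 := by
    filter_upwards [(hvc (((σ : ℤ) : ℝ) * v 0 1 / 2) (by positivity)).filter_mono
      nhdsWithin_le_nhds, (hvc 1 one_pos).filter_mono nhdsWithin_le_nhds,
      hveq.filter_mono nhdsWithin_le_nhds, self_mem_nhdsWithin] with t h1 h2 h3 (h4 : 0 < t)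
    refine ⟨pow_pos h4 k, h3, ?_, ?_⟩
    · have := (abs_lt.1 ((happly t).trans_lt h1)).1
      linarith
    · have := norm_le_norm_add_norm_sub' (v t) (v 0)
      linarith
  have habs : ∀ t, n.toFun t = t ^ k • v t →
      ((σ : ℤ) : ℝ) * n.toFun t 1 = t ^ k * (((σ : ℤ) : ℝ) * v t 1) := fun t ht => by
    rw [ht]
    simp only [PiLp.smul_apply, smul_eq_mul]
    ring
  constructor
  · filter_upwards [h1] with t ⟨h2, h3, h4, _⟩
    rw [habs t h3]
    have : 0 < ((σ : ℤ) : ℝ) * v t 1 := by linarith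
    positivity
  · refine IsBigO.of_bound ((‖v 0‖ + 1) / (((σ : ℤ) : ℝ) * v 0 1 / 2)) ?_
    filter_upwards [h1] with t ⟨h2, h3, h4, h5⟩
    rw [← norm_sign_mul (𝕜 := ℝ) σ (n.toFun t 1), habs t h3, h3]
    simp only [PiLp.smul_apply, smul_eq_mul]
    rw [norm_mul, norm_mul, Real.norm_of_nonneg h2.le, div_mul_eq_mul_div,
      le_div_iff₀ (by positivity),
      Real.norm_of_nonneg (by linarith : (0 : ℝ) ≤ ((σ : ℤ) : ℝ) * v t 1)]
    have h6 : ‖v t 0‖ ≤ ‖v 0‖ + 1 := (PiLp.norm_apply_le (v t) 0).trans h5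
    calc _ = t ^ k * (‖v t 0‖ * (((σ : ℤ) : ℝ) * v 0 1 / 2)) := by ring
      _ ≤ t ^ k * ((‖v 0‖ + 1) * (((σ : ℤ) : ℝ) * v t 1)) := by gcongr
      _ = _ := by ring

lemma SameLocus.refl (l : Arc ℝ) : SameLocus l l := fun ε hε =>
  ⟨ε, hε, subset_rfl, subset_rfl⟩

lemma SameLocus.contactOrder_eq_top {l m : Arc ℝ} (h : SameLocus l m) :
    contactOrder l.toFun m.toFun = ⊤ := by
  refine top_le_iff.1 (ENNReal.le_of_forall_nnreal_lt fun e _ => ?_)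
  refine le_iSup₂_of_le (f := fun (h : ℝ≥0) (_ : ∀ᶠ ε in 𝓝[>] (0 : ℝ),
    (fun s => Metric.infDist (l.toFun s) (m.toFun '' Set.Ico 0 ε)) =O[𝓝[>] (0 : ℝ)]
      fun s => ‖l.toFun s‖ ^ (h : ℝ)) => (h : ℝ≥0∞)) e ?_ le_rfl
  filter_upwards [self_mem_nhdsWithin] with ε (hε : 0 < ε)
  obtain ⟨δ, hδ, hsub, -⟩ := h ε hε
  refine IsBigO.of_bound 1 ?_
  filter_upwards [Ioo_mem_nhdsGT hδ] with s hs
  rw [Metric.infDist_zero_of_mem (hsub (Set.mem_image_of_mem _ ⟨hs.1.le, hs.2⟩)), norm_zero]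
  positivity

/-- Arcs with the same equation have the same image near the origin; their parametrizations may
differ. -/
lemma image_subset_of_arcSeries_eq {σ : ℤˣ} {l m : Arc ℝ} (hl : l ∈ halfArcs σ)
    (hm : m ∈ halfArcs σ) (h : arcSeries σ l = arcSeries σ m) {ε : ℝ} (hε : 0 < ε) :
    ∃ δ > 0, ∀ δ' ≤ δ, l.toFun '' Set.Ico 0 δ' ⊆ m.toFun '' Set.Ico 0 ε := by
  obtain ⟨δ, hδ, hsub⟩ := mem_nhdsGT_iff_exists_Ioo_subset.1
    ((arcSeries_spec hl).and ((tendsto_absY hl).eventually (eventually_exists_mem_Ico hm hε)))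
  refine ⟨δ, hδ, ?_⟩
  rintro δ' hδ' _ ⟨s, hs, rfl⟩
  rcases hs.1.eq_or_lt with rfl | hs0
  · exact ⟨0, ⟨le_rfl, hε⟩, by rw [l.map_zero, m.map_zero]⟩
  · obtain ⟨h1, t, ht, h2, h3⟩ := hsub ⟨hs0, hs.2.trans_le hδ'⟩
    refine ⟨t, ht, ?_⟩
    ext i
    fin_cases i
    · exact h2.trans (by rw [← h, ← h1]; rfl)
    · exact h3.trans (l.sign_mul_absY σ s).symm

lemma sameLocus_iff {σ : ℤˣ} {l m : Arc ℝ} (hl : l ∈ halfArcs σ) (hm : m ∈ halfArcs σ) :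
    SameLocus l m ↔ arcSeries σ l = arcSeries σ m := by
  constructor
  · intro h
    rw [← FracSeries.ord_sub_eq_top, ← contactOrder_eq_ord hl hm, h.contactOrder_eq_top]
  · intro h ε hε
    obtain ⟨δ₁, hδ₁, h1⟩ := image_subset_of_arcSeries_eq hl hm h hε
    obtain ⟨δ₂, hδ₂, h2⟩ := image_subset_of_arcSeries_eq hm hl h.symm hε
    exact ⟨min δ₁ δ₂, lt_min hδ₁ hδ₂, h1 _ (min_le_left _ _), h2 _ (min_le_right _ _)⟩

/-- The height of an arc is its greatest order of coincidence with a Newton–Puiseux root. -/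
lemma PuiseuxRoots.fHeight_eq {f : ℝ × ℝ → ℝ} {σ : ℤˣ} {n : ℕ} (hn : 0 < n)
    {ρ : Fin n → FracSeries ℂ} (h : PuiseuxRoots f σ n ρ) {F : ℂ × ℂ → ℂ}
    (hF : IsComplexification f F) {l : Arc ℝ} (hl : l ∈ halfArcs σ) :
    fHeight f l = ⨆ i, ((arcSeries σ l).ofReal - ρ i).ord := by
  have hg := graphPath_complexPath hl
  apply le_antisymm
  · refine iSup₂_le ?_
    rintro ζ ⟨F', hF', hζ⟩
    obtain ⟨K, hK⟩ := (FracSeries.isBigO_of_coeff hg.coeff_eq_zero).bound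
    obtain ⟨C, ε, hε, hC⟩ := h.exists_dist_le hn hF' K
    refine hg.contactOrder_le |C| ?_
    have hsmall : ∀ i, ∀ᶠ t in 𝓝[≥] (0 : ℝ), ‖ζ.toFun t i‖ < ε := fun i =>
      (((Arc.tendsto_apply_zero ζ i).norm.eventually
        (gt_mem_nhds (by simpa using hε))).filter_mono nhdsWithin_le_nhds)
    filter_upwards [eventually_forall_mem_Ico ((hsmall 0).and ((hsmall 1).and hζ))] with ε' hε'
    filter_upwards [hg.tendsto.eventually hC, hg.tendsto.eventually hK, hl.1, hg.fst, hg.snd]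
      with s h1 h2 h3 h4 h5 t ht
    obtain ⟨h6, h7, h8⟩ := hε' t ht
    replace h3 : 0 < l.absY σ s := h3
    rw [Real.norm_of_nonneg h3.le] at h2
    obtain ⟨i, hi⟩ := h1 _ _ _ h2 h6 h7 h8
    refine ⟨i, hi.trans ?_⟩
    have hd0 : ‖(arcSeries σ l).ofReal.eval (l.absY σ s) - ζ.toFun t 0‖ ≤
        dist (complexPath l s) (ζ.toFun t) := by
      rw [dist_eq_norm, ← h4]
      exact PiLp.norm_apply_le (complexPath l s - ζ.toFun t) 0
    have hd1 : ‖((σ : ℤ) : ℂ) * ((l.absY σ s : ℝ) : ℂ) - ζ.toFun t 1‖ ≤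
        dist (complexPath l s) (ζ.toFun t) := by
      rw [dist_eq_norm]
      refine le_trans (le_of_eq ?_) (PiLp.norm_apply_le (complexPath l s - ζ.toFun t) 1)
      rw [PiLp.sub_apply, h5]
      rfl
    calc _ ≤ |C| * max _ _ := by gcongr; exact le_abs_self C
      _ ≤ _ := by gcongr; exact max_le hd0 hd1
  · refine iSup_le fun i => ?_
    obtain ⟨ζ, d, hd, h1, h0⟩ := FracSeries.exists_arc (h.coeff_eq_zero i) σ
    have hzero : ζ ∈ complexZeroArcs f := by
      obtain ⟨V, u, ε, B, hu, hε, hfac, -⟩ := h.exists_factorization hF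
      refine ⟨F, hF, ?_⟩
      have ht : Tendsto (fun s : ℝ => s ^ d) (𝓝[>] 0) (𝓝[>] 0) := by
        refine tendsto_nhdsWithin_iff.2 ⟨?_, ?_⟩
        · exact (Continuous.tendsto' (by fun_prop) 0 0 (by simp [hd.ne'])).mono_left
            nhdsWithin_le_nhds
        · filter_upwards [self_mem_nhdsWithin] with s (hs : 0 < s) using pow_pos hs d
      rw [← Set.Ioi_insert, nhdsWithin_insert, eventually_sup]
      have hfac0 : ∀ᶠ s in 𝓝[>] (0 : ℝ), F (ζ.toFun s 0, ζ.toFun s 1) = 0 := by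
        have hsm : ∀ᶠ s in 𝓝[>] (0 : ℝ), ‖ζ.toFun s 0‖ < ε :=
          (((Arc.tendsto_apply_zero ζ 0).norm.eventually
            (gt_mem_nhds (by simpa using hε))).filter_mono nhdsWithin_le_nhds)
        filter_upwards [ht.eventually hfac, hsm, self_mem_nhdsWithin] with s h2 h3 (h4 : 0 < s)
        have h5 := (h2 _ h3).2.2.2
        rw [ofReal_sign_mul] at h5
        rw [h1 s]
        refine h5.trans (mul_eq_zero_of_right _ (Finset.prod_eq_zero (Finset.mem_univ i) ?_))
        rw [h0 s h4, sub_self]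
      refine ⟨?_, hfac0⟩
      rw [eventually_pure]
      have hlim : Tendsto (fun s => F (ζ.toFun s 0, ζ.toFun s 1)) (𝓝 0)
          (𝓝 (F (ζ.toFun 0 0, ζ.toFun 0 1))) := by
        have hc := (ζ.analyticAt_apply 0).continuousAt.prodMk (ζ.analyticAt_apply 1).continuousAt
        refine ContinuousAt.comp (f := fun s => (ζ.toFun s 0, ζ.toFun s 1)) ?_ hc
        rw [ζ.map_zero]
        exact hF.1.continuousAt
      exact tendsto_nhds_unique_of_frequently_eq (hlim.mono_left nhdsWithin_le_nhds)
        (tendsto_const_nhds (x := (0 : ℂ)) (f := 𝓝[>] (0 : ℝ))) hfac0.frequently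
    refine le_trans ?_ (le_iSup₂ (f := fun ζ (_ : ζ ∈ complexZeroArcs f) =>
      contactOrder (complexPath l) ζ.toFun) ζ hzero)
    refine hg.le_contactOrder fun ε hε => (tendsto_absY hl).eventually (p := fun y => ∃ t ∈
      Set.Ico 0 ε, ζ.toFun t 0 = (ρ i).eval y ∧ ζ.toFun t 1 = ((σ : ℤ) : ℂ) * (y : ℂ)) ?_
    have hroot := (FracSeries.tendsto_root hd).eventually (Ioo_mem_nhdsGT hε)
    filter_upwards [hroot, self_mem_nhdsWithin] with y hy (hy0 : 0 < y)
    refine ⟨_, ⟨hy.1.le, hy.2⟩, ?_, ?_⟩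
    · rw [h0 _ hy.1, root_pow hd hy0]
    · rw [h1, root_pow hd hy0]
      rfl

/-! ### `f`-arcs and bars in terms of fractional power series -/

/-- `F` is a complexification of `f`, and `ρ` lists the `n ≥ 1` Newton–Puiseux roots of `f` in
`σ y > 0`. -/
structure RootSystem (f : ℝ × ℝ → ℝ) (σ : ℤˣ) (n : ℕ) (F : ℂ × ℂ → ℂ) (ρ : Fin n → FracSeries ℂ) :
    Prop where
  pos : 0 < n
  complexification : IsComplexification f F
  roots : PuiseuxRoots f σ n ρ

namespace RootSystem

variable {f : ℝ × ℝ → ℝ} {σ : ℤˣ} {n : ℕ} {F : ℂ × ℂ → ℂ} {ρ : Fin n → FracSeries ℂ}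
  {l m p : Arc ℝ}

lemma fHeight_eq (h : RootSystem f σ n F ρ) (hl : l ∈ halfArcs σ) :
    fHeight f l = ⨆ i, ((arcSeries σ l).ofReal - ρ i).ord :=
  h.roots.fHeight_eq h.pos h.complexification hl

lemma exists_fHeight_eq (h : RootSystem f σ n F ρ) (hl : l ∈ halfArcs σ) :
    ∃ i, fHeight f l = ((arcSeries σ l).ofReal - ρ i).ord := by
  have : Nonempty (Fin n) := ⟨⟨0, h.pos⟩⟩
  obtain ⟨i, hi⟩ := exists_eq_ciSup_of_finite (f := fun i => ((arcSeries σ l).ofReal - ρ i).ord)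
  exact ⟨i, (h.fHeight_eq hl).trans hi.symm⟩

lemma ord_le_fHeight (h : RootSystem f σ n F ρ) (hl : l ∈ halfArcs σ) (i : Fin n) :
    ((arcSeries σ l).ofReal - ρ i).ord ≤ fHeight f l := by
  rw [h.fHeight_eq hl]
  exact le_iSup (fun i => ((arcSeries σ l).ofReal - ρ i).ord) i

lemma one_le_fHeight (h : RootSystem f σ n F ρ) (hl : l ∈ halfArcs σ) : 1 ≤ fHeight f l := by
  refine le_trans ?_ (h.ord_le_fHeight hl ⟨0, h.pos⟩)
  rw [← ENNReal.ofReal_one, FracSeries.ofReal_le_ord]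
  intro e he
  rw [FracSeries.coeff_sub, FracSeries.coeff_ofReal, arcSeries_coeff hl he,
    h.roots.coeff_eq_zero _ e he, Complex.ofReal_zero, sub_zero]

/-- The height varies along arcs like a distance to the set of roots in an ultrametric space. -/
lemma min_le_fHeight (h : RootSystem f σ n F ρ) (hl : l ∈ halfArcs σ) (hm : m ∈ halfArcs σ) :
    min (fHeight f l) (arcSeries σ l - arcSeries σ m).ord ≤ fHeight f m := by
  obtain ⟨i, hi⟩ := h.exists_fHeight_eq hl
  refine le_trans ?_ (h.ord_le_fHeight hm i)
  have h1 : (arcSeries σ l - arcSeries σ m).ord =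
      ((arcSeries σ m).ofReal - (arcSeries σ l).ofReal).ord := by
    rw [FracSeries.ord_sub_comm (arcSeries σ l), ← FracSeries.ofReal_sub, FracSeries.ord_ofReal]
  rw [hi, h1, min_comm]
  exact FracSeries.min_le_ord_sub _ _ _

lemma fHeight_eq_of_lt (h : RootSystem f σ n F ρ) (hl : l ∈ halfArcs σ) (hm : m ∈ halfArcs σ)
    (hlt : fHeight f l < (arcSeries σ l - arcSeries σ m).ord) : fHeight f m = fHeight f l := by
  have h1 := h.min_le_fHeight hl hm
  have h2 := h.min_le_fHeight hm hl
  rw [min_eq_left hlt.le] at h1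
  rw [FracSeries.ord_sub_comm] at h2
  exact le_antisymm ((min_le_iff.1 h2).resolve_right hlt.not_ge) h1

lemma fHeight_congr (h : RootSystem f σ n F ρ) (hl : l ∈ halfArcs σ) (hm : m ∈ halfArcs σ)
    (heq : arcSeries σ l = arcSeries σ m) : fHeight f m = fHeight f l := by
  rw [h.fHeight_eq hl, h.fHeight_eq hm, heq]

lemma arcEquiv_iff (h : RootSystem f σ n F ρ) (hl : l ∈ halfArcs σ) (hm : m ∈ halfArcs σ) :
    ArcEquiv f l m ↔ arcSeries σ l = arcSeries σ m ∨
      fHeight f l < (arcSeries σ l - arcSeries σ m).ord := by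
  rw [ArcEquiv, sameLocus_iff hl hm, contactOrder_eq_ord hl hm]
  exact or_congr_right ⟨fun h1 => h1.2, fun h1 => ⟨(h.fHeight_eq_of_lt hl hm h1).symm, h1⟩⟩

/-- Since heights of arcs in a half plane are at least `1`, an equivalent arc has contact order
greater than `1`, hence the same tangent half line. -/
lemma mem_halfArcs_of_arcEquiv (h : RootSystem f σ n F ρ) (hl : l ∈ halfArcs σ)
    (hlm : ArcEquiv f l m) : m ∈ halfArcs σ := by
  refine mem_halfArcs_of_one_lt_contactOrder hl ?_
  rcases hlm with h1 | ⟨-, h1⟩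
  · rw [h1.contactOrder_eq_top]
    exact ENNReal.one_lt_top
  · exact (h.one_le_fHeight hl).trans_lt h1

lemma arcEquiv_symm (h : RootSystem f σ n F ρ) (hl : l ∈ halfArcs σ) (hm : m ∈ halfArcs σ)
    (hlm : ArcEquiv f l m) : ArcEquiv f m l := by
  rw [h.arcEquiv_iff hl hm] at hlm
  rw [h.arcEquiv_iff hm hl]
  rcases hlm with h1 | h1
  · exact Or.inl h1.symm
  · right
    rwa [h.fHeight_eq_of_lt hl hm h1, FracSeries.ord_sub_comm]

lemma arcEquiv_trans (h : RootSystem f σ n F ρ) (hl : l ∈ halfArcs σ) (hm : m ∈ halfArcs σ)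
    (hlm : ArcEquiv f l m) (hmp : ArcEquiv f m p) : ArcEquiv f l p := by
  have hp := h.mem_halfArcs_of_arcEquiv hm hmp
  rw [h.arcEquiv_iff hl hm] at hlm
  rw [h.arcEquiv_iff hm hp] at hmp
  rw [h.arcEquiv_iff hl hp]
  rcases hlm with h1 | h1
  · rwa [h1, ← h.fHeight_congr hl hm h1]
  · rcases hmp with h2 | h2
    · exact Or.inr (h2 ▸ h1)
    · rw [h.fHeight_eq_of_lt hl hm h1] at h2
      exact Or.inr ((lt_min h1 h2).trans_le (FracSeries.min_le_ord_sub _ _ _))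

lemma fArc_eq_iff (h : RootSystem f σ n F ρ) (hl : l ∈ halfArcs σ) (hm : m ∈ halfArcs σ) :
    fArc f l = fArc f m ↔ arcSeries σ l = arcSeries σ m ∨
      fHeight f l < (arcSeries σ l - arcSeries σ m).ord := by
  rw [← h.arcEquiv_iff hl hm]
  constructor
  · intro heq
    have : m ∈ fArc f m := Or.inl (SameLocus.refl m)
    rwa [← heq] at this
  · intro hlm
    have hml := h.arcEquiv_symm hl hm hlm
    ext p
    exact ⟨fun hp => h.arcEquiv_trans hm hl hml hp, fun hp => h.arcEquiv_trans hl hm hlm hp⟩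

/-- Bar equivalence of `f`-arcs, with the two cases of the definition merged: for finite heights it
says that the equations agree below the common height. -/
lemma barEquiv_iff (h : RootSystem f σ n F ρ) (hl : l ∈ halfArcs σ) (hm : m ∈ halfArcs σ) :
    BarEquiv f l m ↔ fHeight f m = fHeight f l ∧
      fHeight f l ≤ (arcSeries σ l - arcSeries σ m).ord ∧
        (fHeight f l = ⊤ → arcSeries σ l = arcSeries σ m) := by
  rw [BarEquiv, h.fArc_eq_iff hl hm, contactOrder_eq_ord hl hm]
  constructor
  · rintro ((h1 | h1) | ⟨h1, h2⟩)
    · refine ⟨h.fHeight_congr hl hm h1, ?_, fun _ => h1⟩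
      rw [FracSeries.ord_sub_eq_top.2 h1]
      exact le_top
    · exact ⟨h.fHeight_eq_of_lt hl hm h1, h1.le, fun h2 => absurd h1 (by simp [h2])⟩
    · refine ⟨h1.symm, (h1.trans h2).le, fun h3 => ?_⟩
      rw [← FracSeries.ord_sub_eq_top, ← h2, ← h1, h3]
  · rintro ⟨h1, h2, -⟩
    rcases h2.eq_or_lt with h4 | h4
    · exact Or.inr ⟨h1.symm, h1.trans h4⟩
    · exact Or.inl (Or.inr h4)

lemma fArc_mem_bar_iff (h : RootSystem f σ n F ρ) (hl : l ∈ halfArcs σ) (hm : m ∈ halfArcs σ)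
    (hfin : fHeight f l ≠ ⊤) : fArc f m ∈ bar f σ l ↔ fHeight f m = fHeight f l ∧
      fHeight f l ≤ (arcSeries σ l - arcSeries σ m).ord := by
  constructor
  · rintro ⟨m', hm', heq, hbar⟩
    rw [h.barEquiv_iff hl hm'] at hbar
    obtain ⟨h1, h2, -⟩ := hbar
    rcases (h.fArc_eq_iff hm' hm).1 heq.symm with h3 | h3
    · exact ⟨(h.fHeight_congr hm' hm h3).trans h1, h3 ▸ h2⟩
    · refine ⟨(h.fHeight_eq_of_lt hm' hm h3).trans h1, ?_⟩
      rw [h1] at h3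
      exact (le_min h2 h3.le).trans (FracSeries.min_le_ord_sub _ _ _)
  · rintro ⟨h1, h2⟩
    exact ⟨m, hm, rfl, (h.barEquiv_iff hl hm).2 ⟨h1, h2, fun h3 => absurd h3 hfin⟩⟩

lemma bar_subset (h : RootSystem f σ n F ρ) (hl : l ∈ halfArcs σ) (hm : m ∈ halfArcs σ)
    (hfin : fHeight f l ≠ ⊤) (h1 : fHeight f m = fHeight f l)
    (h2 : fHeight f l ≤ (arcSeries σ l - arcSeries σ m).ord) : bar f σ m ⊆ bar f σ l := by
  rintro _ ⟨p, hp, rfl, hbar⟩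
  rw [h.barEquiv_iff hm hp, h1] at hbar
  rw [h.fArc_mem_bar_iff hl hp hfin]
  exact ⟨hbar.1, (le_min h2 hbar.2.1).trans (FracSeries.min_le_ord_sub _ _ _)⟩

lemma bar_eq (h : RootSystem f σ n F ρ) (hl : l ∈ halfArcs σ) (hm : m ∈ halfArcs σ)
    (hfin : fHeight f l ≠ ⊤) (h1 : fHeight f m = fHeight f l)
    (h2 : fHeight f l ≤ (arcSeries σ l - arcSeries σ m).ord) : bar f σ m = bar f σ l := by
  refine (h.bar_subset hl hm hfin h1 h2).antisymm (h.bar_subset hm hl (h1 ▸ hfin) h1.symm ?_)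
  rwa [h1, FracSeries.ord_sub_comm]

end RootSystem

/-! ### The initial form along a bar -/

lemma tendsto_rpow_nhdsGT_zero {e : ℝ} (he : 0 < e) :
    Tendsto (fun y : ℝ => y ^ e) (𝓝[>] 0) (𝓝 0) := by
  have := (Real.continuousAt_rpow_const 0 e (Or.inr he.le)).tendsto
  rw [Real.zero_rpow he.ne'] at this
  exact this.mono_left nhdsWithin_le_nhds

/-- Passing from a scale `yᵇ` to a coarser scale `yᵃ`. -/
lemma tendsto_rpow_smul_of_lt {E : Type*} [NormedAddCommGroup E] [NormedSpace ℝ E] {g : ℝ → E}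
    {a b : ℝ} (hab : a < b) {q : E}
    (h : Tendsto (fun y : ℝ => y ^ (-b) • g y) (𝓝[>] 0) (𝓝 q)) :
    Tendsto (fun y : ℝ => y ^ (-a) • g y) (𝓝[>] 0) (𝓝 0) := by
  have h1 := (tendsto_rpow_nhdsGT_zero (sub_pos.2 hab)).smul h
  rw [zero_smul] at h1
  refine h1.congr' ?_
  filter_upwards [self_mem_nhdsWithin] with y (hy : 0 < y)
  rw [smul_smul, ← Real.rpow_add hy]
  congr 2
  ring

/-- The exponent of a leading term is determined by the function. -/
lemma rpow_scale_unique {E : Type*} [NormedAddCommGroup E] [NormedSpace ℝ E] {g : ℝ → E}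
    {a b : ℝ} {p q : E} (hp : p ≠ 0) (hq : q ≠ 0)
    (ha : Tendsto (fun y : ℝ => y ^ (-a) • g y) (𝓝[>] 0) (𝓝 p))
    (hb : Tendsto (fun y : ℝ => y ^ (-b) • g y) (𝓝[>] 0) (𝓝 q)) : a = b := by
  rcases lt_trichotomy a b with h | h | h
  · exact absurd (tendsto_nhds_unique ha (tendsto_rpow_smul_of_lt h hb)) hp
  · exact h
  · exact absurd (tendsto_nhds_unique hb (tendsto_rpow_smul_of_lt h ha)) hq

open Classical in
/-- The indices of the series `ρᵢ` that agree with `α` below the exponent `t`. -/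
noncomputable def cluster {n : ℕ} (ρ : Fin n → FracSeries ℂ) (α : FracSeries ℂ) (t : ℝ) :
    Finset (Fin n) :=
  {i | ∀ e < t, (ρ i).coeff e = α.coeff e}

lemma mem_cluster {n : ℕ} {ρ : Fin n → FracSeries ℂ} {α : FracSeries ℂ} {t : ℝ} {i : Fin n} :
    i ∈ cluster ρ α t ↔ ∀ e < t, (ρ i).coeff e = α.coeff e := by
  simp [cluster]

/-- The monic polynomial whose roots are the coefficients at `t` of the series `ρᵢ` that agree
with `α` below `t`. -/
noncomputable def clusterPoly {n : ℕ} (ρ : Fin n → FracSeries ℂ) (α : FracSeries ℂ) (t : ℝ) :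
    ℂ[X] :=
  ∏ i ∈ cluster ρ α t, (X - C ((ρ i).coeff t))

/-- `φ(y) = α_{<t}(y) + w yᵗ + o(yᵗ)`, where `α_{<t}` is the part of `α` of exponents `< t`. -/
def IsPathAt (α : FracSeries ℂ) (t : ℝ) (φ : ℝ → ℂ) (w : ℂ) : Prop :=
  Tendsto (fun y : ℝ => y ^ (-t) • (φ y - α.eval y)) (𝓝[>] 0) (𝓝 (w - α.coeff t))

namespace IsPathAt

variable {α β : FracSeries ℂ} {t : ℝ} {φ : ℝ → ℂ} {w : ℂ}

lemma add_rpow (α : FracSeries ℂ) (t : ℝ) (w : ℂ) :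
    IsPathAt α t (fun y => α.eval y + y ^ t • (w - α.coeff t)) w := by
  refine tendsto_const_nhds.congr' ?_
  filter_upwards [self_mem_nhdsWithin] with y (hy : 0 < y)
  rw [add_sub_cancel_left, smul_smul, ← Real.rpow_add hy, neg_add_cancel, Real.rpow_zero, one_smul]

/-- Only the terms of exponent less than `t` matter. -/
lemma congr_left (h : IsPathAt α t φ w) (hαβ : ∀ e < t, β.coeff e = α.coeff e) :
    IsPathAt β t φ w := by
  have h1 := Tendsto.add h ((α - β).tendsto_eval_smul (e := t) fun e he => by
    rw [FracSeries.coeff_sub, hαβ e he, sub_self])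
  rw [FracSeries.coeff_sub, sub_add_sub_cancel] at h1
  refine h1.congr' ?_
  filter_upwards [FracSeries.eventually_eval_sub α β] with y hy
  rw [hy, ← smul_add, sub_add_sub_cancel]

lemma eval (hαβ : ∀ e < t, β.coeff e = α.coeff e) : IsPathAt α t β.eval (β.coeff t) := by
  have h : IsPathAt β t β.eval (β.coeff t) := by simp [IsPathAt]
  exact h.congr_left fun e he => (hαβ e he).symm

lemma tendsto_zero (h : IsPathAt α t φ w) (ht : 0 < t) (hα : α.coeff 0 = 0) :
    Tendsto φ (𝓝[>] 0) (𝓝 0) := by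
  have h1 : Tendsto (fun y : ℝ => y ^ (-(0 : ℝ)) • (φ y - α.eval y)) (𝓝[>] 0) (𝓝 0) :=
    tendsto_rpow_smul_of_lt ht h
  have h2 := h1.add α.tendsto_eval
  simpa [hα] using h2

lemma sub_eval (h : IsPathAt α t φ w) (hαβ : ∀ e < t, β.coeff e = α.coeff e) :
    Tendsto (fun y : ℝ => y ^ (-t) • (φ y - β.eval y)) (𝓝[>] 0) (𝓝 (w - β.coeff t)) :=
  h.congr_left hαβ

end IsPathAt

/-- If `β` does not agree with `α` below `t`, then `φ - β` has a leading term, the same for all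
`φ = α_{<t} + w yᵗ + o(yᵗ)`. -/
lemma FracSeries.exists_leading_of_not_agree {α β : FracSeries ℂ} {t : ℝ}
    (h : ¬ ∀ e < t, β.coeff e = α.coeff e) :
    ∃ (E : ℝ) (a : ℂ), E < t ∧ a ≠ 0 ∧ ∀ φ w, IsPathAt α t φ w →
      Tendsto (fun y : ℝ => y ^ (-E) • (φ y - β.eval y)) (𝓝[>] 0) (𝓝 a) := by
  push Not at h
  obtain ⟨e, he, hne⟩ := h
  have hne' : (α - β).coeff e ≠ 0 := by rwa [coeff_sub, sub_ne_zero, ne_comm]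
  obtain ⟨E, -, hE, hlow⟩ := (α - β).exists_leading ⟨e, hne'⟩
  have hEt : E < t := by
    by_contra! hle
    exact hne' (hlow e (he.trans_le hle))
  refine ⟨E, _, hEt, hE, fun φ w hφ => ?_⟩
  have h1 := (tendsto_rpow_smul_of_lt hEt hφ).add ((α - β).tendsto_eval_smul hlow)
  rw [zero_add] at h1
  refine h1.congr' ?_
  filter_upwards [eventually_eval_sub α β] with y hy
  rw [hy, ← smul_add, sub_add_sub_cancel]

lemma logDeriv_mul_prod_sub {ι : Type*} {V : ℂ → ℂ} {w : ℂ} (hV : AnalyticAt ℂ V w)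
    (hV0 : V w ≠ 0) (s : Finset ι) (a : ι → ℂ) (ha : ∀ i ∈ s, w - a i ≠ 0) :
    logDeriv (fun x => V x * ∏ i ∈ s, (x - a i)) w = deriv V w / V w + ∑ i ∈ s, (w - a i)⁻¹ := by
  rw [logDeriv_mul w hV0 (Finset.prod_ne_zero_iff.2 ha) hV.differentiableAt (by fun_prop),
    logDeriv_apply]
  congr 1
  rw [logDeriv_prod (f := fun i x => x - a i) (x := w) ha (fun i _ => by fun_prop)]
  refine Finset.sum_congr rfl fun i _ => ?_
  simp [logDeriv_apply]

lemma eval_derivative_C_mul_clusterPoly {n : ℕ} {ρ : Fin n → FracSeries ℂ} {α : FracSeries ℂ}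
    {t : ℝ} {A : ℂ} (hA : A ≠ 0) {w : ℂ} (hw : (clusterPoly ρ α t).eval w ≠ 0) :
    (C A * clusterPoly ρ α t).derivative.eval w =
      (∑ i ∈ cluster ρ α t, (w - (ρ i).coeff t)⁻¹) * (C A * clusterPoly ρ α t).eval w := by
  have heval : ∀ x, (C A * clusterPoly ρ α t).eval x =
      A * ∏ i ∈ cluster ρ α t, (x - (ρ i).coeff t) := fun x => by
    simp [clusterPoly, eval_prod]
  have hw' : ∀ i ∈ cluster ρ α t, w - (ρ i).coeff t ≠ 0 := by
    rw [← Finset.prod_ne_zero_iff]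
    simpa [clusterPoly, eval_prod] using hw
  have h := logDeriv_mul_prod_sub (V := fun _ => A) (w := w) analyticAt_const hA
    (cluster ρ α t) (fun i => (ρ i).coeff t) hw'
  rw [deriv_const, zero_div, zero_add] at h
  rw [← h, logDeriv_apply, ← Polynomial.deriv]
  simp_rw [← heval]
  rw [div_mul_cancel₀]
  rw [eval_mul, eval_C]
  exact mul_ne_zero hA hw

/-- The initial form of `G` along the paths `α_{<t}(y) + w yᵗ + o(yᵗ)`: up to a constant, it is the
polynomial `∏ (w - zᵢ)`, over the roots `α_{<t}(y) + zᵢ yᵗ + ⋯`. The initial form of the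
`x`-derivative is the derivative, by comparison of logarithmic derivatives. -/
lemma PuiseuxRoots.exists_initialForm {g : ℝ × ℝ → ℝ} {σ : ℤˣ} {n : ℕ}
    {ρ : Fin n → FracSeries ℂ} (h : PuiseuxRoots g σ n ρ) {G : ℂ × ℂ → ℂ}
    (hG : IsComplexification g G) {α : FracSeries ℂ} (hα : α.coeff 0 = 0) {t : ℝ} (ht : 0 < t) :
    ∃ (e : ℝ) (A : ℂ), A ≠ 0 ∧ ∀ φ w, IsPathAt α t φ w →
      Tendsto (fun y : ℝ => y ^ (-e) • G (φ y, ((((σ : ℤ) : ℝ) * y : ℝ) : ℂ))) (𝓝[>] 0)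
        (𝓝 ((C A * clusterPoly ρ α t).eval w)) ∧
      ((clusterPoly ρ α t).eval w ≠ 0 →
        Tendsto (fun y : ℝ => y ^ (-(e - t)) •
          complexPartialX G (φ y, ((((σ : ℤ) : ℝ) * y : ℝ) : ℂ))) (𝓝[>] 0)
          (𝓝 ((C A * clusterPoly ρ α t).derivative.eval w))) := by
  classical
  obtain ⟨V, u, ε, B, hu, hε, hfac, hV⟩ := h.exists_factorization hG
  -- each factor `φ - ρᵢ` has order `t` and leading coefficient `w - zᵢ` for the indices in the
  -- cluster, and a leading term independent of `φ` for the others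
  have hterm : ∀ i, ∃ (E : ℝ) (a : ℂ), (i ∈ cluster ρ α t → E = t) ∧
      (i ∉ cluster ρ α t → E < t ∧ a ≠ 0) ∧ ∀ φ w, IsPathAt α t φ w →
      Tendsto (fun y : ℝ => y ^ (-E) • (φ y - (ρ i).eval y)) (𝓝[>] 0)
        (𝓝 (if i ∈ cluster ρ α t then w - (ρ i).coeff t else a)) := fun i => by
    by_cases hi : i ∈ cluster ρ α t
    · refine ⟨t, 0, fun _ => rfl, fun h' => absurd hi h', fun φ w hφ => ?_⟩
      rw [if_pos hi]
      exact hφ.sub_eval (mem_cluster.1 hi)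
    · obtain ⟨E, a, h1, h2, h3⟩ := FracSeries.exists_leading_of_not_agree (mem_cluster.not.1 hi)
      exact ⟨E, a, fun h' => absurd h' hi, fun _ => ⟨h1, h2⟩, by simpa only [if_neg hi] using h3⟩
  choose E a hE ha hlim using hterm
  refine ⟨∑ i, E i, u * ∏ i ∈ (cluster ρ α t)ᶜ, a i, mul_ne_zero hu (Finset.prod_ne_zero_iff.2
    fun i hi => (ha i (Finset.mem_compl.1 hi)).2), fun φ w hφ => ?_⟩
  have hφ0 := hφ.tendsto_zero ht hα
  have hφε : ∀ᶠ y in 𝓝[>] (0 : ℝ), ‖φ y‖ < ε :=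
    hφ0.norm.eventually (gt_mem_nhds (by simpa using hε))
  have hmain : Tendsto (fun y : ℝ => y ^ (-∑ i, E i) • G (φ y, ((((σ : ℤ) : ℝ) * y : ℝ) : ℂ)))
      (𝓝[>] 0) (𝓝 ((C (u * ∏ i ∈ (cluster ρ α t)ᶜ, a i) * clusterPoly ρ α t).eval w)) := by
    have h1 := (hV φ hφ0).mul (tendsto_finsetProd Finset.univ fun i _ => hlim i φ w hφ)
    have h2 : u * ∏ i, (if i ∈ cluster ρ α t then w - (ρ i).coeff t else a i) =
        (C (u * ∏ i ∈ (cluster ρ α t)ᶜ, a i) * clusterPoly ρ α t).eval w := by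
      rw [← Finset.prod_mul_prod_compl (cluster ρ α t),
        Finset.prod_congr rfl fun i hi => if_pos hi,
        Finset.prod_congr (s₁ := (cluster ρ α t)ᶜ) rfl fun i hi => if_neg (Finset.mem_compl.1 hi)]
      simp only [clusterPoly, eval_mul, eval_C, eval_prod, eval_sub, eval_X]
      ring
    rw [h2] at h1
    refine h1.congr' ?_
    filter_upwards [hfac, hφε, self_mem_nhdsWithin] with y h3 h4 (hy : 0 < y)
    rw [(h3 _ h4).2.2.2, Finset.prod_smul, ← Real.rpow_sum_of_pos hy, Finset.sum_neg_distrib,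
      mul_smul_comm]
  refine ⟨hmain, fun hw => ?_⟩
  have hw' : ∀ i ∈ cluster ρ α t, w - (ρ i).coeff t ≠ 0 := by
    rw [← Finset.prod_ne_zero_iff]
    simpa [clusterPoly, eval_prod] using hw
  have hne : ∀ᶠ y in 𝓝[>] (0 : ℝ), ∀ i, φ y - (ρ i).eval y ≠ 0 := by
    refine eventually_all.2 fun i => ?_
    have h0 : (if i ∈ cluster ρ α t then w - (ρ i).coeff t else a i) ≠ 0 := by
      split_ifs with hi
      · exact hw' i hi
      · exact (ha i hi).2
    filter_upwards [(hlim i φ w hφ).eventually_ne h0] with y hy h1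
    simp [h1] at hy
  -- in the logarithmic derivative, scaled by `yᵗ`, only the cluster survives
  have hlog : Tendsto (fun y : ℝ => y ^ t • (deriv (V y) (φ y) / V y (φ y) +
      ∑ i, (φ y - (ρ i).eval y)⁻¹)) (𝓝[>] 0)
      (𝓝 (∑ i ∈ cluster ρ α t, (w - (ρ i).coeff t)⁻¹)) := by
    have hVlim : Tendsto (fun y : ℝ => y ^ t • (deriv (V y) (φ y) / V y (φ y))) (𝓝[>] 0) (𝓝 0) := by
      have hO : (fun y : ℝ => deriv (V y) (φ y) / V y (φ y)) =O[𝓝[>] 0] fun _ => (1 : ℝ) := by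
        refine IsBigO.of_bound B ?_
        filter_upwards [hfac, hφε] with y h3 h4
        obtain ⟨-, h5, h6, -⟩ := h3 _ h4
        rw [norm_div, norm_one, mul_one, div_le_iff₀ (norm_pos_iff.2 h5)]
        exact h6
      have h1 := (isBigO_refl (fun y : ℝ => y ^ t) (𝓝[>] 0)).smul hO
      refine h1.trans_tendsto ?_
      simpa using tendsto_rpow_nhdsGT_zero ht
    have hsum : ∀ i, Tendsto (fun y : ℝ => y ^ t • (φ y - (ρ i).eval y)⁻¹) (𝓝[>] 0)
        (𝓝 (if i ∈ cluster ρ α t then (w - (ρ i).coeff t)⁻¹ else 0)) := fun i => by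
      have h1 := hlim i φ w hφ
      by_cases hi : i ∈ cluster ρ α t
      · rw [if_pos hi] at h1 ⊢
        refine (h1.inv₀ (hw' i hi)).congr' ?_
        filter_upwards [self_mem_nhdsWithin] with y (hy : 0 < y)
        rw [hE i hi, smul_inv₀, ← Real.rpow_neg hy.le, neg_neg]
      · rw [if_neg hi] at h1 ⊢
        have h2 := (tendsto_rpow_nhdsGT_zero (sub_pos.2 (ha i hi).1)).smul
          (h1.inv₀ (ha i hi).2)
        rw [zero_smul] at h2
        refine h2.congr' ?_
        filter_upwards [self_mem_nhdsWithin] with y (hy : 0 < y)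
        rw [smul_inv₀, ← Real.rpow_neg hy.le, neg_neg, smul_smul, ← Real.rpow_add hy,
          sub_add_cancel]
    have h1 := hVlim.add (tendsto_finsetSum Finset.univ fun i _ => hsum i)
    rw [zero_add, Finset.sum_ite_mem, Finset.univ_inter] at h1
    refine h1.congr fun y => ?_
    rw [smul_add, Finset.smul_sum]
  rw [eval_derivative_C_mul_clusterPoly (mul_ne_zero hu (Finset.prod_ne_zero_iff.2
    fun i hi => (ha i (Finset.mem_compl.1 hi)).2)) hw]
  refine (hlog.mul hmain).congr' ?_
  filter_upwards [hfac, hφε, hne, self_mem_nhdsWithin] with y h3 h4 h5 (hy : 0 < y)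
  obtain ⟨h6, h7, -, h8⟩ := h3 _ h4
  have hev : (fun x : ℂ => G (x, ((((σ : ℤ) : ℝ) * y : ℝ) : ℂ))) =ᶠ[𝓝 (φ y)]
      fun x => V y x * ∏ i, (x - (ρ i).eval y) := by
    filter_upwards [continuous_norm.continuousAt.eventually (gt_mem_nhds h4)] with x hx
    exact (h3 x hx).2.2.2
  have h9 := (logDeriv_congr_nhds hev).self_of_nhds
  rw [logDeriv_mul_prod_sub h6 h7 Finset.univ (fun i => (ρ i).eval y) fun i _ => h5 i,
    logDeriv_apply] at h9
  have h10 : G (φ y, ((((σ : ℤ) : ℝ) * y : ℝ) : ℂ)) ≠ 0 := by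
    rw [h8]
    exact mul_ne_zero h7 (Finset.prod_ne_zero_iff.2 fun i _ => h5 i)
  rw [← h9, smul_mul_smul_comm, ← Real.rpow_add hy, div_mul_cancel₀ _ h10]
  congr 2
  ring

section Cluster

variable {n : ℕ} {ρ : Fin n → FracSeries ℂ} {α β : FracSeries ℂ} {t : ℝ}

lemma cluster_congr (h : ∀ e < t, β.coeff e = α.coeff e) : cluster ρ β t = cluster ρ α t := by
  ext i
  simp only [mem_cluster]
  exact forall₂_congr fun e he => by rw [h e he]

lemma clusterPoly_ne_zero : clusterPoly ρ α t ≠ 0 :=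
  (monic_prod_X_sub_C _ _).ne_zero

lemma eval_clusterPoly_ne_zero {w : ℂ} :
    (clusterPoly ρ α t).eval w ≠ 0 ↔ ∀ i ∈ cluster ρ α t, w ≠ (ρ i).coeff t := by
  simp [clusterPoly, eval_prod, Finset.prod_ne_zero_iff, sub_ne_zero]

open Classical in
lemma rootMultiplicity_C_mul_clusterPoly {A : ℂ} (hA : A ≠ 0) (z : ℂ) :
    (C A * clusterPoly ρ α t).rootMultiplicity z =
      {i ∈ cluster ρ α t | (ρ i).coeff t = z}.card := by
  rw [← count_roots, roots_C_mul _ hA, clusterPoly, roots_prod _ _ (monic_prod_X_sub_C _ _).ne_zero]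
  simp only [roots_X_sub_C, Multiset.bind_singleton, Multiset.count_map, Finset.card_def,
    Finset.filter_val, eq_comm]

lemma derivative_C_mul_clusterPoly_ne_zero {A : ℂ} (hA : A ≠ 0)
    (hne : (cluster ρ α t).Nonempty) : (C A * clusterPoly ρ α t).derivative ≠ 0 := by
  intro h0
  have h1 := derivative_eq_zero.1 h0
  rw [natDegree_C_mul hA, clusterPoly, natDegree_finsetProd_X_sub_C_eq_card] at h1
  exact hne.card_pos.ne' h1

/-- The initial form of the `x`-derivative is the derivative of the initial form. -/
lemma exists_derivative_eq_C_mul_clusterPoly {g : ℝ × ℝ → ℝ} {σ : ℤˣ} {n' : ℕ}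
    {ρ' : Fin n' → FracSeries ℂ} {G : ℂ × ℂ → ℂ} (h' : PuiseuxRoots g σ n' ρ')
    (hG : IsComplexification g (complexPartialX G)) (hα : α.coeff 0 = 0) (ht : 0 < t) {e : ℝ}
    {A : ℂ} (hA : A ≠ 0) (hne : (cluster ρ α t).Nonempty)
    (hlim : ∀ φ w, IsPathAt α t φ w → (clusterPoly ρ α t).eval w ≠ 0 →
        Tendsto (fun y : ℝ => y ^ (-(e - t)) •
          complexPartialX G (φ y, ((((σ : ℤ) : ℝ) * y : ℝ) : ℂ))) (𝓝[>] 0)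
          (𝓝 ((C A * clusterPoly ρ α t).derivative.eval w))) :
    ∃ A' : ℂ, A' ≠ 0 ∧ (C A * clusterPoly ρ α t).derivative = C A' * clusterPoly ρ' α t := by
  obtain ⟨e', A', hA', hlim'⟩ := h'.exists_initialForm hG hα ht
  -- where none of the polynomials vanishes, both sides are leading coefficients of the same
  -- function
  refine ⟨A', hA', eq_of_infinite_eval_eq _ _ ?_⟩
  have hD := derivative_C_mul_clusterPoly_ne_zero hA hne
  set R := clusterPoly ρ α t * (C A * clusterPoly ρ α t).derivative * clusterPoly ρ' α t with hR
  have hR0 : R ≠ 0 := mul_ne_zero (mul_ne_zero clusterPoly_ne_zero hD) clusterPoly_ne_zero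
  have hfin : {w | R.eval w = 0}.Finite :=
    R.roots.toFinset.finite_toSet.subset fun w hw => by simpa [hR0] using hw
  refine (hfin.infinite_compl).mono fun w hw => ?_
  have hw' : R.eval w ≠ 0 := hw
  rw [hR, eval_mul, eval_mul] at hw'
  have h1 := hlim _ w (IsPathAt.add_rpow α t w) (left_ne_zero_of_mul (left_ne_zero_of_mul hw'))
  have h2 := (hlim' _ w (IsPathAt.add_rpow α t w)).1
  have h3 : (C A' * clusterPoly ρ' α t).eval w ≠ 0 := by
    rw [eval_mul, eval_C]
    exact mul_ne_zero hA' (right_ne_zero_of_mul hw')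
  have hee := rpow_scale_unique (right_ne_zero_of_mul (left_ne_zero_of_mul hw')) h3 h1 h2
  rw [hee] at h1
  exact tendsto_nhds_unique h1 h2

end Cluster

/-- A complex polynomial with real values on the real line has real coefficients: it agrees with its
conjugate at infinitely many points. -/
lemma Polynomial.exists_map_eq_of_forall_real {P : ℂ[X]}
    (h : ∀ u : ℝ, ∃ v : ℝ, P.eval (u : ℂ) = v) : ∃ I : ℝ[X], I.map (algebraMap ℝ ℂ) = P := by
  have hconj : P.map (starRingEnd ℂ) = P := by
    refine eq_of_infinite_eval_eq _ _ ((Set.infinite_range_of_injective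
      Complex.ofReal_injective).mono ?_)
    rintro _ ⟨u, rfl⟩
    obtain ⟨v, hv⟩ := h u
    have : (P.map (starRingEnd ℂ)).eval ((starRingEnd ℂ) (u : ℂ)) =
        starRingEnd ℂ (P.eval (u : ℂ)) :=
      eval_map_apply _ _
    rw [Complex.conj_ofReal, hv, Complex.conj_ofReal, ← hv] at this
    exact this
  have hlift : P ∈ lifts (algebraMap ℝ ℂ) := by
    rw [lifts_iff_coeff_lifts]
    intro k
    have h1 := congrArg (fun Q => Q.coeff k) hconj
    simp only [coeff_map] at h1
    exact ⟨(P.coeff k).re, Complex.conj_eq_iff_re.1 h1⟩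
  simpa [mem_lifts] using hlift

/-! ### `B`-roots as root multiplicities -/

section BRoots

variable {f g : ℝ × ℝ → ℝ} {σ : ℤˣ} {n : ℕ} {ρ : Fin n → FracSeries ℂ}

open Classical in
/-- The `B`-root multiplicity of `z` is the number of roots `ρᵢ` that agree with `λ_B` below `h(B)`
and have the coefficient `z` at `h(B)`. -/
lemma PuiseuxRoots.encard_bRoots (h : PuiseuxRoots g σ n ρ) (l : Arc ℝ) (z : ℂ) :
    (bRoots f g σ l z).encard =
      ({i ∈ cluster ρ (arcSeries σ l).ofReal (fHeight f l).toReal |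
        (ρ i).coeff (fHeight f l).toReal = z}.card : ℕ∞) := by
  have h1 : bRoots f g σ l z = {p : FracSeries ℂ × ℕ |
      ((∀ e < (fHeight f l).toReal, p.1.coeff e = ((arcSeries σ l).coeff e : ℂ)) ∧
        p.1.coeff (fHeight f l).toReal = z) ∧ p.2 < {i | ρ i = p.1}.ncard} := by
    ext p
    simp only [bRoots, Set.mem_ofPred_eq, h.isRootGT_iff, and_assoc]
  rw [h1, encard_setOf_lt_ncard_fiber ρ fun β => (∀ e < (fHeight f l).toReal,
    β.coeff e = ((arcSeries σ l).coeff e : ℂ)) ∧ β.coeff (fHeight f l).toReal = z,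
    ← Set.ncard_coe_finset]
  congr 2
  ext i
  simp [mem_cluster]

lemma PuiseuxRoots.isBRoot_iff (h : PuiseuxRoots g σ n ρ) (l : Arc ℝ) (z : ℂ) :
    IsBRoot f g σ l z ↔ ∃ i ∈ cluster ρ (arcSeries σ l).ofReal (fHeight f l).toReal,
      (ρ i).coeff (fHeight f l).toReal = z := by
  classical
  rw [IsBRoot, ← Set.encard_ne_zero, h.encard_bRoots, ne_eq, Nat.cast_eq_zero, Finset.card_eq_zero,
    ← ne_eq, ← Finset.nonempty_iff_ne_empty, Finset.filter_nonempty_iff]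

open Classical in
lemma PuiseuxRoots.setOf_isBRoot (h : PuiseuxRoots g σ n ρ) (l : Arc ℝ) :
    {z | IsBRoot f g σ l z} = ((cluster ρ (arcSeries σ l).ofReal (fHeight f l).toReal).image
      fun i => (ρ i).coeff (fHeight f l).toReal : Finset ℂ) := by
  ext z
  simp [h.isBRoot_iff]

lemma PuiseuxRoots.clusterPoly_eq_prod (h : PuiseuxRoots g σ n ρ) (l : Arc ℝ)
    (hfin : {z | IsBRoot f g σ l z}.Finite) :
    clusterPoly ρ (arcSeries σ l).ofReal (fHeight f l).toReal =
      ∏ z ∈ hfin.toFinset, (X - C z) ^ (bRoots f g σ l z).ncard := by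
  classical
  have h1 : hfin.toFinset = (cluster ρ (arcSeries σ l).ofReal (fHeight f l).toReal).image
      fun i => (ρ i).coeff (fHeight f l).toReal := by
    rw [← Finset.coe_inj, Set.Finite.coe_toFinset, h.setOf_isBRoot]
  rw [h1, clusterPoly, Finset.prod_comp (fun z : ℂ => X - C z)]
  refine Finset.prod_congr rfl fun z _ => ?_
  rw [Set.ncard, h.encard_bRoots]
  simp

end BRoots

/-! ### The polynomial of a bar -/

namespace RootSystem

variable {f : ℝ × ℝ → ℝ} {σ : ℤˣ} {n : ℕ} {F : ℂ × ℂ → ℂ} {ρ : Fin n → FracSeries ℂ}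
  {l m : Arc ℝ}

lemma ofReal_toReal_fHeight (hfin : fHeight f l ≠ ⊤) :
    ENNReal.ofReal (fHeight f l).toReal = fHeight f l := ENNReal.ofReal_toReal hfin

lemma one_le_toReal_fHeight (h : RootSystem f σ n F ρ) (hl : l ∈ halfArcs σ)
    (hfin : fHeight f l ≠ ⊤) : 1 ≤ (fHeight f l).toReal := by
  have := (ENNReal.toReal_le_toReal ENNReal.one_ne_top hfin).2 (h.one_le_fHeight hl)
  simpa using this

/-- A root realizing the height of an arc. -/
lemma exists_mem_cluster (h : RootSystem f σ n F ρ) (hl : l ∈ halfArcs σ)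
    (hfin : fHeight f l ≠ ⊤) :
    ∃ i ∈ cluster ρ (arcSeries σ l).ofReal (fHeight f l).toReal,
      (ρ i).coeff (fHeight f l).toReal ≠ ((arcSeries σ l).coeff (fHeight f l).toReal : ℂ) := by
  obtain ⟨i, hi⟩ := h.exists_fHeight_eq hl
  rw [← ofReal_toReal_fHeight hfin] at hi
  have h1 : ∀ e < (fHeight f l).toReal, (ρ i).coeff e = (arcSeries σ l).ofReal.coeff e := by
    intro e he
    have := FracSeries.ofReal_le_ord.1 hi.le e he
    rw [FracSeries.coeff_sub, sub_eq_zero] at this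
    exact this.symm
  refine ⟨i, mem_cluster.2 h1, fun heq => hi.not_lt ?_⟩
  rw [FracSeries.ofReal_lt_ord ENNReal.toReal_nonneg]
  intro e he
  rw [FracSeries.coeff_sub, sub_eq_zero]
  rcases he.lt_or_eq with he | rfl
  · exact (h1 e he).symm
  · rw [heq, FracSeries.coeff_ofReal]

/-- An arc that agrees with `l` below the height of `l` has the same height exactly if its
coordinate is not a `B`-root of `f`; otherwise it is closer to some root. -/
lemma fHeight_eq_iff (h : RootSystem f σ n F ρ) (hl : l ∈ halfArcs σ) (hm : m ∈ halfArcs σ)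
    (hfin : fHeight f l ≠ ⊤) (hlm : ∀ e < (fHeight f l).toReal,
      (arcSeries σ m).coeff e = (arcSeries σ l).coeff e) :
    fHeight f m = fHeight f l ↔ (clusterPoly ρ (arcSeries σ l).ofReal (fHeight f l).toReal).eval
      ((arcSeries σ m).coeff (fHeight f l).toReal : ℂ) ≠ 0 := by
  set t := (fHeight f l).toReal with ht
  have hlow : ∀ i ∈ cluster ρ (arcSeries σ l).ofReal t, ∀ e < t,
      ((arcSeries σ m).ofReal - ρ i).coeff e = 0 := fun i hi e he => by
    rw [FracSeries.coeff_sub, FracSeries.coeff_ofReal, hlm e he, mem_cluster.1 hi e he,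
      FracSeries.coeff_ofReal, sub_self]
  rw [eval_clusterPoly_ne_zero]
  constructor
  · intro heq i hi hz
    refine (h.ord_le_fHeight hm i).not_gt ?_
    rw [heq, ← ofReal_toReal_fHeight hfin, FracSeries.ofReal_lt_ord ENNReal.toReal_nonneg]
    intro e he
    rcases he.lt_or_eq with he | rfl
    · exact hlow i hi e he
    · rw [FracSeries.coeff_sub, FracSeries.coeff_ofReal, hz, sub_self]
  · intro hne
    rw [← ofReal_toReal_fHeight hfin, h.fHeight_eq hm]
    have hord : ∀ i ∈ cluster ρ (arcSeries σ l).ofReal t,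
        ((arcSeries σ m).ofReal - ρ i).ord = ENNReal.ofReal t := fun i hi =>
      FracSeries.ord_eq_of_leading (by
        rw [FracSeries.coeff_sub, FracSeries.coeff_ofReal, sub_ne_zero]
        exact hne i hi) (hlow i hi)
    refine le_antisymm (iSup_le fun i => ?_) ?_
    · by_cases hi : i ∈ cluster ρ (arcSeries σ l).ofReal t
      · exact (hord i hi).le
      · simp only [mem_cluster, not_forall] at hi
        obtain ⟨e, he, hne⟩ := hi
        refine (iInf₂_le e ?_).trans (ENNReal.ofReal_le_ofReal he.le)
        rw [FracSeries.coeff_sub, FracSeries.coeff_ofReal, hlm e he, sub_ne_zero]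
        exact fun h' => hne h'.symm
    · obtain ⟨i, hi, -⟩ := h.exists_mem_cluster hl hfin
      rw [← ht, ← hord i hi]
      exact le_iSup (fun i => ((arcSeries σ m).ofReal - ρ i).ord) i

lemma fArc_mem_bar_iff_coeff (h : RootSystem f σ n F ρ) (hl : l ∈ halfArcs σ) (hm : m ∈ halfArcs σ)
    (hfin : fHeight f l ≠ ⊤) : fArc f m ∈ bar f σ l ↔ fHeight f m = fHeight f l ∧
      ∀ e < (fHeight f l).toReal, (arcSeries σ m).coeff e = (arcSeries σ l).coeff e := by
  rw [h.fArc_mem_bar_iff hl hm hfin]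
  refine and_congr_right fun _ => ?_
  rw [← ofReal_toReal_fHeight hfin, FracSeries.ofReal_le_ord]
  rw [ofReal_toReal_fHeight hfin]
  exact forall₂_congr fun e _ => by rw [FracSeries.coeff_sub, sub_eq_zero, eq_comm]

/-- Changing the coefficient at the height `t` of an arc. -/
lemma exists_arc_coeff_eq (h : RootSystem f σ n F ρ) (hl : l ∈ halfArcs σ)
    (hfin : fHeight f l ≠ ⊤) (c : ℝ) : ∃ m ∈ halfArcs σ,
      (∀ e < (fHeight f l).toReal, (arcSeries σ m).coeff e = (arcSeries σ l).coeff e) ∧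
      (arcSeries σ m).coeff (fHeight f l).toReal = c := by
  set t := (fHeight f l).toReal with ht
  obtain ⟨i, -, hi⟩ := h.exists_mem_cluster hl hfin
  -- `t` is an exponent of `ρᵢ` or of the arc, hence rational
  obtain ⟨k, d, hd, hkd⟩ : ∃ k d : ℕ, 0 < d ∧ t = (k : ℝ) / d := by
    obtain ⟨d, hd, hsupp, -⟩ := ((arcSeries σ l).ofReal - ρ i).exists_hasDen
    obtain ⟨k, hk⟩ := hsupp t (by
      rw [FracSeries.coeff_sub, FracSeries.coeff_ofReal, sub_ne_zero]
      exact hi.symm)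
    exact ⟨k, d, hd, hk⟩
  have hco : ∀ e, (arcSeries σ l - FracSeries.monomial k d hd ((arcSeries σ l).coeff t - c)).coeff e
      = (arcSeries σ l).coeff e - if e = t then (arcSeries σ l).coeff t - c else 0 := fun e => by
    rw [FracSeries.coeff_sub, hkd]
    rfl
  have h1 := h.one_le_toReal_fHeight hl hfin
  obtain ⟨m, hm, hmeq⟩ := exists_arc_arcSeries_eq
    (α := arcSeries σ l - FracSeries.monomial k d hd ((arcSeries σ l).coeff t - c))
    (fun e he => by rw [hco, if_neg (he.trans_le h1).ne, arcSeries_coeff hl he, sub_zero]) σ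
  refine ⟨m, hm, fun e he => ?_, ?_⟩
  · rw [hmeq, hco, if_neg he.ne, sub_zero]
  · rw [hmeq, hco, if_pos rfl, sub_sub_cancel]

/-- The polynomial of a bar, and its derivative. -/
lemma exists_initialPoly (h : RootSystem f σ n F ρ) {n' : ℕ} {ρ' : Fin n' → FracSeries ℂ}
    (h' : PuiseuxRoots (partialX f) σ n' ρ')
    (hF' : IsComplexification (partialX f) (complexPartialX F)) (hl : l ∈ halfArcs σ)
    (hfin : fHeight f l ≠ ⊤) :
    ∃ (I : ℝ[X]) (A A' : ℂ) (e : ℝ), A ≠ 0 ∧ A' ≠ 0 ∧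
      I.map (algebraMap ℝ ℂ) =
        C A * clusterPoly ρ (arcSeries σ l).ofReal (fHeight f l).toReal ∧
      I.derivative.map (algebraMap ℝ ℂ) =
        C A' * clusterPoly ρ' (arcSeries σ l).ofReal (fHeight f l).toReal ∧
      ∀ μ : FracSeries ℝ, (∀ e' < (fHeight f l).toReal, μ.coeff e' = (arcSeries σ l).coeff e') →
        Tendsto (fun y => f (μ.eval y, ((σ : ℤ) : ℝ) * y) / y ^ e) (𝓝[>] 0)
          (𝓝 (I.eval (μ.coeff (fHeight f l).toReal))) := by
  set t := (fHeight f l).toReal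
  set α := (arcSeries σ l).ofReal
  have ht : 0 < t := one_pos.trans_le (h.one_le_toReal_fHeight hl hfin)
  have hα : α.coeff 0 = 0 := by
    rw [FracSeries.coeff_ofReal, arcSeries_coeff hl one_pos, Complex.ofReal_zero]
  obtain ⟨e, A, hA, hlim⟩ := h.roots.exists_initialForm h.complexification hα ht
  obtain ⟨i, hi, -⟩ := h.exists_mem_cluster hl hfin
  obtain ⟨A', hA', hD⟩ := exists_derivative_eq_C_mul_clusterPoly h' hF' hα ht hA ⟨i, hi⟩
    fun φ w hφ => (hlim φ w hφ).2
  -- along real paths, the values are real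
  have hreal : ∀ (φ : ℝ → ℝ) (u : ℝ), IsPathAt α t (fun y => (φ y : ℂ)) u →
      Tendsto (fun y => ((f (φ y, ((σ : ℤ) : ℝ) * y) / y ^ e : ℝ) : ℂ)) (𝓝[>] 0)
        (𝓝 ((C A * clusterPoly ρ α t).eval (u : ℂ))) := fun φ u hφ => by
    have hφ0 : Tendsto φ (𝓝[>] 0) (𝓝 0) := by
      have := (Complex.continuous_re.tendsto 0).comp (hφ.tendsto_zero ht hα)
      simpa [Function.comp_def] using this
    have hσ : Tendsto (fun y : ℝ => ((σ : ℤ) : ℝ) * y) (𝓝[>] 0) (𝓝 0) :=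
      (Continuous.tendsto' (by fun_prop) 0 0 (by simp)).mono_left nhdsWithin_le_nhds
    have hpt : Tendsto (fun y => (φ y, ((σ : ℤ) : ℝ) * y)) (𝓝[>] 0) (𝓝 (0 : ℝ × ℝ)) :=
      hφ0.prodMk_nhds hσ
    refine (hlim _ _ hφ).1.congr' ?_
    filter_upwards [hpt.eventually h.complexification.2, self_mem_nhdsWithin] with y h1 (hy : 0 < y)
    rw [h1, Real.rpow_neg hy.le, Complex.real_smul, div_eq_inv_mul]
    push_cast
    rfl
  have hclosed : ∀ (φ : ℝ → ℝ) (u : ℝ), IsPathAt α t (fun y => (φ y : ℂ)) u →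
      ∃ v : ℝ, (C A * clusterPoly ρ α t).eval (u : ℂ) = v := fun φ u hφ => by
    have h1 := (Complex.continuous_im.tendsto _).comp (hreal φ u hφ)
    have h2 : ((C A * clusterPoly ρ α t).eval (u : ℂ)).im = 0 := by
      refine tendsto_nhds_unique h1 (tendsto_const_nhds.congr fun y => ?_)
      simp only [Function.comp, Complex.ofReal_im]
    exact ⟨_, (Complex.ext rfl (by simpa using h2))⟩
  obtain ⟨I, hI⟩ := exists_map_eq_of_forall_real fun u => hclosed
    (fun y => (arcSeries σ l).eval y + y ^ t * (u - (arcSeries σ l).coeff t)) u (by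
      have := IsPathAt.add_rpow α t u
      simp only [α, FracSeries.eval_ofReal, FracSeries.coeff_ofReal, Complex.real_smul] at this
      simpa using this)
  refine ⟨I, A, A', e, hA, hA', hI, ?_, fun μ hμ => ?_⟩
  · rw [← derivative_map, hI, hD]
  · have h1 := hreal μ.eval (μ.coeff t) (by
      have := IsPathAt.eval (α := α) (t := t) (β := μ.ofReal) fun e' he' => by
        rw [FracSeries.coeff_ofReal, FracSeries.coeff_ofReal, hμ e' he']
      simpa only [FracSeries.coeff_ofReal, funext μ.eval_ofReal] using this)
    rw [← hI, eval_map_algebraMap, show ((μ.coeff t : ℝ) : ℂ) = algebraMap ℝ ℂ (μ.coeff t) from rfl,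
      aeval_algebraMap_apply] at h1
    have h2 := (Complex.continuous_re.tendsto _).comp h1
    simpa [Function.comp_def] using h2

end RootSystem

/-! ### Counting the critical points -/

lemma AnalyticAt.isRootGT_partialX {f : ℝ × ℝ → ℝ} (hf : AnalyticAt ℝ f 0) {σ : ℤˣ}
    {β : FracSeries ℂ} (h : IsRootGT f σ β 1) : IsRootGT (partialX f) σ β 0 := by
  obtain ⟨hβ, G, hG, hroot⟩ := h
  refine ⟨hβ, complexPartialX G, hG.partialX hf, fun i hi => ?_⟩
  obtain rfl : i = 0 := by omega
  filter_upwards [hroot 1 le_rfl] with y hy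
  rw [iteratedDeriv_one] at hy
  rw [iteratedDeriv_zero]
  exact hy

/-- `rootMult` counts the `j` for which the equation of the arc is a root of multiplicity greater
than `j`; these form an initial segment of `ℕ`. -/
lemma PuiseuxRoots.lt_rootMult_iff {f : ℝ × ℝ → ℝ} {σ : ℤˣ} {n : ℕ} {ρ : Fin n → FracSeries ℂ}
    (h : PuiseuxRoots f σ n ρ) (l : Arc ℝ) (j : ℕ) :
    (j : ℕ∞) < rootMult f σ l ↔ IsRootGT f σ (arcSeries σ l).ofReal j := by
  have h1 : {p : FracSeries ℂ × ℕ | (∀ e, p.1.coeff e = ((arcSeries σ l).coeff e : ℂ)) ∧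
      IsRootGT f σ p.1 p.2} = {p : FracSeries ℂ × ℕ | p.1 = (arcSeries σ l).ofReal ∧
      p.2 < {i | ρ i = p.1}.ncard} := by
    ext p
    simp only [Set.mem_ofPred_eq, h.isRootGT_iff, FracSeries.ext_iff, funext_iff,
      FracSeries.coeff_ofReal]
  rw [rootMult, h1, encard_setOf_lt_ncard_fiber ρ (· = (arcSeries σ l).ofReal), h.isRootGT_iff,
    Nat.cast_lt]

namespace RootSystem

variable {f : ℝ × ℝ → ℝ} {σ : ℤˣ} {n : ℕ} {F : ℂ × ℂ → ℂ} {ρ : Fin n → FracSeries ℂ}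
  {γ γ' : Arc ℝ} {r : Set (Set (Arc ℝ)) → ℝ} {β : FracSeries ℂ}

/-- The root `β` of `f_x` is attached to the real arc `γ`: it is the equation of `γ`, or agrees with
it to an order greater than the height of `γ`. -/
def IsRealCriticalRoot (f : ℝ × ℝ → ℝ) (σ : ℤˣ) (γ : Arc ℝ) (β : FracSeries ℂ) : Prop :=
  (arcSeries σ γ).ofReal = β ∨ fHeight f γ < ((arcSeries σ γ).ofReal - β).ord

/-- The root `β` of `f_x` is attached to the real arc `γ` although it leaves the real plane at the
height of `γ`; the arc `γ` has the coordinate chosen for its bar. -/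
structure IsGenericCriticalRoot (f : ℝ × ℝ → ℝ) (σ : ℤˣ) (r : Set (Set (Arc ℝ)) → ℝ) (γ : Arc ℝ)
    (β : FracSeries ℂ) : Prop where
  ne_top : fHeight f γ ≠ ⊤
  coeff_eq : ∀ e < (fHeight f γ).toReal, β.coeff e = ((arcSeries σ γ).coeff e : ℂ)
  coeff_ne : ∀ c : ℝ, β.coeff (fHeight f γ).toReal ≠ (c : ℂ)
  canonCoord_eq : canonCoord f σ γ = r (bar f σ γ)

/-- A root of `f_x` lies in at most one `f`-arc: two arcs closer to the root than their heights are
closer to each other than the smaller height, by the ultrametric inequality. -/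
lemma fArc_eq_of_isRealCriticalRoot (h : RootSystem f σ n F ρ) (hγ : γ ∈ halfArcs σ)
    (hγ' : γ' ∈ halfArcs σ) (h1 : IsRealCriticalRoot f σ γ β) (h2 : IsRealCriticalRoot f σ γ' β) :
    fArc f γ = fArc f γ' := by
  wlog hle : fHeight f γ ≤ fHeight f γ' generalizing γ γ'
  · exact (this hγ' hγ h2 h1 (le_of_not_ge hle)).symm
  have hord : ((arcSeries σ γ).ofReal - (arcSeries σ γ').ofReal).ord =
      (arcSeries σ γ - arcSeries σ γ').ord := by
    rw [← FracSeries.ofReal_sub, FracSeries.ord_ofReal]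
  rcases h1 with rfl | h1
  · rcases h2 with h2 | h2
    · exact (h.fArc_eq_iff hγ hγ').2 (Or.inl (FracSeries.ofReal_injective h2.symm))
    · refine ((h.fArc_eq_iff hγ' hγ).2 (Or.inr ?_)).symm
      rwa [FracSeries.ord_sub_comm, hord, FracSeries.ord_sub_comm] at h2
  · refine (h.fArc_eq_iff hγ hγ').2 (Or.inr ?_)
    rw [← hord]
    rcases h2 with rfl | h2
    · exact h1
    · refine (lt_min h1 (hle.trans_lt h2)).trans_le ?_
      rw [FracSeries.ord_sub_comm (arcSeries σ γ').ofReal]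
      exact FracSeries.min_le_ord_sub _ _ _

lemma IsGenericCriticalRoot.ord_le (h2 : IsGenericCriticalRoot f σ r γ β) (μ : FracSeries ℝ) :
    (μ.ofReal - β).ord ≤ fHeight f γ := by
  rw [← ofReal_toReal_fHeight h2.ne_top]
  refine iInf₂_le _ ?_
  rw [FracSeries.coeff_sub, FracSeries.coeff_ofReal, sub_ne_zero]
  exact (h2.coeff_ne _).symm

lemma IsGenericCriticalRoot.le_ord (h2 : IsGenericCriticalRoot f σ r γ β) :
    fHeight f γ ≤ ((arcSeries σ γ).ofReal - β).ord := by
  rw [← ofReal_toReal_fHeight h2.ne_top, FracSeries.ofReal_le_ord]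
  intro e he
  rw [FracSeries.coeff_sub, FracSeries.coeff_ofReal, sub_eq_zero]
  exact (h2.coeff_eq e he).symm

/-- A root of `f_x` cannot be attached to arcs in both ways: leaving the real plane at the height of
`γ'` bounds its order of coincidence with every real arc by this height. -/
lemma not_isRealCriticalRoot_of_isGenericCriticalRoot (h : RootSystem f σ n F ρ)
    (hγ : γ ∈ halfArcs σ) (hγ' : γ' ∈ halfArcs σ) (h1 : IsRealCriticalRoot f σ γ β)
    (h2 : IsGenericCriticalRoot f σ r γ' β) : False := by
  have hle := h2.ord_le (arcSeries σ γ)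
  rcases h1 with rfl | h1
  · rw [FracSeries.ord_sub_eq_top.2 rfl] at hle
    exact h2.ne_top (top_le_iff.1 hle)
  · have h3 : fHeight f γ < (arcSeries σ γ - arcSeries σ γ').ord := by
      rw [← FracSeries.ord_ofReal, FracSeries.ofReal_sub]
      refine (lt_min h1 ?_).trans_le (FracSeries.min_le_ord_sub _ β _)
      rw [FracSeries.ord_sub_comm]
      exact (h1.trans_le hle).trans_le h2.le_ord
    have h4 := h.fHeight_eq_of_lt hγ hγ' h3
    rw [h4] at hle
    exact h1.not_ge hle

/-- A root of `f_x` that leaves the real plane determines the bar, hence, through the chosen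
coordinate of the bar, the `f`-arc. -/
lemma fArc_eq_of_isGenericCriticalRoot (h : RootSystem f σ n F ρ) (hγ : γ ∈ halfArcs σ)
    (hγ' : γ' ∈ halfArcs σ) (h1 : IsGenericCriticalRoot f σ r γ β)
    (h2 : IsGenericCriticalRoot f σ r γ' β) : fArc f γ = fArc f γ' := by
  have heq : fHeight f γ' = fHeight f γ :=
    le_antisymm (h2.le_ord.trans (h1.ord_le _)) (h1.le_ord.trans (h2.ord_le _))
  have hord : fHeight f γ ≤ (arcSeries σ γ - arcSeries σ γ').ord := by
    rw [← FracSeries.ord_ofReal, FracSeries.ofReal_sub]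
    refine (le_min h1.le_ord ?_).trans (FracSeries.min_le_ord_sub _ β _)
    rw [FracSeries.ord_sub_comm, ← heq]
    exact h2.le_ord
  have hcoord : canonCoord f σ γ' = canonCoord f σ γ := by
    rw [h1.canonCoord_eq, h2.canonCoord_eq, h.bar_eq hγ hγ' h1.ne_top heq hord]
  refine (h.fArc_eq_iff hγ hγ').2 (Or.inr ?_)
  rw [canonCoord, canonCoord, heq] at hcoord
  rw [← ofReal_toReal_fHeight h1.ne_top] at hord ⊢
  rw [FracSeries.ofReal_lt_ord ENNReal.toReal_nonneg]
  intro e he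
  rcases he.lt_or_eq with he | rfl
  · exact FracSeries.ofReal_le_ord.1 hord e he
  · rw [FracSeries.coeff_sub, hcoord, sub_self]

/-- Every critical point is attached to a root of `f_x`. -/
lemma exists_root_of_mem_criticalPoints (hf : AnalyticAt ℝ f 0) (h : RootSystem f σ n F ρ)
    {n' : ℕ} {ρ' : Fin n' → FracSeries ℂ} (h' : PuiseuxRoots (partialX f) σ n' ρ')
    {c : Set (Arc ℝ)} (hc : c ∈ criticalPoints f σ r) :
    ∃ j, ∃ γ ∈ halfArcs σ, c = fArc f γ ∧
      (IsRealCriticalRoot f σ γ (ρ' j) ∨ IsGenericCriticalRoot f σ r γ (ρ' j)) := by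
  obtain ⟨γ, hγ, rfl, ⟨k, hfin, hk, hcard⟩ | ⟨k, -, hk, hmult⟩ | ⟨hfin, ⟨z, hz⟩, hno, hcoord⟩⟩ := hc
  · have hroot : IsBRoot f (partialX f) σ γ (canonCoord f σ γ : ℂ) := by
      rw [IsBRoot, ← Set.encard_ne_zero, hcard]
      exact_mod_cast (by omega : k ≠ 0)
    obtain ⟨j, hj, hjc⟩ := (h'.isBRoot_iff γ _).1 hroot
    refine ⟨j, γ, hγ, rfl, Or.inl (Or.inr ?_)⟩
    nth_rw 1 [← ofReal_toReal_fHeight hfin]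
    rw [FracSeries.ofReal_lt_ord ENNReal.toReal_nonneg]
    intro e he
    rw [FracSeries.coeff_sub, sub_eq_zero]
    rcases he.lt_or_eq with he | rfl
    · exact (mem_cluster.1 hj e he).symm
    · rw [hjc]
      rfl
  · have h1 : ((1 : ℕ) : ℕ∞) < rootMult f σ γ := by
      rw [hmult]
      exact_mod_cast (by omega : 1 < k + 1)
    have h2 := (h'.isRootGT_iff _ _).1 (hf.isRootGT_partialX ((h.roots.lt_rootMult_iff γ 1).1 h1))
    obtain ⟨j, hj⟩ := (Set.ncard_pos (Set.toFinite _)).1 h2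
    exact ⟨j, γ, hγ, rfl, Or.inl (Or.inl (Eq.symm hj))⟩
  · obtain ⟨j, hj, -⟩ := (h'.isBRoot_iff γ _).1 hz
    refine ⟨j, γ, hγ, rfl, Or.inr ⟨hfin, mem_cluster.1 hj, fun c hc => hno c ?_, hcoord⟩⟩
    exact (h'.isBRoot_iff γ _).2 ⟨j, hj, hc⟩

/-- Choosing for each critical point a root of `f_x` attached to it gives an injective map from the
critical points to the list of roots of `f_x`. -/
lemma encard_criticalPoints_le (hf : AnalyticAt ℝ f 0) (h : RootSystem f σ n F ρ)
    {n' : ℕ} {ρ' : Fin n' → FracSeries ℂ} (h' : PuiseuxRoots (partialX f) σ n' ρ')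
    (r : Set (Set (Arc ℝ)) → ℝ) : (criticalPoints f σ r).encard ≤ n' := by
  have key := fun c : criticalPoints f σ r => h.exists_root_of_mem_criticalPoints hf h' c.2
  choose j γ hγ hc hroot using key
  have hinj : Function.Injective j := fun c c' hcc => by
    refine Subtype.ext ?_
    rw [hc c, hc c']
    have h2 := hroot c'
    rw [← hcc] at h2
    rcases hroot c with h1 | h1 <;> rcases h2 with h2 | h2
    · exact h.fArc_eq_of_isRealCriticalRoot (hγ c) (hγ c') h1 h2
    · exact (h.not_isRealCriticalRoot_of_isGenericCriticalRoot (hγ c) (hγ c') h1 h2).elim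
    · exact (h.not_isRealCriticalRoot_of_isGenericCriticalRoot (hγ c') (hγ c) h2 h1).elim
    · exact h.fArc_eq_of_isGenericCriticalRoot (hγ c) (hγ c') h1 h2
  have := ENat.card_le_card_of_injective hinj
  simpa using this

end RootSystem

/-- Mini-regularity makes the order in `x` equal to the multiplicity, both for `f` and, with
`m(f) - 1`, for `f_x`. -/
lemma exists_rootSystem {f : ℝ × ℝ → ℝ} (hf : AnalyticAt ℝ f 0) (hf0 : f 0 = 0)
    (hreg : IsMiniRegular f) (σ : ℤˣ) :
    ∃ (F : ℂ × ℂ → ℂ) (ρ : Fin (mult f) → FracSeries ℂ) (ρ' : Fin (mult f - 1) → FracSeries ℂ),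
      RootSystem f σ (mult f) F ρ ∧ PuiseuxRoots (partialX f) σ (mult f - 1) ρ' := by
  have hpos : 0 < mult f := by
    rw [Nat.pos_iff_ne_zero]
    intro h0
    have hA : AnalyticAt ℝ (fun x : ℝ => f (x, 0)) 0 :=
      AnalyticAt.comp₂ (h := f) (f := fun x => x) (g := fun _ => (0 : ℝ)) (x := (0 : ℝ)) hf
        analyticAt_id analyticAt_const
    rw [IsMiniRegular, h0, Nat.cast_zero, hA.analyticOrderAt_eq_zero] at hreg
    exact hreg hf0
  obtain ⟨F, hF, hord⟩ := exists_isComplexification hf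
  have hn := hF.analyticOrderAt_eq hf hreg
  obtain ⟨ρ, hρ⟩ := exists_puiseuxRoots hF hord hn σ
  have hsub : mult f - 1 + 1 = mult f := Nat.sub_add_cancel hpos
  have hord' : OrderGE (mult f - 1) (complexPartialX F) := by
    refine OrderGE.complexPartialX hF.1 ?_
    rwa [hsub]
  have hn' : analyticOrderAt (fun x : ℂ => complexPartialX F (x, 0)) 0 = (mult f - 1 : ℕ) := by
    have h1 := (AnalyticAt.axis hF.1).analyticOrderAt_deriv_add_one
    have h0 : F (0, 0) = 0 := by
      have := hF.2.self_of_nhds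
      simp only [Prod.fst_zero, Prod.snd_zero, Complex.ofReal_zero, hf0] at this
      exact this
    simp only [h0, sub_zero] at h1
    rw [hn, ← hsub, Nat.cast_add, Nat.cast_one] at h1
    exact (ENat.add_left_injective_of_ne_top ENat.one_ne_top) h1
  obtain ⟨ρ', hρ'⟩ := exists_puiseuxRoots (hF.partialX hf) hord' hn' σ
  exact ⟨F, ρ, ρ', ⟨hpos, hF, hρ⟩, hρ'⟩

/-! ### The polynomial and the critical points of a bar -/

theorem mainTheorem4 (f : ℝ × ℝ → ℝ) (hf : AnalyticAt ℝ f 0) (hf0 : f 0 = 0)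
    (hreg : IsMiniRegular f) (σ : ℤˣ) :
    (∀ l ∈ halfArcs σ, fHeight f l ≠ ⊤ →
      ∃ I : ℝ[X],
        (∀ Q : ℝ[X], IsInitialPoly f σ l Q ↔ Q = I) ∧
        (∃ a : ℝ, a ≠ 0 ∧ ∃ hfin : {z : ℂ | IsBRoot f f σ l z}.Finite,
          (∀ z, (bRoots f f σ l z).Finite) ∧
          I.map (algebraMap ℝ ℂ) =
            C (a : ℂ) * ∏ z ∈ hfin.toFinset, (X - C z) ^ (bRoots f f σ l z).ncard) ∧
        (∀ γ ∈ halfArcs σ, fArc f γ ∈ bar f σ l → ∀ k : ℕ,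
          (IsOrdinaryCritical f σ γ k ↔
            I.derivative.eval (canonCoord f σ γ) = 0 ∧ I.eval (canonCoord f σ γ) ≠ 0 ∧
              I.derivative.rootMultiplicity (canonCoord f σ γ) = k)) ∧
        (∀ c : ℝ, I.eval c ≠ 0 →
          ∃ γ ∈ halfArcs σ, fArc f γ ∈ bar f σ l ∧ canonCoord f σ γ = c)) ∧
    (∀ r : Set (Set (Arc ℝ)) → ℝ, (criticalPoints f σ r).encard ≤ (mult f - 1 : ℕ)) := by
  classical
  obtain ⟨F, ρ, ρ', h, h'⟩ := exists_rootSystem hf hf0 hreg σ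
  refine ⟨fun l hl hfin => ?_, fun r => h.encard_criticalPoints_le hf h' r⟩
  obtain ⟨I, A, A', e, hA, hA', hI, hD, hlim⟩ :=
    h.exists_initialPoly h' (h.complexification.partialX hf) hl hfin
  have hmap : ∀ (P : ℝ[X]) (c : ℝ), (P.map (algebraMap ℝ ℂ)).eval (c : ℂ) = ((P.eval c : ℝ) : ℂ) :=
    fun P c => by
      rw [show (c : ℂ) = algebraMap ℝ ℂ c from rfl, eval_map_algebraMap, aeval_algebraMap_apply]
      simp
  have hIne : ∀ c : ℝ, I.eval c ≠ 0 ↔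
      (clusterPoly ρ (arcSeries σ l).ofReal (fHeight f l).toReal).eval (c : ℂ) ≠ 0 := fun c => by
    rw [← Complex.ofReal_ne_zero, ← hmap, hI, eval_mul, eval_C, mul_ne_zero_iff_left hA]
  have hI0 : I ≠ 0 := by
    rintro rfl
    rw [Polynomial.map_zero] at hI
    exact mul_ne_zero (C_ne_zero.2 hA) clusterPoly_ne_zero hI.symm
  have hD0 : I.derivative ≠ 0 := by
    intro h0
    rw [h0, Polynomial.map_zero] at hD
    exact mul_ne_zero (C_ne_zero.2 hA') clusterPoly_ne_zero hD.symm
  have hmem : ∀ m ∈ halfArcs σ, fArc f m ∈ bar f σ l → fHeight f m = fHeight f l ∧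
      (∀ e < (fHeight f l).toReal, (arcSeries σ m).coeff e = (arcSeries σ l).coeff e) ∧
      I.eval (canonCoord f σ m) ≠ 0 := fun m hm hbar => by
    obtain ⟨h1, h2⟩ := (h.fArc_mem_bar_iff_coeff hl hm hfin).1 hbar
    refine ⟨h1, h2, (hIne _).2 ?_⟩
    rw [canonCoord, h1]
    exact (h.fHeight_eq_iff hl hm hfin h2).1 h1
  have hex : ∀ c : ℝ, I.eval c ≠ 0 →
      ∃ γ ∈ halfArcs σ, fArc f γ ∈ bar f σ l ∧ canonCoord f σ γ = c := fun c hc => by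
    obtain ⟨m, hm, h1, rfl⟩ := h.exists_arc_coeff_eq hl hfin c
    have h2 := (h.fHeight_eq_iff hl hm hfin h1).2 ((hIne _).1 hc)
    exact ⟨m, hm, (h.fArc_mem_bar_iff_coeff hl hm hfin).2 ⟨h2, h1⟩, by rw [canonCoord, h2]⟩
  have hlead : ∀ m ∈ halfArcs σ, fArc f m ∈ bar f σ l →
      HasLeadingTerm (fun y => f ((arcSeries σ m).eval y, ((σ : ℤ) : ℝ) * y))
        (I.eval (canonCoord f σ m)) e := fun m hm hbar => by
    obtain ⟨h1, h2, h3⟩ := hmem m hm hbar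
    refine ⟨h3, ?_⟩
    rw [canonCoord, h1]
    exact hlim _ h2
  refine ⟨I, fun Q => ⟨?_, ?_⟩, ?_, fun γ hγ hbar k => ?_, hex⟩
  -- the canonical coordinates of the bar are all but finitely many real numbers, so they determine
  -- the polynomial
  · rintro ⟨e', hQ⟩
    have hfinI : {c | I.eval c = 0}.Finite :=
      I.roots.toFinset.finite_toSet.subset fun c hc => by simpa [hI0] using hc
    refine eq_of_infinite_eval_eq _ _ (hfinI.infinite_compl.mono fun c hc => ?_)
    obtain ⟨γ, hγ, hbar, rfl⟩ := hex c hc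
    obtain ⟨h1, h2⟩ := hQ γ hγ hbar
    obtain ⟨h3, h4⟩ := hlead γ hγ hbar
    have hsmul : ∀ (E : ℝ) (v : ℝ),
        Tendsto (fun y => f ((arcSeries σ γ).eval y, ((σ : ℤ) : ℝ) * y) / y ^ E) (𝓝[>] 0) (𝓝 v) →
        Tendsto (fun y => y ^ (-E) • f ((arcSeries σ γ).eval y, ((σ : ℤ) : ℝ) * y)) (𝓝[>] 0)
          (𝓝 v) := fun E v hv => by
      refine hv.congr' ?_
      filter_upwards [self_mem_nhdsWithin] with y (hy : 0 < y)
      rw [Real.rpow_neg hy.le, smul_eq_mul, div_eq_inv_mul]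
    obtain rfl := rpow_scale_unique h1 h3 (hsmul _ _ h2) (hsmul _ _ h4)
    exact tendsto_nhds_unique h2 h4
  · rintro rfl
    exact ⟨e, hlead⟩
  · have hfinB : {z : ℂ | IsBRoot f f σ l z}.Finite := by
      rw [h.roots.setOf_isBRoot]
      exact Finset.finite_toSet _
    -- the cluster polynomial is monic, so the constant is the leading coefficient of `I`, hence
    -- real
    have hA_eq : A = (I.leadingCoeff : ℂ) := by
      have h1 := congrArg leadingCoeff hI
      rw [leadingCoeff_map, leadingCoeff_mul, leadingCoeff_C,
        (show (clusterPoly ρ (arcSeries σ l).ofReal (fHeight f l).toReal).Monic from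
          monic_prod_X_sub_C _ _).leadingCoeff, mul_one] at h1
      exact h1.symm
    refine ⟨I.leadingCoeff, leadingCoeff_ne_zero.2 hI0, hfinB, fun z => ?_, ?_⟩
    · rw [← Set.encard_ne_top_iff, h.roots.encard_bRoots]
      exact ENat.natCast_ne_top _
    · rw [hI, h.roots.clusterPoly_eq_prod l hfinB, hA_eq]
  · obtain ⟨h1, h2, h3⟩ := hmem γ hγ hbar
    have hcard : (bRoots f (partialX f) σ γ (canonCoord f σ γ : ℂ)).encard =
        (I.derivative.rootMultiplicity (canonCoord f σ γ) : ℕ∞) := by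
      rw [h'.encard_bRoots, h1, cluster_congr (α := (arcSeries σ l).ofReal) fun e he => by
        rw [FracSeries.coeff_ofReal, FracSeries.coeff_ofReal, h2 e he],
        ← rootMultiplicity_C_mul_clusterPoly hA', ← hD,
        eq_rootMultiplicity_map (algebraMap ℝ ℂ).injective]
      rfl
    rw [IsOrdinaryCritical, hcard, h1, Nat.cast_inj]
    constructor
    · rintro ⟨-, hk, rfl⟩
      exact ⟨(rootMultiplicity_pos hD0).1 hk, h3, rfl⟩
    · rintro ⟨h4, -, rfl⟩
      exact ⟨hfin, (rootMultiplicity_pos hD0).2 h4, rfl⟩
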